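/- **Setting.** Let $b:\mathbb R^n\to\mathbb R^n$ be $C^1$ and let $D$ be a constant symmetric positive definite $n\times n$ matrix. For $0<\epsilon<\epsilon_0$ let $\pi_\epsilon$ be a stationary probability density of $dX=b(X)\,dt+[2\epsilon D]^{1/2}dB$, i.e. $\pi_\epsilon\ge 0$ is $C^2$, $\int_{\mathbb R^n}\pi_\epsilon=1$ and $\nabla\cdot(b\,\pi_\epsilon-\epsilon D\nabla\pi_\epsilon)=0$ on $\mathbb R^n$. Let $\Gamma$ be a nonconstant closed orbit of $\dot x=b(x)$, and let $\mathcal D$ be a compact set that is the closure of its interior, contains $\Gamma$ in its interior, and is such that every trajectory of $\dot x=b(x)$ starting in $\mathcal D$ stays in $\mathcal D$ for all positive times and converges to $\Gamma$ (so $\Gamma$ is an attracting limit cycle). Let $\varphi\in C^4$ and $\omega\in C^2$ be real functions on an open neighbourhood of $\mathcal D$, with $\omega>0$ on $\mathcal D$, such that $$\pi_\epsilon(x)=a(\epsilon)\exp\Big[-\frac{\varphi(x)}{\epsilon}+\ln\omega(x)+O(\epsilon)\Big]\quad\text{uniformly for }x\in\mathcal D,\ \epsilon\to0,$$ with $a(\epsilon)>0$,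 and $\int_{\mathbb R^n\setminus\mathcal D}\pi_\epsilon=O(\epsilon)$. Suppose that at each point of $\Gamma$ the kernel of the Hessian $\nabla\nabla\varphi$ is at most one-dimensional. Put $\gamma=b+D\nabla\varphi$, and let $1/v(x)$ be the product of the nonzero eigenvalues of $\nabla\nabla\varphi(x)$. For small $\delta>0$, the marginal density $g_\epsilon=g_{\epsilon,\delta}$ of $\pi_\epsilon$ on $\Gamma$ is the continuous function on $\Gamma$ such that, for every Borel $A\subseteq\Gamma$, $\int_A g_\epsilon\,ds$ ($s$ = arc length) equals the $\pi_\epsilon$-mass of the union of the closed discs of radius $\delta$ centred at the points of $A$ in the hyperplanes perpendicular to $\Gamma$ there. **Theorem.** 1. $\sqrt{v(x)}\;\|\omega(x)\gamma(x)\|$ is constant on $\Gamma$. 2. There are a constant $K$ and a $\delta_0>0$ such that for every $0<\delta<\delta_0$ the marginal density $g_\epsilon$ exists for all small $\epsilon>0$ and, uniformly for $x\in\Gamma$ as $\epsilon\to0$ (the constant in $O(\epsilon)$ may depend on $\delta$), $$g_\epsilon(x)=\frac{\omega(x)\sqrt{v(x)}}{\int_\Gamma\omega\sqrt v\,ds}+O(\epsilon),\qquad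 g_\epsilon(x)\,\|\gamma(x)\|=K+O(\epsilon).$$ -/

import Mathlib

open Set Filter Topology MeasureTheory

noncomputable section

/-- The constant matrix `D` acting on `ℝⁿ`. -/
def diffAct {n : ℕ} (D : Matrix (Fin n) (Fin n) ℝ) (w : EuclideanSpace ℝ (Fin n)) :
    EuclideanSpace ℝ (Fin n) :=
  WithLp.toLp 2 (D.mulVec w.ofLp)

/-- Divergence of a vector field: the trace of its Jacobian. -/
def divergence {n : ℕ} (F : EuclideanSpace ℝ (Fin n) → EuclideanSpace ℝ (Fin n))
    (x : EuclideanSpace ℝ (Fin n)) : ℝ :=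
  LinearMap.trace ℝ (EuclideanSpace ℝ (Fin n)) (fderiv ℝ F x).toLinearMap

/-- The Hessian `∇∇φ(x)`, as an operator on `ℝⁿ`. -/
def hessian {n : ℕ} (φ : EuclideanSpace ℝ (Fin n) → ℝ) (x : EuclideanSpace ℝ (Fin n)) :
    EuclideanSpace ℝ (Fin n) →ₗ[ℝ] EuclideanSpace ℝ (Fin n) :=
  (fderiv ℝ (gradient φ) x).toLinearMap

open Classical in
/-- Product of the nonzero (real) eigenvalues, counted with multiplicity. -/
def prodNonzeroEigenvalues {n : ℕ}
    (L : EuclideanSpace ℝ (Fin n) →ₗ[ℝ] EuclideanSpace ℝ (Fin n)) : ℝ :=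
  (L.charpoly.roots.filter (fun l => l ≠ 0)).prod

/-- `v(x)`, where `1 / v(x)` is the product of the nonzero eigenvalues of `∇∇φ(x)`. -/
def scaledVariance {n : ℕ} (φ : EuclideanSpace ℝ (Fin n) → ℝ)
    (x : EuclideanSpace ℝ (Fin n)) : ℝ :=
  1 / prodNonzeroEigenvalues (hessian φ x)

/-- The field `γ` of the decomposition `b = -D ∇φ + γ`. -/
def circField {n : ℕ} (b : EuclideanSpace ℝ (Fin n) → EuclideanSpace ℝ (Fin n))
    (D : Matrix (Fin n) (Fin n) ℝ) (φ : EuclideanSpace ℝ (Fin n) → ℝ)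
    (x : EuclideanSpace ℝ (Fin n)) : EuclideanSpace ℝ (Fin n) :=
  b x + diffAct D (gradient φ x)

/-- The probability flux `J[p] = b p - ε D ∇p`. -/
def probFlux {n : ℕ} (b : EuclideanSpace ℝ (Fin n) → EuclideanSpace ℝ (Fin n))
    (D : Matrix (Fin n) (Fin n) ℝ) (ε : ℝ) (p : EuclideanSpace ℝ (Fin n) → ℝ)
    (x : EuclideanSpace ℝ (Fin n)) : EuclideanSpace ℝ (Fin n) :=
  p x • b x - ε • diffAct D (gradient p x)

/-- `p` is a stationary probability density of `dX = b(X) dt + (2εD)^{1/2} dB`: a probability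
density on `ℝⁿ` that solves the stationary Fokker–Planck equation `∇·J[p] = 0`. -/
structure IsStationaryDensity {n : ℕ}
    (b : EuclideanSpace ℝ (Fin n) → EuclideanSpace ℝ (Fin n))
    (D : Matrix (Fin n) (Fin n) ℝ) (ε : ℝ) (p : EuclideanSpace ℝ (Fin n) → ℝ) : Prop where
  nonneg : ∀ x, 0 ≤ p x
  contDiff : ContDiff ℝ 2 p
  integrable : Integrable p
  integral_eq_one : ∫ x, p x = 1
  stationary : ∀ x, divergence (probFlux b D ε p) x = 0

/-- `x` runs through a (nonconstant) closed orbit of `x' = b(x)` with minimal period `T`. -/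
structure IsClosedOrbit {n : ℕ}
    (b : EuclideanSpace ℝ (Fin n) → EuclideanSpace ℝ (Fin n))
    (x : ℝ → EuclideanSpace ℝ (Fin n)) (T : ℝ) : Prop where
  period_pos : 0 < T
  solves : ∀ t, HasDerivAt x (b (x t)) t
  periodic : Function.Periodic x T
  injOn : InjOn x (Ico 0 T)

/-- Every trajectory of `x' = b(x)` that starts in `𝒟` exists for all positive times, stays in
`𝒟` and converges to `Γ`. -/
def AttractedWithin {n : ℕ}
    (b : EuclideanSpace ℝ (Fin n) → EuclideanSpace ℝ (Fin n))
    (𝒟 Γ : Set (EuclideanSpace ℝ (Fin n))) : Prop :=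
  ∀ x₀ ∈ 𝒟, ∃ x : ℝ → EuclideanSpace ℝ (Fin n), x 0 = x₀ ∧
    (∀ t, 0 ≤ t → HasDerivWithinAt x (b (x t)) (Ici 0) t) ∧ (∀ t, 0 ≤ t → x t ∈ 𝒟) ∧
    Tendsto (fun t => Metric.infDist (x t) Γ) atTop (𝓝 0)

/-- The stationary WKB form
`π_ε(x) = a(ε) exp(-φ(x)/ε + ln ω(x) + O(ε))`, uniformly for `x ∈ 𝒟`, as `ε → 0`. -/
def HasWKBForm {n : ℕ} (𝒟 : Set (EuclideanSpace ℝ (Fin n)))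
    (φ ω : EuclideanSpace ℝ (Fin n) → ℝ) (ε₀ : ℝ)
    (π : ℝ → EuclideanSpace ℝ (Fin n) → ℝ) : Prop :=
  ∃ (a : ℝ → ℝ) (C : ℝ), ∀ ε ∈ Ioo 0 ε₀, 0 < a ε ∧ ∀ x ∈ 𝒟, ∃ r : ℝ, |r| ≤ C * ε ∧
    π ε x = a ε * Real.exp (-(φ x) / ε + Real.log (ω x) + r)

/-- Integral of `f` with respect to arc length along one turn of the closed orbit `x`. -/
def arcIntegral {n : ℕ} (x : ℝ → EuclideanSpace ℝ (Fin n)) (T : ℝ)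
    (f : EuclideanSpace ℝ (Fin n) → ℝ) : ℝ :=
  ∫ t in Ico 0 T, f (x t) * ‖deriv x t‖

/-- The union of the closed discs of radius `δ`, centred at the points `x t` with `t ∈ S`, in the
hyperplanes perpendicular to the orbit. -/
def normalTube {n : ℕ} (x : ℝ → EuclideanSpace ℝ (Fin n)) (δ : ℝ) (S : Set ℝ) :
    Set (EuclideanSpace ℝ (Fin n)) :=
  {y | ∃ t ∈ S, inner ℝ (deriv x t) (y - x t) = 0 ∧ ‖y - x t‖ ≤ δ}

/-- `g` is the marginal density of `p` on the closed orbit `x`: integrating out the directions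
perpendicular to the orbit in its tube of radius `δ`, the part of the tube that lies over a piece
of the orbit has as mass the integral of `g` over that piece with respect to arc length.
Continuity fixes `g` at every point of the orbit. -/
structure IsMarginalDensity {n : ℕ} (p : EuclideanSpace ℝ (Fin n) → ℝ)
    (x : ℝ → EuclideanSpace ℝ (Fin n)) (T δ : ℝ)
    (g : EuclideanSpace ℝ (Fin n) → ℝ) : Prop where
  continuousOn : ContinuousOn g (range x)
  mass_eq : ∀ S : Set ℝ, MeasurableSet S → S ⊆ Ico 0 T →
    ∫ y in normalTube x δ S, p y = ∫ t in S, g (x t) * ‖deriv x t‖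

end

/-! Write Γ for the cycle and u = b/‖b‖.

Geometry. Testing the weak stationary equation with χ e^{φ/ε} cancels the exponential of the WKB
form, and after multiplication by ε only the coefficient χ ω ∇φ·γ survives as ε → 0. Hence ∇φ·(b +
D∇φ) = 0 on 𝒟 (`fderiv_circField_eq_zero`); no derivative of the O(ε) remainder is taken. So φ
decreases along trajectories in 𝒟 at the rate ⟨∇φ, D∇φ⟩. On a periodic orbit it must then be
constant, which forces ∇φ = 0 and γ = b on Γ; since every trajectory in 𝒟 converges to Γ, φ is
minimal on Γ. The Hessian on Γ is therefore nonnegative and annihilates b, and the kernel hypothesis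
makes it positive definite across Γ. Adding the projection onto u gives the completed Hessian M,
which is positive definite with 1/v = det M.

Marginal density. In normal coordinates the disc integral of π_ε at y ∈ Γ is a Laplace integral with
Jacobian 1 − κ·w, κ the curvature vector. The relative correction of order √ε is odd and the disc is
symmetric, so the relative error is O(ε) (`laplace_expansion`, `IsWKBCycle.exists_laplace`). The
hyperplanes turn with y; to stay in one fixed space, an auxiliary Gaussian variable along u is
integrated as well, and it is this variable that completes the Hessian to M. The result is a common
scale times ω/√det M = ω√v. Off the tube φ exceeds its minimum by a fixed amount, so the mass is
negligible there, and total mass one determines the scale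
(`IsWKBFamily.exists_abs_massScale_sub_le`).

Constant flux. Consequently π_ε converges weakly to the normalized measure ω√v ds on Γ. In the limit
the weak equation reads ∫_Γ (b·∇ψ) ω√v ds = 0 for all test functions ψ; integrating by parts in time
shows that ω√v‖b‖ is constant along Γ (`IsWKBFamily.exists_leadingDensity_mul_norm_eq`). With γ = b
on Γ this is the first claim, and combined with the asymptotics of g it yields the second. -/

/-! ### Gaussian integrals and determinants of symmetric operators -/

/-- The Gaussian integral of a positive definite quadratic form. -/
theorem integral_exp_neg_inner_div {V : Type*} [NormedAddCommGroup V] [InnerProductSpace ℝ V]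
    [FiniteDimensional ℝ V] [MeasurableSpace V] [BorelSpace V] {M : V →ₗ[ℝ] V}
    (hM : M.IsSymmetric) (hpos : ∀ w, w ≠ 0 → 0 < inner ℝ (M w) w) {ε : ℝ} (hε : 0 < ε) :
    ∫ w : V, Real.exp (-(inner ℝ (M w) w) / (2 * ε)) =
      Real.sqrt (2 * Real.pi * ε) ^ Module.finrank ℝ V / Real.sqrt (LinearMap.det M) := by
  set e := hM.eigenvectorBasis rfl
  set μ := hM.eigenvalues rfl
  have hμ : ∀ i, 0 < μ i := by
    intro i
    have h1 := hpos (e i) (e.orthonormal.ne_zero i)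
    rw [hM.apply_eigenvectorBasis rfl i] at h1
    change 0 < inner ℝ (μ i • e i) (e i) at h1
    simpa [inner_smul_left] using h1
  have hquad : ∀ c : EuclideanSpace ℝ (Fin (Module.finrank ℝ V)),
      inner ℝ (M (e.repr.symm c)) (e.repr.symm c) = ∑ i, μ i * c i ^ 2 := by
    intro c
    have h2 : M (e.repr.symm c) = e.repr.symm (WithLp.toLp 2 fun i => μ i * c i) := by
      apply e.repr.injective
      ext i
      rw [hM.eigenvectorBasis_apply_self_apply rfl]
      simp [e, μ]
    rw [h2, LinearIsometryEquiv.inner_map_map, PiLp.inner_apply]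
    simp [pow_two]
    exact Finset.sum_congr rfl fun i _ => by ring
  -- In the orthonormal eigenbasis the form is diagonal, so the integral factors into
  -- one-dimensional Gaussians.
  rw [← e.repr.symm.measurePreserving.integral_comp e.repr.symm.toHomeomorph.measurableEmbedding]
  rw [← (PiLp.volume_preserving_toLp _).integral_comp
    (MeasurableEquiv.toLp 2 _).measurableEmbedding]
  simp_rw [hquad]
  have h3 : ∀ c : Fin (Module.finrank ℝ V) → ℝ,
      Real.exp (-(∑ i, μ i * c i ^ 2) / (2 * ε)) = ∏ i, Real.exp (-(μ i / (2 * ε)) * c i ^ 2) := by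
    intro c
    rw [← Real.exp_sum, ← Finset.sum_neg_distrib, Finset.sum_div]
    congr 1
    exact Finset.sum_congr rfl fun i _ => by ring
  simp_rw [h3]
  rw [integral_fintype_prod_volume_eq_prod
    (f := fun i (t : ℝ) => Real.exp (-(μ i / (2 * ε)) * t ^ 2))]
  simp_rw [integral_gaussian]
  rw [hM.det_eq_prod_eigenvalues rfl]
  have h4 : ∀ i, Real.sqrt (Real.pi / (μ i / (2 * ε))) =
      Real.sqrt (2 * Real.pi * ε) / Real.sqrt (μ i) := by
    intro i
    rw [← Real.sqrt_div (by positivity)]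
    congr 1
    field_simp
  simp_rw [h4, Finset.prod_div_distrib]
  congr 1
  · simp
  · exact (Real.sqrt_prod _ fun i _ => (hμ i).le).symm

/-- If the kernel is at most one-dimensional, it is spanned by any of its nonzero vectors. -/
theorem exists_smul_eq_of_finrank_ker_le_one {V : Type*} [AddCommGroup V] [Module ℝ V]
    [FiniteDimensional ℝ V] {H : V →ₗ[ℝ] V} {u w : V} (hu : u ≠ 0) (hHu : H u = 0)
    (hker : Module.finrank ℝ (LinearMap.ker H) ≤ 1) (hw : H w = 0) : ∃ c : ℝ, c • u = w := by
  rcases finrank_le_one_iff.1 hker with ⟨v, hv⟩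
  obtain ⟨c, hc⟩ := hv ⟨u, hHu⟩
  obtain ⟨d, hd⟩ := hv ⟨w, hw⟩
  have hc0 : c ≠ 0 := by
    rintro rfl
    apply hu
    simpa using (congrArg Subtype.val hc).symm
  refine ⟨d / c, ?_⟩
  have h1 : c • (v : V) = u := congrArg Subtype.val hc
  have h2 : d • (v : V) = w := congrArg Subtype.val hd
  rw [← h1, ← h2, smul_smul, div_mul_cancel₀ _ hc0]

theorem det_pos_of_inner_pos {V : Type*} [NormedAddCommGroup V] [InnerProductSpace ℝ V]
    [FiniteDimensional ℝ V] {M : V →ₗ[ℝ] V} (hM : M.IsSymmetric)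
    (hpos : ∀ w, w ≠ 0 → 0 < inner ℝ (M w) w) : 0 < LinearMap.det M := by
  rw [hM.det_eq_prod_eigenvalues rfl]
  refine Finset.prod_pos fun i _ => ?_
  have h1 := hpos (hM.eigenvectorBasis rfl i) ((hM.eigenvectorBasis rfl).orthonormal.ne_zero i)
  rw [hM.apply_eigenvectorBasis rfl i] at h1
  simpa [inner_smul_left] using h1

/-- For a symmetric operator with kernel at most the line of the unit vector `u`, the product of
the nonzero eigenvalues is the determinant after adding the projection onto `u`. -/
theorem prodNonzeroEigenvalues_eq_det {n : ℕ}
    {H : EuclideanSpace ℝ (Fin n) →ₗ[ℝ] EuclideanSpace ℝ (Fin n)} (hH : H.IsSymmetric)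
    {u : EuclideanSpace ℝ (Fin n)} (hu : ‖u‖ = 1) (hHu : H u = 0)
    (hker : Module.finrank ℝ (LinearMap.ker H) ≤ 1) :
    prodNonzeroEigenvalues H =
      LinearMap.det (H + (innerₛₗ ℝ u).smulRight u) := by
  classical
  set e := hH.eigenvectorBasis rfl
  set μ := hH.eigenvalues rfl
  have hu0 : u ≠ 0 := by rintro rfl; simp at hu
  have hspan : ∀ w, H w = 0 → ∃ c : ℝ, c • u = w := fun w hw =>
    exists_smul_eq_of_finrank_ker_le_one hu0 hHu hker hw
  have hHe : ∀ i, H (e i) = μ i • e i := fun i => hH.apply_eigenvectorBasis rfl i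
  -- The eigenbasis of H also diagonalizes the completed operator: null eigenvectors are multiples
  -- of u and get eigenvalue 1, the others are orthogonal to u by symmetry and keep theirs.
  have hMe : ∀ i, (H + (innerₛₗ ℝ u).smulRight u) (e i) =
      (if μ i ≠ 0 then μ i else 1) • e i := by
    intro i
    by_cases h : μ i = 0
    · have h0 : H (e i) = 0 := by rw [hHe, h, zero_smul]
      obtain ⟨c, hc⟩ := hspan _ h0
      simp only [LinearMap.add_apply, h0, LinearMap.smulRight_apply, innerₛₗ_apply_apply, h]
      rw [← hc, inner_smul_right, real_inner_self_eq_norm_sq, hu]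
      simp
    · have : inner ℝ u (e i) = 0 := by
        have h1 : inner ℝ (H u) (e i) = inner ℝ u (H (e i)) := hH u (e i)
        rw [hHu, hHe, inner_zero_left, inner_smul_right] at h1
        rcases mul_eq_zero.1 h1.symm with h2 | h2
        · exact absurd h2 h
        · exact h2
      simp [this, h, hHe]
  have hdet : LinearMap.det (H + (innerₛₗ ℝ u).smulRight u) =
      ∏ i, (if μ i ≠ 0 then μ i else 1) := by
    rw [← LinearMap.det_toMatrix e.toBasis]
    have : LinearMap.toMatrix e.toBasis e.toBasis (H + (innerₛₗ ℝ u).smulRight u) =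
        Matrix.diagonal fun i => (if μ i ≠ 0 then μ i else 1) := by
      ext i j
      rw [LinearMap.toMatrix_apply, OrthonormalBasis.coe_toBasis, hMe, map_smul,
        Finsupp.smul_apply, OrthonormalBasis.coe_toBasis_repr_apply, e.repr_self]
      by_cases hij : i = j
      · subst hij; simp
      · simp [hij]
    rw [this, Matrix.det_diagonal]
  rw [hdet, prodNonzeroEigenvalues, hH.roots_charpoly_eq_eigenvalues rfl, Finset.prod_ite]
  simp only [Multiset.filter_map, Finset.prod_const_one, mul_one]
  rfl

/-! ### Laplace's method with relative error O(ε) -/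

/-- Third order Taylor expansion on `[0, 1]`. -/
theorem abs_sub_taylor_three_le {f f1 f2 f3 : ℝ → ℝ} {K : ℝ}
    (h0 : ∀ s ∈ Icc (0 : ℝ) 1, HasDerivAt f (f1 s) s)
    (h1 : ∀ s ∈ Icc (0 : ℝ) 1, HasDerivAt f1 (f2 s) s)
    (h2 : ∀ s ∈ Icc (0 : ℝ) 1, HasDerivAt f2 (f3 s) s)
    (h3 : ∀ s ∈ Icc (0 : ℝ) 1, |f3 s - f3 0| ≤ K) :
    |f 1 - f 0 - f1 0 - f2 0 / 2 - f3 0 / 6| ≤ K := by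
  have hK : 0 ≤ K := (abs_nonneg _).trans (h3 0 (by simp))
  -- The mean value inequality from 0, applied to the successive remainders; factorials are given
  -- away since only some uniform constant matters.
  have key : ∀ g g' : ℝ → ℝ, (∀ s ∈ Icc (0 : ℝ) 1, HasDerivAt g (g' s) s) → g 0 = 0 →
      (∀ s ∈ Icc (0 : ℝ) 1, |g' s| ≤ K) → ∀ s ∈ Icc (0 : ℝ) 1, |g s| ≤ K := by
    intro g g' hg hg0 hb s hs
    have h := (convex_Icc (0 : ℝ) 1).norm_image_sub_le_of_norm_hasDerivWithin_le (C := K)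
      (fun t ht => (hg t ht).hasDerivWithinAt) hb (x := 0) (y := s) (by simp) hs
    rw [hg0, sub_zero, sub_zero] at h
    refine h.trans ?_
    rw [Real.norm_eq_abs, abs_of_nonneg hs.1]
    nlinarith [hs.2]
  have a2 := key (fun s => f2 s - f2 0 - s * f3 0) (fun s => f3 s - f3 0)
    (fun s hs => by
      have := ((h2 s hs).sub_const (f2 0)).sub ((hasDerivAt_id s).mul_const (f3 0))
      convert! this using 1
      simp) (by simp) h3
  have a1 := key (fun s => f1 s - f1 0 - s * f2 0 - s ^ 2 / 2 * f3 0)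
    (fun s => f2 s - f2 0 - s * f3 0)
    (fun s hs => by
      have := (((h1 s hs).sub_const (f1 0)).sub ((hasDerivAt_id s).mul_const (f2 0))).sub
        ((((hasDerivAt_id s).pow 2).div_const 2).mul_const (f3 0))
      convert! this using 1
      simp) (by simp) a2
  have a0 := key (fun s => f s - f 0 - s * f1 0 - s ^ 2 / 2 * f2 0 - s ^ 3 / 6 * f3 0)
    (fun s => f1 s - f1 0 - s * f2 0 - s ^ 2 / 2 * f3 0)
    (fun s hs => by
      have := ((((h0 s hs).sub_const (f 0)).sub ((hasDerivAt_id s).mul_const (f1 0))).sub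
        ((((hasDerivAt_id s).pow 2).div_const 2).mul_const (f2 0))).sub
        ((((hasDerivAt_id s).pow 3).div_const 6).mul_const (f3 0))
      convert! this using 1
      simp
      left
      ring) (by simp) a1
  have := a0 1 (by simp)
  simp only [one_mul, one_pow] at this
  convert this using 2
  ring

theorem integrable_exp_neg_mul_sq_norm {V : Type*} [NormedAddCommGroup V] [InnerProductSpace ℝ V]
    [FiniteDimensional ℝ V] [MeasurableSpace V] [BorelSpace V] {κ : ℝ} (hκ : 0 < κ) :
    Integrable fun w : V => Real.exp (-κ * ‖w‖ ^ 2) := by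
  apply Integrable.of_integral_ne_zero
  rw [GaussianFourier.integral_rexp_neg_mul_sq_norm hκ]
  positivity

theorem integral_exp_neg_div_mul_sq_norm {V : Type*} [NormedAddCommGroup V]
    [InnerProductSpace ℝ V] [FiniteDimensional ℝ V] [MeasurableSpace V] [BorelSpace V]
    {κ ε : ℝ} (hκ : 0 < κ) (hε : 0 < ε) :
    ∫ w : V, Real.exp (-(κ / ε) * ‖w‖ ^ 2) =
      Real.sqrt (Real.pi / κ) ^ Module.finrank ℝ V * Real.sqrt ε ^ Module.finrank ℝ V := by
  rw [GaussianFourier.integral_rexp_neg_mul_sq_norm (by positivity), ← mul_pow,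
    ← Real.sqrt_mul (by positivity), Real.sqrt_eq_rpow, ← Real.rpow_natCast, ← Real.rpow_mul
      (by positivity)]
  congr 1
  · field_simp
  · ring

/-- The pointwise estimate behind the Laplace expansion. -/
theorem laplace_pointwise {C lam ε r m ρ c h h₀ l : ℝ} (hC : 0 ≤ C)
    (hε : 0 < ε) (hε1 : ε ≤ 1) (hr : 0 ≤ r) (hm : lam * r ^ 2 ≤ m) (hc : |c| ≤ C * r ^ 3)
    (hl : |l| ≤ C * r) (hρc : |ρ - c| ≤ C * r ^ 4) (hρ : |ρ| ≤ lam / 4 * r ^ 2)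
    (hh : |h - h₀ - l| ≤ C * r ^ 2) (hh₀ : |h₀| ≤ C) :
    |h * Real.exp (-(m / 2 + ρ) / ε) - (l - h₀ * c / ε) * Real.exp (-m / (2 * ε))
        - h₀ * Real.exp (-m / (2 * ε))| ≤
      ε * ((12 * C ^ 3 + 3 * C ^ 2 + C + 2 * C ^ 2) * (1 + r / Real.sqrt ε) ^ 10) *
        Real.exp (-(lam / 4 / ε) * r ^ 2) := by
  -- Everything is measured in the Laplace scale s = r/√ε, and all powers of s are bounded by powers
  -- of x = 1 + s ≥ 1.
  set e := Real.sqrt ε with he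
  have he0 : 0 < e := Real.sqrt_pos.2 hε
  have he1 : e ≤ 1 := Real.sqrt_le_one.2 hε1
  have hee : e ^ 2 = ε := Real.sq_sqrt hε.le
  set s := r / e with hs
  have hs0 : 0 ≤ s := by positivity
  have hrs : r = e * s := by rw [hs]; field_simp
  set x := 1 + s with hx
  have hx1 : 1 ≤ x := by linarith
  have hsx : s ≤ x := by linarith
  have hpw : ∀ {i j : ℕ}, i ≤ j → s ^ i ≤ x ^ j := fun {i j} hij =>
    (pow_le_pow_left₀ hs0 hsx i).trans (pow_le_pow_right₀ hx1 hij)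
  set X := ρ / ε with hX
  set Y := c / ε with hY
  set G := Real.exp (-m / (2 * ε)) with hG
  set F := Real.exp (lam / 4 * s ^ 2) with hF
  have hs2 : s ^ 2 = r ^ 2 / ε := by rw [hs, div_pow, hee]
  have hXabs : |X| ≤ lam / 4 * s ^ 2 := by
    rw [hX, abs_div, abs_of_pos hε, hs2, ← mul_div_assoc]
    gcongr
  have hF1 : 1 ≤ F := Real.one_le_exp ((abs_nonneg _).trans hXabs)
  have hYb : |Y| ≤ C * e * x ^ 3 := by
    rw [hY, abs_div, abs_of_pos hε, div_le_iff₀ hε]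
    calc |c| ≤ C * r ^ 3 := hc
      _ = C * e * s ^ 3 * ε := by rw [hrs, ← hee]; ring
      _ ≤ C * e * x ^ 3 * ε := by gcongr
  have hXY : |X - Y| ≤ C * ε * x ^ 4 := by
    rw [hX, hY, ← sub_div, abs_div, abs_of_pos hε, div_le_iff₀ hε]
    calc |ρ - c| ≤ C * r ^ 4 := hρc
      _ = C * ε * s ^ 4 * ε := by rw [hrs, ← hee]; ring
      _ ≤ C * ε * x ^ 4 * ε := by gcongr
  have hXb : |X| ≤ 2 * C * e * x ^ 4 := by
    have h1 : |X| ≤ |X - Y| + |Y| := by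
      simpa using abs_add_le (X - Y) Y
    have h2 : C * e * x ^ 3 ≤ C * e * x ^ 4 := by
      gcongr
      norm_num
    have h3 : C * ε * x ^ 4 ≤ C * e * x ^ 4 := by
      gcongr
      rw [← hee]; nlinarith
    linarith
  -- Second order remainder of the exponential, |X|² e^{|X|} with X² = O(ε x⁸), plus the quartic
  -- part X − Y of the exponent, which is already O(ε).
  have hexp : |Real.exp (-X) - 1 + Y| ≤ ε * ((4 * C ^ 2 + C) * x ^ 8) * F := by
    have h1 : |Real.exp (-X) - 1 + X| ≤ |X| ^ 2 * F := by
      have := Complex.norm_exp_sub_sum_le_norm_mul_exp ((-X : ℝ) : ℂ) 2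
      rw [Complex.norm_real, Real.norm_eq_abs, abs_neg] at this
      simp only [Finset.sum_range_succ, Finset.range_zero, Finset.sum_empty, pow_zero,
        Nat.factorial_zero, Nat.cast_one, div_one, zero_add, pow_one, Nat.factorial_one] at this
      rw [← Complex.ofReal_exp, ← Complex.ofReal_one, ← Complex.ofReal_add, ← Complex.ofReal_sub,
        Complex.norm_real, Real.norm_eq_abs] at this
      calc |Real.exp (-X) - 1 + X| = |Real.exp (-X) - (1 + -X)| := by congr 1; ring
        _ ≤ |X| ^ 2 * Real.exp |X| := this
        _ ≤ |X| ^ 2 * F := by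
            gcongr
            exact Real.exp_le_exp.2 hXabs
    have h2 : |X| ^ 2 ≤ ε * (4 * C ^ 2 * x ^ 8) := by
      calc |X| ^ 2 ≤ (2 * C * e * x ^ 4) ^ 2 := by gcongr
        _ = ε * (4 * C ^ 2 * x ^ 8) := by rw [← hee]; ring
    have h3 : |X - Y| ≤ ε * (C * x ^ 8) * F := by
      calc |X - Y| ≤ C * ε * x ^ 4 := hXY
        _ ≤ C * ε * x ^ 8 * F := by
          have : C * ε * x ^ 4 ≤ C * ε * x ^ 8 := by
            gcongr
            norm_num
          exact this.trans (le_mul_of_one_le_right (by positivity) hF1)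
        _ = ε * (C * x ^ 8) * F := by ring
    calc |Real.exp (-X) - 1 + Y| = |(Real.exp (-X) - 1 + X) + -(X - Y)| := by congr 1; ring
      _ ≤ |Real.exp (-X) - 1 + X| + |X - Y| := by
          have := abs_add_le (Real.exp (-X) - 1 + X) (-(X - Y))
          rwa [abs_neg] at this
      _ ≤ ε * (4 * C ^ 2 * x ^ 8) * F + ε * (C * x ^ 8) * F := by gcongr; exact h1.trans (by gcongr)
      _ = _ := by ring
  have hh0' : |h - h₀| ≤ 2 * C * e * x ^ 2 := by
    have h1 : |h - h₀| ≤ |h - h₀ - l| + |l| := by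
      simpa using abs_add_le (h - h₀ - l) l
    have h2 : C * r ^ 2 ≤ C * e * x ^ 2 := by
      calc C * r ^ 2 = C * e * (e * s ^ 2) := by rw [hrs]; ring
        _ ≤ C * e * (1 * x ^ 2) := by gcongr
        _ = _ := by ring
    have h3 : C * r ≤ C * e * x ^ 2 := by
      calc C * r = C * e * s ^ 1 := by rw [hrs]; ring
        _ ≤ C * e * x ^ 2 := by gcongr; exact hpw (by norm_num)
    linarith
  have hhb : |h| ≤ 3 * C * x ^ 2 := by
    have h1 : |h| ≤ |h - h₀| + |h₀| := by
      simpa using abs_add_le (h - h₀) h₀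
    have h2 : 2 * C * e * x ^ 2 ≤ 2 * C * 1 * x ^ 2 := by gcongr
    have h3 : C ≤ C * x ^ 2 := le_mul_of_one_le_right hC (one_le_pow₀ hx1)
    linarith
  have hsplit : Real.exp (-(m / 2 + ρ) / ε) = Real.exp (-X) * G := by
    rw [hG, ← Real.exp_add]; congr 1; rw [hX]; field_simp; ring
  -- The Gaussian decay lam/2 is split in two quarters: one cancels the factor F that the
  -- exponential of |X| cost, the other remains for integrability.
  have hGb : G ≤ Real.exp (-(lam / 4 / ε) * r ^ 2) * Real.exp (-(lam / 4 * s ^ 2)) := by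
    rw [hG, ← Real.exp_add, hs2]
    apply Real.exp_le_exp.2
    have : lam * r ^ 2 / ε ≤ m / ε := by gcongr
    have e1 : -m / (2 * ε) = -(m / ε) / 2 := by field_simp
    have e2 : -(lam / 4 / ε) * r ^ 2 + -(lam / 4 * (r ^ 2 / ε)) = -(lam * r ^ 2 / ε) / 2 := by
      field_simp; ring
    rw [e1, e2]; linarith
  -- Split as h(e^{-X} − 1 + Y) + (h − h₀ − l) − (h − h₀)Y. The three bounds produce 3C(4C² + C), C
  -- and 2C², and the degree 10 is 2 from h plus 8 from the exponential.
  have hmain : |h * Real.exp (-X) - (l - h₀ * Y) - h₀| ≤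
      ε * ((12 * C ^ 3 + 3 * C ^ 2 + C + 2 * C ^ 2) * x ^ 10) * F := by
    have t1 : |h * (Real.exp (-X) - 1 + Y)| ≤
        ε * ((12 * C ^ 3 + 3 * C ^ 2) * x ^ 10) * F := by
      rw [abs_mul]
      calc |h| * |Real.exp (-X) - 1 + Y| ≤
          (3 * C * x ^ 2) * (ε * ((4 * C ^ 2 + C) * x ^ 8) * F) := by gcongr
        _ = _ := by ring
    have t2 : |h - h₀ - l| ≤ ε * (C * x ^ 10) * F := by
      calc |h - h₀ - l| ≤ C * r ^ 2 := hh
        _ = ε * (C * s ^ 2) := by rw [hrs, ← hee]; ring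
        _ ≤ ε * (C * x ^ 10) := by gcongr; exact hpw (by norm_num)
        _ ≤ _ := le_mul_of_one_le_right (by positivity) hF1
    have t3 : |(h - h₀) * Y| ≤ ε * (2 * C ^ 2 * x ^ 10) * F := by
      rw [abs_mul]
      calc |h - h₀| * |Y| ≤ (2 * C * e * x ^ 2) * (C * e * x ^ 3) := by gcongr
        _ = ε * (2 * C ^ 2 * x ^ 5) := by rw [← hee]; ring
        _ ≤ ε * (2 * C ^ 2 * x ^ 10) := by
            gcongr
            norm_num
        _ ≤ _ := le_mul_of_one_le_right (by positivity) hF1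
    calc |h * Real.exp (-X) - (l - h₀ * Y) - h₀|
        = |h * (Real.exp (-X) - 1 + Y) + (h - h₀ - l) + -((h - h₀) * Y)| := by congr 1; ring
      _ ≤ |h * (Real.exp (-X) - 1 + Y)| + |h - h₀ - l| + |(h - h₀) * Y| := by
          have := abs_add_three (h * (Real.exp (-X) - 1 + Y)) (h - h₀ - l) (-((h - h₀) * Y))
          rwa [abs_neg] at this
      _ ≤ _ := by linarith
  calc _ = |h * Real.exp (-X) - (l - h₀ * Y) - h₀| * G := by
        rw [hsplit, hY]
        nth_rewrite 4 [← abs_of_pos (a := G) (Real.exp_pos _)]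
        rw [← abs_mul]
        congr 1; ring
    _ ≤ (ε * ((12 * C ^ 3 + 3 * C ^ 2 + C + 2 * C ^ 2) * x ^ 10) * F) *
          (Real.exp (-(lam / 4 / ε) * r ^ 2) * Real.exp (-(lam / 4 * s ^ 2))) := by
        gcongr
    _ = _ := by
        have : F * Real.exp (-(lam / 4 * s ^ 2)) = 1 := by
          rw [hF, ← Real.exp_add, add_neg_cancel, Real.exp_zero]
        linear_combination (ε * ((12 * C ^ 3 + 3 * C ^ 2 + C + 2 * C ^ 2) * x ^ 10) *
          Real.exp (-(lam / 4 / ε) * r ^ 2)) * this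

/-- By 1 + s ≤ e^s the power is at most e^{10 s}, and completing the square absorbs 10 s into lam
s²/8. This lets half of the remaining Gaussian decay pay for the polynomial factor. -/
theorem one_add_pow_ten_mul_exp_le {lam : ℝ} (hlam : 0 < lam) {s : ℝ} (hs : 0 ≤ s) :
    (1 + s) ^ 10 ≤ Real.exp (200 / lam) * Real.exp (lam / 8 * s ^ 2) := by
  rw [← Real.exp_add]
  calc (1 + s) ^ 10 ≤ Real.exp s ^ 10 := by
        gcongr
        linarith [Real.add_one_le_exp s]
    _ = Real.exp (10 * s) := by rw [← Real.exp_nat_mul]; norm_num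
    _ ≤ _ := by
        apply Real.exp_le_exp.2
        have : 200 / lam + lam / 8 * s ^ 2 - 10 * s = (lam * s - 40) ^ 2 / (8 * lam) := by
          field_simp; ring
        have h2 : 0 ≤ (lam * s - 40) ^ 2 / (8 * lam) := by positivity
        linarith

/-- Laplace's method with a relative error `O(ε)`, uniform in all data with the same bounds. -/
theorem laplace_expansion {V : Type*} [NormedAddCommGroup V] [InnerProductSpace ℝ V]
    [FiniteDimensional ℝ V] [MeasurableSpace V] [BorelSpace V] {C lam δ : ℝ} (hC : 0 ≤ C)
    (hlam : 0 < lam) (hδ : 0 < δ) :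
    ∃ K : ℝ, ∀ (M : V →ₗ[ℝ] V) (Ω : Set V) (q h c l : V → ℝ) (h₀ : ℝ), M.IsSymmetric →
      (∀ w, lam * ‖w‖ ^ 2 ≤ inner ℝ (M w) w) → MeasurableSet Ω → (∀ w ∈ Ω, -w ∈ Ω) →
      Metric.closedBall 0 δ ⊆ Ω → Continuous q → Continuous h → Continuous c → Continuous l →
      (∀ w, c (-w) = -c w) → (∀ w, l (-w) = -l w) → (∀ w, |c w| ≤ C * ‖w‖ ^ 3) →
      (∀ w, |l w| ≤ C * ‖w‖) →
      (∀ w ∈ Ω, |q w - inner ℝ (M w) w / 2 - c w| ≤ C * ‖w‖ ^ 4) →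
      (∀ w ∈ Ω, |q w - inner ℝ (M w) w / 2| ≤ lam / 4 * ‖w‖ ^ 2) →
      (∀ w ∈ Ω, |h w - h₀ - l w| ≤ C * ‖w‖ ^ 2) → |h₀| ≤ C → ∀ ε ∈ Ioc (0 : ℝ) 1,
      IntegrableOn (fun w => h w * Real.exp (-q w / ε)) Ω ∧
      |(∫ w in Ω, h w * Real.exp (-q w / ε)) - h₀ * (Real.sqrt (2 * Real.pi * ε) ^
          Module.finrank ℝ V / Real.sqrt (LinearMap.det M))| ≤
        K * ε * Real.sqrt ε ^ Module.finrank ℝ V := by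
  set n := Module.finrank ℝ V
  set B := 12 * C ^ 3 + 3 * C ^ 2 + C + 2 * C ^ 2 with hB
  -- B covers the points of Ω, C/δ² the Gaussian tail outside Ω, and the exponential is the price of
  -- absorbing the polynomial of degree ten.
  set K2 := (B + C / δ ^ 2) * Real.exp (200 / lam) with hK2
  have hB0 : 0 ≤ B := by positivity
  refine ⟨K2 * Real.sqrt (Real.pi / (lam / 8)) ^ n, ?_⟩
  intro M Ω q h c l h₀ hM hpos hΩ hsymm hball hq hh hc hl hcodd hlodd hcb hlb hqc hqb hhb hh₀ ε
    ⟨hε, hε1⟩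
  have hMc : Continuous fun w : V => inner ℝ (M w) w :=
    (LinearMap.continuous_of_finiteDimensional M).inner continuous_id
  set G : V → ℝ := fun w => Real.exp (-inner ℝ (M w) w / (2 * ε)) with hG
  have hGc : Continuous G := by fun_prop
  set Θ : V → ℝ := fun w => Real.exp (-(lam / 8 / ε) * ‖w‖ ^ 2) with hΘ
  have hΘi : Integrable Θ := integrable_exp_neg_mul_sq_norm (by positivity)
  set o : V → ℝ := fun w => (l w - h₀ * c w / ε) * G w with ho
  have hoc : Continuous o := by fun_prop
  set f : V → ℝ := fun w => h w * Real.exp (-q w / ε) with hf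
  have hfc : Continuous f := by fun_prop
  have hes : ∀ w : V, Real.exp (lam / 8 * (‖w‖ / Real.sqrt ε) ^ 2) *
      Real.exp (-(lam / 4 / ε) * ‖w‖ ^ 2) = Θ w := by
    intro w
    rw [hΘ, ← Real.exp_add, div_pow, Real.sq_sqrt hε.le]
    congr 1; field_simp; ring
  have hpoly : ∀ w : V, (1 + ‖w‖ / Real.sqrt ε) ^ 10 * Real.exp (-(lam / 4 / ε) * ‖w‖ ^ 2) ≤
      Real.exp (200 / lam) * Θ w := by
    intro w
    rw [← hes, ← mul_assoc]
    gcongr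
    exact one_add_pow_ten_mul_exp_le hlam (by positivity)
  have hGb : ∀ w, G w ≤ Real.exp (-(lam / 4 / ε) * ‖w‖ ^ 2) := by
    intro w
    apply Real.exp_le_exp.2
    rw [div_le_iff₀ (by positivity)]
    have h1 := hpos w
    have h2 : -(lam / 4 / ε) * ‖w‖ ^ 2 * (2 * ε) = -(lam * ‖w‖ ^ 2) / 2 := by field_simp; ring
    have h3 : 0 ≤ lam * ‖w‖ ^ 2 := by positivity
    rw [h2]; linarith
  have hε' : 0 < Real.sqrt ε := Real.sqrt_pos.2 hε
  have hε1' : Real.sqrt ε ≤ 1 := Real.sqrt_le_one.2 hε1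
  have hee : Real.sqrt ε ^ 2 = ε := Real.sq_sqrt hε.le
  have hs : ∀ w : V, ‖w‖ = Real.sqrt ε * (‖w‖ / Real.sqrt ε) := fun w => by field_simp
  have hpw : ∀ (w : V) {i : ℕ}, i ≤ 10 → (‖w‖ / Real.sqrt ε) ^ i ≤
      (1 + ‖w‖ / Real.sqrt ε) ^ 10 := by
    intro w i hi
    have h0 : 0 ≤ ‖w‖ / Real.sqrt ε := by positivity
    exact (pow_le_pow_left₀ h0 (by linarith) i).trans (pow_le_pow_right₀ (by linarith) hi)
  have hGi : Integrable G := by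
    refine (integrable_exp_neg_mul_sq_norm (V := V) (κ := lam / 4 / ε) (by positivity)).mono'
      hGc.aestronglyMeasurable (Eventually.of_forall fun w => ?_)
    rw [Real.norm_eq_abs, abs_of_pos (Real.exp_pos _)]
    exact hGb w
  have hob : ∀ w, |o w| ≤ (C + C ^ 2) * Real.exp (200 / lam) * Θ w := by
    intro w
    have h1 : |l w - h₀ * c w / ε| ≤ (C + C ^ 2) * (1 + ‖w‖ / Real.sqrt ε) ^ 10 := by
      have a1 : |l w| ≤ C * (1 + ‖w‖ / Real.sqrt ε) ^ 10 := by
        calc |l w| ≤ C * ‖w‖ := hlb w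
          _ = C * (Real.sqrt ε * (‖w‖ / Real.sqrt ε) ^ 1) := by rw [pow_one, ← hs]
          _ ≤ C * (1 * (1 + ‖w‖ / Real.sqrt ε) ^ 10) := by
              gcongr; exact hpw w (by norm_num)
          _ = _ := by ring
      have a2 : |h₀ * c w / ε| ≤ C ^ 2 * (1 + ‖w‖ / Real.sqrt ε) ^ 10 := by
        rw [abs_div, abs_mul, abs_of_pos hε, div_le_iff₀ hε]
        calc |h₀| * |c w| ≤ C * (C * ‖w‖ ^ 3) := by gcongr; exact hcb w
          _ = C ^ 2 * (Real.sqrt ε * (‖w‖ / Real.sqrt ε) ^ 3) * ε := by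
              nth_rewrite 1 [hs w]; nth_rewrite 5 [← hee]; ring
          _ ≤ C ^ 2 * (1 * (1 + ‖w‖ / Real.sqrt ε) ^ 10) * ε := by
              gcongr; exact hpw w (by norm_num)
          _ = _ := by ring
      calc _ ≤ |l w| + |h₀ * c w / ε| := abs_sub _ _
        _ ≤ _ := by linarith
    calc |o w| = |l w - h₀ * c w / ε| * G w := by
          rw [ho]; simp only [abs_mul]; rw [abs_of_pos (a := G w) (Real.exp_pos _)]
      _ ≤ ((C + C ^ 2) * (1 + ‖w‖ / Real.sqrt ε) ^ 10) *
          Real.exp (-(lam / 4 / ε) * ‖w‖ ^ 2) := by gcongr; exact hGb w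
      _ = (C + C ^ 2) * ((1 + ‖w‖ / Real.sqrt ε) ^ 10 *
          Real.exp (-(lam / 4 / ε) * ‖w‖ ^ 2)) := by ring
      _ ≤ (C + C ^ 2) * (Real.exp (200 / lam) * Θ w) :=
          mul_le_mul_of_nonneg_left (hpoly w) (by positivity)
      _ = _ := by ring
  have hoi : Integrable o :=
    (hΘi.const_mul _).mono' hoc.aestronglyMeasurable (Eventually.of_forall hob)
  have hmain : ∀ w, |Ω.indicator f w - Ω.indicator o w - h₀ * G w| ≤ ε * K2 * Θ w := by
    intro w
    have hfin : ∀ b : ℝ, b ≤ B + C / δ ^ 2 → 0 ≤ b →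
        ε * (b * (1 + ‖w‖ / Real.sqrt ε) ^ 10) * Real.exp (-(lam / 4 / ε) * ‖w‖ ^ 2) ≤
        ε * K2 * Θ w := by
      intro b hb hb0
      calc _ = ε * b * ((1 + ‖w‖ / Real.sqrt ε) ^ 10 * Real.exp (-(lam / 4 / ε) * ‖w‖ ^ 2)) := by
            ring
        _ ≤ ε * (B + C / δ ^ 2) * (Real.exp (200 / lam) * Θ w) :=
            mul_le_mul (by gcongr) (hpoly w) (by positivity) (by positivity)
        _ = _ := by rw [hK2]; ring
    by_cases hw : w ∈ Ω
    · rw [indicator_of_mem hw, indicator_of_mem hw]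
      have := laplace_pointwise hC hε hε1 (norm_nonneg w) (hpos w) (hcb w) (hlb w)
        (ρ := q w - inner ℝ (M w) w / 2) (hqc w hw) (hqb w hw) (hhb w hw) hh₀
      rw [add_sub_cancel] at this
      exact this.trans (hfin B (le_add_of_nonneg_right (by positivity)) hB0)
    · rw [indicator_of_notMem hw, indicator_of_notMem hw]
      have hwδ : δ < ‖w‖ := by
        by_contra hcon
        exact hw (hball (by simpa using not_lt.1 hcon))
      refine le_trans ?_ (hfin (C / δ ^ 2) (le_add_of_nonneg_left hB0) (by positivity))
      rw [sub_zero, zero_sub, abs_neg, abs_mul, abs_of_pos (a := G w) (Real.exp_pos _)]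
      -- Outside Ω one has ‖w‖ > δ, so the factor ‖w‖²/δ² ≥ 1 can be inserted; in the Laplace scale
      -- it supplies the missing ε.
      have h1 : C ≤ ε * (C / δ ^ 2 * (1 + ‖w‖ / Real.sqrt ε) ^ 10) := by
        have h2 : (1 : ℝ) ≤ ‖w‖ ^ 2 / δ ^ 2 := by
          rw [one_le_div (by positivity)]; gcongr
        calc C ≤ C * (‖w‖ ^ 2 / δ ^ 2) := le_mul_of_one_le_right hC h2
          _ = ε * (C / δ ^ 2 * (‖w‖ / Real.sqrt ε) ^ 2) := by
              nth_rewrite 1 [hs w]; nth_rewrite 3 [← hee]; ring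
          _ ≤ _ := by gcongr ε * (C / δ ^ 2 * ?_); exact hpw w (by norm_num)
      gcongr
      · exact hh₀.trans h1
      · exact hGb w
  have hfm : Integrable fun w => Ω.indicator f w - Ω.indicator o w - h₀ * G w := by
    refine (hΘi.const_mul (ε * K2)).mono' ?_ (Eventually.of_forall hmain)
    exact ((hfc.aestronglyMeasurable.indicator hΩ).sub
      (hoc.aestronglyMeasurable.indicator hΩ)).sub (hGc.aestronglyMeasurable.const_mul _)
  have hoΩ : Integrable (Ω.indicator o) := hoi.indicator hΩ
  have hfi : Integrable (Ω.indicator f) := by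
    convert! (hfm.add hoΩ).add (hGi.const_mul h₀) using 1
    ext w
    simp only [Pi.add_apply]
    ring
  refine ⟨(integrable_indicator_iff hΩ).1 hfi, ?_⟩
  -- The correction of relative order √ε is odd and Ω is symmetric, so it contributes nothing. This
  -- is what improves the error from √ε to ε.
  have hozero : ∫ w, Ω.indicator o w = 0 := by
    have h1 : ∀ w, Ω.indicator o (-w) = -Ω.indicator o w := by
      intro w
      have hG' : G (-w) = G w := by simp [hG]
      by_cases hw : w ∈ Ω
      · rw [indicator_of_mem hw, indicator_of_mem (hsymm w hw)]
        simp only [ho, hG', hcodd, hlodd]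
        ring
      · have : -w ∉ Ω := fun h' => hw (by simpa using hsymm _ h')
        rw [indicator_of_notMem hw, indicator_of_notMem this, neg_zero]
    have h2 := integral_neg_eq_self (Ω.indicator o) (volume : Measure V)
    simp_rw [h1, integral_neg] at h2
    linarith
  rw [← integral_exp_neg_inner_div hM ?_ hε, ← integral_indicator hΩ]
  · have h1 : ∫ w, (Ω.indicator f w - Ω.indicator o w - h₀ * G w) =
        (∫ w, Ω.indicator f w) - h₀ * ∫ w, G w := by
      rw [integral_sub (f := fun w => Ω.indicator f w - Ω.indicator o w) (hfi.sub hoΩ)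
        (hGi.const_mul h₀), integral_sub hfi hoΩ, hozero, sub_zero,
        integral_const_mul]
    calc |(∫ w, Ω.indicator f w) - h₀ * ∫ w, G w|
        = |∫ w, (Ω.indicator f w - Ω.indicator o w - h₀ * G w)| := by rw [h1]
      _ ≤ ∫ w, ε * K2 * Θ w := by
          rw [← Real.norm_eq_abs]
          exact norm_integral_le_of_norm_le (hΘi.const_mul (ε * K2)) (Eventually.of_forall hmain)
      _ = _ := by
          rw [integral_const_mul, hΘ, integral_exp_neg_div_mul_sq_norm (by positivity) hε]
          ring
  · intro w hw
    exact lt_of_lt_of_le (by positivity) (hpos w)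

/-! ### The weak stationary equation -/

/-- The action of `D` as a continuous linear map. -/
noncomputable def diffCLM {n : ℕ} (D : Matrix (Fin n) (Fin n) ℝ) :
    EuclideanSpace ℝ (Fin n) →L[ℝ] EuclideanSpace ℝ (Fin n) :=
  (Matrix.toEuclideanLin D).toContinuousLinearMap

theorem diffAct_eq {n : ℕ} (D : Matrix (Fin n) (Fin n) ℝ) : diffAct D = diffCLM D := rfl

theorem inner_diffCLM_left {n : ℕ} {D : Matrix (Fin n) (Fin n) ℝ} (hD : D.PosDef)
    (v w : EuclideanSpace ℝ (Fin n)) :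
    inner ℝ (diffCLM D v) w = inner ℝ v (diffCLM D w) :=
  (Matrix.isSymmetric_toEuclideanLin_iff.2 hD.isHermitian) v w

theorem inner_diffCLM_pos {n : ℕ} {D : Matrix (Fin n) (Fin n) ℝ} (hD : D.PosDef)
    {v : EuclideanSpace ℝ (Fin n)} (hv : v ≠ 0) : 0 < inner ℝ v (diffCLM D v) := by
  have h := hD.dotProduct_mulVec_pos (x := v.ofLp) (by simpa using hv)
  rw [EuclideanSpace.inner_eq_star_dotProduct, dotProduct_comm]
  exact h

/-- `div (D ∇ψ)` for a constant symmetric matrix `D`. -/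
noncomputable def diffOp {n : ℕ} (D : Matrix (Fin n) (Fin n) ℝ) (ψ : EuclideanSpace ℝ (Fin n) → ℝ)
    (y : EuclideanSpace ℝ (Fin n)) : ℝ :=
  ∑ i, fderiv ℝ (fun z => fderiv ℝ ψ z (EuclideanSpace.basisFun (Fin n) ℝ i)) y
    (diffCLM D (EuclideanSpace.basisFun (Fin n) ℝ i))

theorem integral_mul_fderiv_of_hasCompactSupport {n : ℕ} {f g : EuclideanSpace ℝ (Fin n) → ℝ}
    (hf : ContDiff ℝ 1 f) (hg : ContDiff ℝ 1 g) (hc : HasCompactSupport f)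
    (v : EuclideanSpace ℝ (Fin n)) :
    ∫ y, f y * fderiv ℝ g y v = - ∫ y, fderiv ℝ f y v * g y := by
  have hf' : Continuous fun y => fderiv ℝ f y v := (hf.continuous_fderiv one_ne_zero).clm_apply
    continuous_const
  have hg' : Continuous fun y => fderiv ℝ g y v := (hg.continuous_fderiv one_ne_zero).clm_apply
    continuous_const
  refine integral_mul_fderiv_eq_neg_fderiv_mul_of_integrable ?_ ?_ ?_
    (fun y _ => hf.differentiable one_ne_zero y) (fun y _ => hg.differentiable one_ne_zero y)
  · exact (hf'.mul hg.continuous).integrable_of_hasCompactSupport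
      (HasCompactSupport.mul_right (hc.fderiv_apply ℝ v))
  · exact (hf.continuous.mul hg').integrable_of_hasCompactSupport hc.mul_right
  · exact (hf.continuous.mul hg.continuous).integrable_of_hasCompactSupport hc.mul_right

theorem fderiv_eq_sum_basisFun {n : ℕ} (L : EuclideanSpace ℝ (Fin n) →L[ℝ] ℝ)
    (v : EuclideanSpace ℝ (Fin n)) :
    L v = ∑ i, L (EuclideanSpace.basisFun (Fin n) ℝ i) *
      inner ℝ (EuclideanSpace.basisFun (Fin n) ℝ i) v := by
  conv_lhs => rw [← (EuclideanSpace.basisFun (Fin n) ℝ).sum_repr' v]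
  rw [map_sum]
  exact Finset.sum_congr rfl fun i _ => by rw [map_smul, smul_eq_mul, mul_comm]

/-- The weak form of the stationary Fokker–Planck equation. -/
theorem IsStationaryDensity.integral_generator_eq_zero {n : ℕ}
    {b : EuclideanSpace ℝ (Fin n) → EuclideanSpace ℝ (Fin n)} (hb : ContDiff ℝ 1 b)
    {D : Matrix (Fin n) (Fin n) ℝ} (hD : D.PosDef) {ε : ℝ} {p : EuclideanSpace ℝ (Fin n) → ℝ}
    (hp : IsStationaryDensity b D ε p) {ψ : EuclideanSpace ℝ (Fin n) → ℝ} (hψ : ContDiff ℝ 2 ψ)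
    (hc : HasCompactSupport ψ) :
    ∫ y, p y * (fderiv ℝ ψ y (b y) + ε * diffOp D ψ y) = 0 := by
  set e := EuclideanSpace.basisFun (Fin n) ℝ with he
  have hp1 : ContDiff ℝ 1 p := hp.contDiff.of_le (by norm_num)
  have hψ1 : ContDiff ℝ 1 ψ := hψ.of_le (by norm_num)
  have hgr : ContDiff ℝ 1 (gradient p) :=
    (InnerProductSpace.toDual ℝ (EuclideanSpace ℝ (Fin n))).symm.contDiff.comp
      (hp.contDiff.fderiv_right (m := 1) (by norm_num))
  have hJ : ContDiff ℝ 1 (probFlux b D ε p) := by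
    unfold probFlux
    rw [diffAct_eq]
    exact (hp1.smul hb).sub (((diffCLM D).contDiff.comp hgr).const_smul ε)
  have hJi : ∀ i, ContDiff ℝ 1 fun y => inner ℝ (e i) (probFlux b D ε p y) := fun i =>
    contDiff_const.inner ℝ hJ
  have hdiv : ∀ y, ∑ i, fderiv ℝ (fun z => inner ℝ (e i) (probFlux b D ε p z)) y (e i) = 0 := by
    intro y
    rw [← hp.stationary y, divergence, LinearMap.trace_eq_sum_inner _ e]
    refine Finset.sum_congr rfl fun i _ => ?_
    rw [fderiv_inner_apply ℝ (differentiableAt_const _) (hJ.differentiable one_ne_zero y)]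
    simp
  have hψe : ∀ i, ContDiff ℝ 1 fun y => fderiv ℝ ψ y (e i) := fun i =>
    (hψ.fderiv_right (m := 1) (by norm_num)).clm_apply contDiff_const
  have hψec : ∀ i, HasCompactSupport fun y => fderiv ℝ ψ y (e i) := fun i => hc.fderiv_apply ℝ _
  have hψ' : Continuous (fderiv ℝ ψ) := hψ1.continuous_fderiv one_ne_zero
  have hp' : Continuous (fderiv ℝ p) := hp1.continuous_fderiv one_ne_zero
  -- Integrating by parts coordinatewise moves the gradient from ψ to the flux, whose divergence
  -- vanishes.
  have h1 : ∫ y, fderiv ℝ ψ y (probFlux b D ε p y) = 0 := by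
    have h2 : ∀ y, fderiv ℝ ψ y (probFlux b D ε p y) =
        ∑ i, fderiv ℝ ψ y (e i) * inner ℝ (e i) (probFlux b D ε p y) :=
      fun y => fderiv_eq_sum_basisFun _ _
    simp_rw [h2]
    rw [integral_finsetSum]
    · have h3 : ∀ i, ∫ y, fderiv ℝ ψ y (e i) * inner ℝ (e i) (probFlux b D ε p y) =
          -∫ y, ψ y * fderiv ℝ (fun z => inner ℝ (e i) (probFlux b D ε p z)) y (e i) := by
        intro i
        rw [integral_mul_fderiv_of_hasCompactSupport hψ1 (hJi i) hc, neg_neg]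
      simp_rw [h3, Finset.sum_neg_distrib]
      rw [← integral_finsetSum]
      · simp_rw [← Finset.mul_sum, hdiv]
        simp
      · intro i _
        exact (hψ.continuous.mul (((hJi i).continuous_fderiv one_ne_zero).clm_apply
          continuous_const)).integrable_of_hasCompactSupport hc.mul_right
    · intro i _
      exact ((hψe i).continuous.mul (hJi i).continuous).integrable_of_hasCompactSupport
        (hψec i).mul_right
  have h4 : ∀ y, fderiv ℝ ψ y (probFlux b D ε p y) = p y * fderiv ℝ ψ y (b y) -
      ε * ∑ i, fderiv ℝ ψ y (e i) * fderiv ℝ p y (diffCLM D (e i)) := by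
    intro y
    have h5 : ∑ i, fderiv ℝ ψ y (e i) * fderiv ℝ p y (diffCLM D (e i)) =
        fderiv ℝ ψ y (diffCLM D (gradient p y)) := by
      rw [fderiv_eq_sum_basisFun (fderiv ℝ ψ y) (diffCLM D (gradient p y))]
      refine Finset.sum_congr rfl fun i _ => ?_
      rw [← inner_diffCLM_left hD, real_inner_comm, inner_gradient_left]
    rw [h5, probFlux, diffAct_eq, map_sub, map_smul, map_smul, smul_eq_mul, smul_eq_mul]
  -- A second integration by parts frees the density of derivatives; the symmetry of D was used to
  -- put D on the direction of differentiation.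
  have h6 : ∀ i, ∫ y, fderiv ℝ ψ y (e i) * fderiv ℝ p y (diffCLM D (e i)) =
      -∫ y, fderiv ℝ (fun z => fderiv ℝ ψ z (e i)) y (diffCLM D (e i)) * p y := fun i =>
    integral_mul_fderiv_of_hasCompactSupport (hψe i) hp1 (hψec i) _
  have i1 : Integrable fun y => p y * fderiv ℝ ψ y (b y) :=
    (hp1.continuous.mul (hψ'.clm_apply hb.continuous)).integrable_of_hasCompactSupport
      (HasCompactSupport.mul_left (HasCompactSupport.intro hc fun y hy => by
        rw [fderiv_of_notMem_tsupport (𝕜 := ℝ) hy]; rfl))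
  have i2 : ∀ i, Integrable fun y => fderiv ℝ ψ y (e i) * fderiv ℝ p y (diffCLM D (e i)) :=
    fun i => ((hψe i).continuous.mul (hp'.clm_apply
      continuous_const)).integrable_of_hasCompactSupport (hψec i).mul_right
  have i3 : ∀ i, Integrable fun y =>
      fderiv ℝ (fun z => fderiv ℝ ψ z (e i)) y (diffCLM D (e i)) * p y := fun i =>
    ((((hψe i).continuous_fderiv one_ne_zero).clm_apply continuous_const).mul
      hp1.continuous).integrable_of_hasCompactSupport
        (HasCompactSupport.mul_right ((hψec i).fderiv_apply ℝ _))
  have h7 : ∫ y, p y * (fderiv ℝ ψ y (b y) + ε * diffOp D ψ y) =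
      (∫ y, p y * fderiv ℝ ψ y (b y)) + ε *
        ∑ i, ∫ y, fderiv ℝ (fun z => fderiv ℝ ψ z (e i)) y (diffCLM D (e i)) * p y := by
    rw [← integral_finsetSum _ fun i _ => i3 i, ← integral_const_mul, ← integral_add i1
      ((integrable_finsetSum _ fun i _ => i3 i).const_mul ε)]
    congr 1
    ext y
    rw [diffOp, ← Finset.sum_mul]
    ring
  have h8 : ∫ y, fderiv ℝ ψ y (probFlux b D ε p y) =
      (∫ y, p y * fderiv ℝ ψ y (b y)) - ε *
        ∑ i, ∫ y, fderiv ℝ ψ y (e i) * fderiv ℝ p y (diffCLM D (e i)) := by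
    simp_rw [h4]
    rw [← integral_finsetSum _ fun i _ => i2 i, ← integral_const_mul, ← integral_sub i1
      ((integrable_finsetSum _ fun i _ => i2 i).const_mul ε)]
  rw [h7, ← h1, h8]
  simp_rw [h6, Finset.sum_neg_distrib]
  ring

/-! ### WKB form and the Hamilton–Jacobi equation -/

/-- A function in WKB form is close to its leading term. -/
theorem HasWKBForm.exists_bound {n : ℕ} {𝒟 : Set (EuclideanSpace ℝ (Fin n))}
    {φ ω : EuclideanSpace ℝ (Fin n) → ℝ} {ε₀ : ℝ} (hε₀ : 0 < ε₀)
    {π : ℝ → EuclideanSpace ℝ (Fin n) → ℝ} (h : HasWKBForm 𝒟 φ ω ε₀ π)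
    (hω : ∀ y ∈ 𝒟, 0 < ω y) :
    ∃ (a : ℝ → ℝ) (C ε₁ : ℝ), 0 < C ∧ 0 < ε₁ ∧ ε₁ ≤ ε₀ ∧ ε₁ ≤ 1 ∧ ∀ ε ∈ Ioo 0 ε₁, 0 < a ε ∧
      ∀ y ∈ 𝒟, |π ε y - a ε * (ω y * Real.exp (-φ y / ε))| ≤
        C * ε * (a ε * (ω y * Real.exp (-φ y / ε))) := by
  obtain ⟨a, C, h⟩ := h
  -- The bound on ε keeps the remainder r in [−1, 1], where |e^r − 1| ≤ 2|r|; the added 1 makes the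
  -- constants positive.
  refine ⟨a, 2 * (|C| + 1), min ε₀ (1 / (|C| + 1)), by positivity, by positivity,
    min_le_left _ _, (min_le_right _ _).trans ?_, fun ε hε => ?_⟩
  · rw [div_le_one (by positivity)]
    linarith [abs_nonneg C]
  have hε' := (lt_min_iff.1 hε.2)
  obtain ⟨ha, h⟩ := h ε ⟨hε.1, hε'.1⟩
  refine ⟨ha, fun y hy => ?_⟩
  obtain ⟨r, hr, hπ⟩ := h y hy
  have hr' : |r| ≤ (|C| + 1) * ε := hr.trans (by
    have := hε.1
    gcongr
    linarith [le_abs_self C])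
  have hr1 : |r| ≤ 1 := by
    refine hr'.trans ?_
    have := hε'.2.le
    rwa [le_div_iff₀ (by positivity), mul_comm] at this
  have h1 : π ε y = a ε * (ω y * Real.exp (-φ y / ε)) * Real.exp r := by
    rw [hπ, Real.exp_add, Real.exp_add, Real.exp_log (hω y hy)]
    ring
  have hpos : 0 < a ε * (ω y * Real.exp (-φ y / ε)) := by
    have := hω y hy
    positivity
  rw [h1, ← mul_sub_one, abs_mul, abs_of_pos hpos, mul_comm]
  gcongr
  exact (Real.abs_exp_sub_one_le hr1).trans (by linarith)

theorem fderiv_mul_exp_div {n : ℕ} {α φ : EuclideanSpace ℝ (Fin n) → ℝ}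
    {y : EuclideanSpace ℝ (Fin n)} (hα : DifferentiableAt ℝ α y) (hφ : DifferentiableAt ℝ φ y)
    (ε : ℝ) (v : EuclideanSpace ℝ (Fin n)) :
    fderiv ℝ (fun z => α z * Real.exp (φ z / ε)) y v =
      (fderiv ℝ α y v + α y * fderiv ℝ φ y v / ε) * Real.exp (φ y / ε) := by
  have h1 : HasFDerivAt (fun z => φ z / ε) (ε⁻¹ • fderiv ℝ φ y) y := by
    simpa [div_eq_inv_mul] using hφ.hasFDerivAt.fun_const_smul ε⁻¹
  rw [(hα.hasFDerivAt.fun_mul h1.exp).fderiv]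
  simp
  ring

/-- The first order terms produced when the generator acts on `χ e^{φ/ε}`. -/
noncomputable def firstOrderTerm {n : ℕ}
    (b : EuclideanSpace ℝ (Fin n) → EuclideanSpace ℝ (Fin n))
    (D : Matrix (Fin n) (Fin n) ℝ) (φ χ : EuclideanSpace ℝ (Fin n) → ℝ)
    (y : EuclideanSpace ℝ (Fin n)) : ℝ :=
  fderiv ℝ χ y (b y) + ∑ i, (fderiv ℝ χ y (diffCLM D (EuclideanSpace.basisFun (Fin n) ℝ i)) *
      fderiv ℝ φ y (EuclideanSpace.basisFun (Fin n) ℝ i) +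
    χ y * fderiv ℝ (fun z => fderiv ℝ φ z (EuclideanSpace.basisFun (Fin n) ℝ i)) y
      (diffCLM D (EuclideanSpace.basisFun (Fin n) ℝ i)) +
    fderiv ℝ χ y (EuclideanSpace.basisFun (Fin n) ℝ i) *
      fderiv ℝ φ y (diffCLM D (EuclideanSpace.basisFun (Fin n) ℝ i)))

/-- The terms are sorted by powers of ε. Both b·∇φ and the quadratic term D∇φ·∇φ from the second
derivatives appear at order 1/ε, where they combine to ∇φ·γ. -/
theorem generator_mul_exp {n : ℕ} (b : EuclideanSpace ℝ (Fin n) → EuclideanSpace ℝ (Fin n))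
    {D : Matrix (Fin n) (Fin n) ℝ} (hD : D.PosDef) {φ χ : EuclideanSpace ℝ (Fin n) → ℝ}
    (hφ : ContDiff ℝ 2 φ) (hχ : ContDiff ℝ 2 χ) {ε : ℝ} (hε : ε ≠ 0)
    (y : EuclideanSpace ℝ (Fin n)) :
    fderiv ℝ (fun z => χ z * Real.exp (φ z / ε)) y (b y) +
        ε * diffOp D (fun z => χ z * Real.exp (φ z / ε)) y =
      (χ y * fderiv ℝ φ y (circField b D φ y) / ε + firstOrderTerm b D φ χ y +
        ε * diffOp D χ y) * Real.exp (φ y / ε) := by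
  set e := EuclideanSpace.basisFun (Fin n) ℝ with he
  have dφ : Differentiable ℝ φ := hφ.differentiable (by norm_num)
  have dχ : Differentiable ℝ χ := hχ.differentiable (by norm_num)
  have dφ' : ∀ v, Differentiable ℝ fun z => fderiv ℝ φ z v := fun v =>
    ((hφ.fderiv_right (m := 1) (by norm_num)).clm_apply contDiff_const).differentiable one_ne_zero
  have dχ' : ∀ v, Differentiable ℝ fun z => fderiv ℝ χ z v := fun v =>
    ((hχ.fderiv_right (m := 1) (by norm_num)).clm_apply contDiff_const).differentiable one_ne_zero
  have h1 : ∀ i, fderiv ℝ (fun z => fderiv ℝ (fun z => χ z * Real.exp (φ z / ε)) z (e i)) y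
      (diffCLM D (e i)) =
      (fderiv ℝ (fun z => fderiv ℝ χ z (e i)) y (diffCLM D (e i)) +
        (fderiv ℝ χ y (diffCLM D (e i)) * fderiv ℝ φ y (e i) +
          χ y * fderiv ℝ (fun z => fderiv ℝ φ z (e i)) y (diffCLM D (e i)) +
          fderiv ℝ χ y (e i) * fderiv ℝ φ y (diffCLM D (e i))) / ε +
        χ y * (fderiv ℝ φ y (e i) * fderiv ℝ φ y (diffCLM D (e i))) / ε ^ 2) *
        Real.exp (φ y / ε) := by
    intro i
    simp_rw [fun z => fderiv_mul_exp_div (dχ z) (dφ z) ε (e i)]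
    have hm : HasFDerivAt (fun z => χ z * fderiv ℝ φ z (e i) / ε) (ε⁻¹ •
        (χ y • fderiv ℝ (fun z => fderiv ℝ φ z (e i)) y +
          fderiv ℝ φ y (e i) • fderiv ℝ χ y)) y := by
      simpa [div_eq_inv_mul] using
        ((dχ y).hasFDerivAt.fun_mul (dφ' (e i) y).hasFDerivAt).fun_const_smul ε⁻¹
    rw [fderiv_mul_exp_div ((dχ' (e i) y).fun_add hm.differentiableAt) (dφ y),
      fderiv_fun_add (dχ' (e i) y) hm.differentiableAt, hm.fderiv]
    simp
    field_simp
    ring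
  have h2 : fderiv ℝ φ y (circField b D φ y) =
      fderiv ℝ φ y (b y) + ∑ i, fderiv ℝ φ y (e i) * fderiv ℝ φ y (diffCLM D (e i)) := by
    rw [circField, map_add, diffAct_eq, fderiv_eq_sum_basisFun (fderiv ℝ φ y) (diffCLM D _)]
    congr 1
    refine Finset.sum_congr rfl fun i _ => ?_
    rw [← inner_diffCLM_left hD, real_inner_comm, inner_gradient_left]
  rw [fderiv_mul_exp_div (dχ y) (dφ y), h2, diffOp, ← he]
  simp_rw [h1]
  rw [← Finset.sum_mul, Finset.sum_add_distrib, Finset.sum_add_distrib, ← Finset.sum_div,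
    ← Finset.sum_div, ← Finset.mul_sum, firstOrderTerm, diffOp, ← he]
  field_simp
  ring

/-- The Hamilton–Jacobi equation `∇φ · (b + D∇φ) = 0` for the rate function. -/
theorem fderiv_circField_eq_zero {n : ℕ}
    {b : EuclideanSpace ℝ (Fin n) → EuclideanSpace ℝ (Fin n)} (hb : ContDiff ℝ 1 b)
    {D : Matrix (Fin n) (Fin n) ℝ} (hD : D.PosDef) {𝒟 : Set (EuclideanSpace ℝ (Fin n))}
    (h𝒟 : IsCompact 𝒟) (hreg : 𝒟 ⊆ closure (interior 𝒟)) {φ ω : EuclideanSpace ℝ (Fin n) → ℝ}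
    (hφ : ContDiff ℝ 2 φ) (hω : Continuous ω) (hω_pos : ∀ y ∈ 𝒟, 0 < ω y) {ε₀ : ℝ} (hε₀ : 0 < ε₀)
    {π : ℝ → EuclideanSpace ℝ (Fin n) → ℝ}
    (hπ : ∀ ε ∈ Ioo 0 ε₀, IsStationaryDensity b D ε (π ε)) (hw : HasWKBForm 𝒟 φ ω ε₀ π) :
    ∀ y ∈ 𝒟, fderiv ℝ φ y (circField b D φ y) = 0 := by
  obtain ⟨a, C, ε₁, hC, hε₁, hε₁₀, hε₁1, hwkb⟩ := hw.exists_bound hε₀ hω_pos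
  set H := fun y => fderiv ℝ φ y (circField b D φ y) with hH
  have dφ' : Continuous (fderiv ℝ φ) := hφ.continuous_fderiv (by norm_num)
  have hgr : Continuous (gradient φ) :=
    (InnerProductSpace.toDual ℝ (EuclideanSpace ℝ (Fin n))).symm.continuous.comp dφ'
  have hHc : Continuous H := by
    refine dφ'.clm_apply ?_
    unfold circField
    rw [diffAct_eq]
    exact hb.continuous.add ((diffCLM D).continuous.comp hgr)
  -- The equation is proved in the weak sense first: tested with χ e^{φ/ε} and multiplied by ε, the
  -- stationary equation leaves an error O(ε).
  have hkey : ∀ χ : EuclideanSpace ℝ (Fin n) → ℝ, ContDiff ℝ ((⊤ : ℕ∞) : WithTop ℕ∞) χ →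
      HasCompactSupport χ → tsupport χ ⊆ interior 𝒟 → ∫ y, χ y • (ω y * H y) = 0 := by
    intro χ hχ hχc hχs
    have hχ2 : ContDiff ℝ 2 χ := contDiff_infty.1 hχ 2
    have dχ' : Continuous (fderiv ℝ χ) := hχ2.continuous_fderiv (by norm_num)
    have dφ'' : ∀ v, Continuous (fderiv ℝ fun z => fderiv ℝ φ z v) := fun v =>
      ((hφ.fderiv_right (m := 1) (by norm_num)).clm_apply contDiff_const).continuous_fderiv
        one_ne_zero
    have dχ'' : ∀ v, Continuous (fderiv ℝ fun z => fderiv ℝ χ z v) := fun v =>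
      ((hχ2.fderiv_right (m := 1) (by norm_num)).clm_apply contDiff_const).continuous_fderiv
        one_ne_zero
    have kc : Continuous (firstOrderTerm b D φ χ) := by
      unfold firstOrderTerm
      have := hb.continuous
      have := hχ2.continuous
      fun_prop
    have mc : Continuous (diffOp D χ) := by
      unfold diffOp
      fun_prop
    have kzero : ∀ y ∉ tsupport χ, firstOrderTerm b D φ χ y = 0 := by
      intro y hy
      simp [firstOrderTerm, fderiv_of_notMem_tsupport (𝕜 := ℝ) hy, image_eq_zero_of_notMem_tsupport hy]
    have mzero : ∀ y ∉ tsupport χ, diffOp D χ y = 0 := by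
      intro y hy
      refine Finset.sum_eq_zero fun i _ => ?_
      rw [fderiv_of_notMem_tsupport (𝕜 := ℝ)
        fun h => hy (tsupport_fderiv_apply_subset ℝ _ h)]
      rfl
    have hbd : ∀ f : EuclideanSpace ℝ (Fin n) → ℝ, Continuous f → ∃ B, 0 ≤ B ∧ ∀ y ∈ 𝒟, |f y| ≤ B := by
      intro f hf
      obtain ⟨B, hB⟩ := h𝒟.exists_bound_of_continuousOn hf.continuousOn
      exact ⟨|B|, abs_nonneg _, fun y hy => (hB y hy).trans (le_abs_self B)⟩
    obtain ⟨Bω, hBω0, hBω⟩ := hbd ω hω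
    obtain ⟨Bh, hBh0, hBh⟩ := hbd (fun y => χ y * H y) (hχ2.continuous.mul hHc)
    obtain ⟨Bk, hBk0, hBk⟩ := hbd _ kc
    obtain ⟨Bm, hBm0, hBm⟩ := hbd _ mc
    set B := C * Bω * Bh + (1 + C) * Bω * (Bk + Bm) with hBdef
    have hest : ∀ ε ∈ Ioo 0 ε₁, |∫ y, χ y • (ω y * H y)| ≤ ε * (B * volume.real 𝒟) := by
      intro ε hε
      have hε0 : 0 < ε := hε.1
      have hε1 : ε ≤ 1 := hε.2.le.trans hε₁1
      obtain ⟨ha, hwε⟩ := hwkb ε hε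
      set ψ := fun z => χ z * Real.exp (φ z / ε) with hψ
      have hψ2 : ContDiff ℝ 2 ψ := hχ2.mul (Real.contDiff_exp.comp (hφ.div_const ε))
      have h0 := (hπ ε ⟨hε0, hε.2.trans_le hε₁₀⟩).integral_generator_eq_zero hb hD hψ2
        hχc.mul_right
      simp_rw [hψ, generator_mul_exp b hD hφ hχ2 hε0.ne'] at h0
      -- The density with amplitude and exponential stripped off; it tends to ω uniformly on 𝒟.
      set ρ := fun y => π ε y * Real.exp (φ y / ε) / a ε with hρ
      have hρb : ∀ y ∈ 𝒟, |ρ y - ω y| ≤ C * ε * ω y := by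
        intro y hy
        have h1 := hwε y hy
        have h2 : ρ y - ω y = (π ε y - a ε * (ω y * Real.exp (-φ y / ε))) *
            (Real.exp (φ y / ε) / a ε) := by
          have : Real.exp (-φ y / ε) = (Real.exp (φ y / ε))⁻¹ := by
            rw [← Real.exp_neg, neg_div]
          rw [hρ, this]
          field_simp
        have h3 : 0 < Real.exp (φ y / ε) / a ε := by positivity
        rw [h2, abs_mul, abs_of_pos h3, ← le_div_iff₀ h3]
        refine h1.trans (le_of_eq ?_)
        have : Real.exp (-φ y / ε) = (Real.exp (φ y / ε))⁻¹ := by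
          rw [← Real.exp_neg, neg_div]
        rw [this]
        field_simp
      have h4 : ∫ y, ρ y * (χ y * H y + ε * firstOrderTerm b D φ χ y + ε ^ 2 * diffOp D χ y) = 0 := by
        have : ∀ y, ρ y * (χ y * H y + ε * firstOrderTerm b D φ χ y + ε ^ 2 * diffOp D χ y) =
            (ε / a ε) * (π ε y * ((χ y * H y / ε + firstOrderTerm b D φ χ y + ε * diffOp D χ y) *
              Real.exp (φ y / ε))) := by
          intro y
          rw [hρ]
          field_simp
        simp_rw [this]
        rw [integral_const_mul, h0, mul_zero]
      have πc : Continuous (π ε) := (hπ ε ⟨hε0, hε.2.trans_le hε₁₀⟩).contDiff.continuous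
      have ρc : Continuous ρ := by
        have := hφ.continuous
        fun_prop
      have hsupp : ∀ f : EuclideanSpace ℝ (Fin n) → ℝ, (∀ y ∉ tsupport χ, f y = 0) → Continuous f →
          Integrable f := fun f h1 h2 =>
        h2.integrable_of_hasCompactSupport (HasCompactSupport.intro hχc h1)
      have i1 : Integrable fun y => χ y • (ω y * H y) := hsupp _ (fun y hy => by
        simp [image_eq_zero_of_notMem_tsupport hy]) (hχ2.continuous.smul (hω.mul hHc))
      have i2 : Integrable fun y => ρ y * (χ y * H y + ε * firstOrderTerm b D φ χ y +
          ε ^ 2 * diffOp D χ y) := hsupp _ (fun y hy => by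
        simp [image_eq_zero_of_notMem_tsupport hy, kzero y hy, mzero y hy])
        (ρc.mul (((hχ2.continuous.mul hHc).add (kc.const_mul ε)).add (mc.const_mul _)))
      have h5 : ∫ y, χ y • (ω y * H y) = ∫ y, (χ y • (ω y * H y) -
          ρ y * (χ y * H y + ε * firstOrderTerm b D φ χ y + ε ^ 2 * diffOp D χ y)) := by
        rw [integral_sub i1 i2, h4, sub_zero]
      rw [h5, ← setIntegral_eq_integral_of_forall_compl_eq_zero (s := 𝒟)]
      · have h6 : ∀ y ∈ 𝒟, ‖χ y • (ω y * H y) -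
          ρ y * (χ y * H y + ε * firstOrderTerm b D φ χ y + ε ^ 2 * diffOp D χ y)‖ ≤ ε * B := by
          intro y hy
          have hω0 := (hω_pos y hy).le
          have e1 : χ y • (ω y * H y) -
              ρ y * (χ y * H y + ε * firstOrderTerm b D φ χ y + ε ^ 2 * diffOp D χ y) =
              -((ρ y - ω y) * (χ y * H y)) -
                ε * (ρ y * (firstOrderTerm b D φ χ y + ε * diffOp D χ y)) := by
            simp only [smul_eq_mul]; ring
          have hωB : ω y ≤ Bω := (le_abs_self _).trans (hBω y hy)
          have e2 : |(ρ y - ω y) * (χ y * H y)| ≤ C * ε * Bω * Bh := by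
            rw [abs_mul]
            calc _ ≤ (C * ε * ω y) * Bh := by
                  gcongr
                  exacts [hρb y hy, hBh y hy]
              _ ≤ _ := by gcongr
          have e3 : |ρ y| ≤ (1 + C) * Bω := by
            have := hρb y hy
            have h7 : |ρ y| ≤ |ρ y - ω y| + |ω y| := by simpa using abs_add_le (ρ y - ω y) (ω y)
            have h8 : C * ε * ω y ≤ C * 1 * Bω := by gcongr
            have h9 := hBω y hy
            linarith
          have e4 : |firstOrderTerm b D φ χ y + ε * diffOp D χ y| ≤ Bk + Bm := by
            refine (abs_add_le _ _).trans (add_le_add (hBk y hy) ?_)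
            rw [abs_mul, abs_of_pos hε0]
            exact (mul_le_of_le_one_left (abs_nonneg _) hε1).trans (hBm y hy)
          rw [e1, Real.norm_eq_abs]
          calc _ ≤ |(ρ y - ω y) * (χ y * H y)| +
                |ε * (ρ y * (firstOrderTerm b D φ χ y + ε * diffOp D χ y))| := by
                have := abs_sub (-((ρ y - ω y) * (χ y * H y)))
                  (ε * (ρ y * (firstOrderTerm b D φ χ y + ε * diffOp D χ y)))
                rwa [abs_neg] at this
            _ ≤ C * ε * Bω * Bh + ε * ((1 + C) * Bω * (Bk + Bm)) := by
                rw [abs_mul ε, abs_of_pos hε0, abs_mul (ρ y)]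
                gcongr
            _ = _ := by rw [hBdef]; ring
        have := norm_setIntegral_le_of_norm_le_const (h𝒟.measure_lt_top (μ := volume)) h6
        rw [Real.norm_eq_abs] at this
        exact this.trans (le_of_eq (by ring))
      · intro y hy
        have hy' : y ∉ tsupport χ := fun h => hy (interior_subset (hχs h))
        simp [image_eq_zero_of_notMem_tsupport hy', kzero y hy', mzero y hy']
    have hlim : Tendsto (fun ε : ℝ => ε * (B * volume.real 𝒟)) (𝓝[>] 0) (𝓝 0) := by
      have : Tendsto (fun ε : ℝ => ε * (B * volume.real 𝒟)) (𝓝 0) (𝓝 (0 * (B * volume.real 𝒟))) :=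
        (continuous_id.mul continuous_const).tendsto 0
      rw [zero_mul] at this
      exact this.mono_left nhdsWithin_le_nhds
    have hle : |∫ y, χ y • (ω y * H y)| ≤ 0 := by
      refine ge_of_tendsto hlim ?_
      filter_upwards [Ioo_mem_nhdsGT hε₁] with ε hε
      exact hest ε hε
    exact abs_eq_zero.1 (le_antisymm hle (abs_nonneg _))
  -- Test functions live in the open interior, so vanishing holds there almost everywhere, then
  -- everywhere by continuity.
  have hae := isOpen_interior.ae_eq_zero_of_integral_contDiff_smul_eq_zero (U := interior 𝒟)
    (f := fun y => ω y * H y) (μ := volume)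
    (((hω.mul hHc).locallyIntegrable).locallyIntegrableOn _) hkey
  have hint : EqOn (fun y => ω y * H y) (fun _ => 0) (interior 𝒟) := by
    refine Measure.eqOn_open_of_ae_eq (μ := volume) ?_ isOpen_interior
      (hω.mul hHc).continuousOn continuousOn_const
    rw [Filter.EventuallyEq, ae_restrict_iff' isOpen_interior.measurableSet]
    exact hae
  -- Here 𝒟 being in the closure of its interior carries the equation to boundary points.
  have hcl : EqOn (fun y => ω y * H y) (fun _ => 0) (closure (interior 𝒟)) :=
    hint.closure (hω.mul hHc) continuous_const
  intro y hy
  have := hcl (hreg hy)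
  exact (mul_eq_zero.1 this).resolve_left (hω_pos y hy).ne'

/-! ### Closed orbits -/

theorem exists_lipschitzOnWith_closedBall {E F : Type*} [NormedAddCommGroup E] [NormedSpace ℝ E]
    [FiniteDimensional ℝ E] [NormedAddCommGroup F] [NormedSpace ℝ F] {f : E → F}
    (hf : ContDiff ℝ 1 f) (R : ℝ) :
    ∃ K, LipschitzOnWith K f (Metric.closedBall 0 R) := by
  have := FiniteDimensional.proper_real E
  obtain ⟨C, hC⟩ := (isCompact_closedBall (0 : E) R).exists_bound_of_continuousOn
    (hf.continuous_fderiv one_ne_zero).continuousOn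
  refine ⟨C.toNNReal, (convex_closedBall (0 : E) R).lipschitzOnWith_of_nnnorm_fderiv_le
    (𝕜 := ℝ) (fun y _ => hf.differentiable one_ne_zero y) fun y hy => ?_⟩
  rw [← norm_toNNReal]
  exact Real.toNNReal_mono (hC y hy)

namespace IsClosedOrbit

variable {n : ℕ} {b : EuclideanSpace ℝ (Fin n) → EuclideanSpace ℝ (Fin n)}
  {x : ℝ → EuclideanSpace ℝ (Fin n)} {T : ℝ}

theorem continuous (hx : IsClosedOrbit b x T) : Continuous x :=
  continuous_iff_continuousAt.2 fun t => (hx.solves t).continuousAt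

theorem deriv_eq (hx : IsClosedOrbit b x T) (t : ℝ) : deriv x t = b (x t) := (hx.solves t).deriv

theorem exists_mem_Ico (hx : IsClosedOrbit b x T) (t : ℝ) : ∃ s ∈ Ico 0 T, x t = x s :=
  hx.periodic.exists_mem_Ico₀ hx.period_pos t

theorem range_eq_image (hx : IsClosedOrbit b x T) : range x = x '' Icc 0 T := by
  refine subset_antisymm ?_ (image_subset_range _ _)
  rintro _ ⟨t, rfl⟩
  obtain ⟨s, hs, h⟩ := hx.exists_mem_Ico t
  exact ⟨s, Ico_subset_Icc_self hs, h.symm⟩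

theorem isCompact_range (hx : IsClosedOrbit b x T) : IsCompact (range x) := by
  rw [hx.range_eq_image]
  exact isCompact_Icc.image hx.continuous

theorem exists_int_of_eq (hx : IsClosedOrbit b x T) {s t : ℝ} (h : x s = x t) :
    ∃ k : ℤ, s = t + k * T := by
  have hT := hx.period_pos
  have h1 := toIcoMod_mem_Ico hT 0 s
  have h2 := toIcoMod_mem_Ico hT 0 t
  rw [zero_add] at h1 h2
  have e : ∀ r, x (toIcoMod hT 0 r) = x r := fun r => by
    rw [toIcoMod, hx.periodic.sub_zsmul_eq]
  have := hx.injOn h1 h2 (by rw [e, e, h])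
  refine ⟨toIcoDiv hT 0 s - toIcoDiv hT 0 t, ?_⟩
  have a1 := toIcoMod_add_toIcoDiv_zsmul hT 0 s
  have a2 := toIcoMod_add_toIcoDiv_zsmul hT 0 t
  rw [zsmul_eq_mul] at a1 a2
  push_cast
  linarith

/-- A zero of b on the orbit would be an equilibrium; uniqueness for the equation would make the
orbit constant, against injectivity on one period. -/
theorem field_ne_zero (hx : IsClosedOrbit b x T) (hb : ContDiff ℝ 1 b) (t : ℝ) : b (x t) ≠ 0 := by
  intro h0
  obtain ⟨R, hR⟩ := hx.isCompact_range.isBounded.subset_closedBall 0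
  obtain ⟨K, hK⟩ := exists_lipschitzOnWith_closedBall hb R
  have hconst : x = fun _ => x t := by
    refine ODE_solution_unique_univ (v := fun _ => b) (s := fun _ => Metric.closedBall 0 R)
      (t₀ := t) (fun _ => hK) (fun s => ⟨hx.solves s, hR (mem_range_self s)⟩)
      (fun s => ⟨?_, hR (mem_range_self t)⟩) rfl
    rw [h0]
    exact hasDerivAt_const _ _
  have hT := hx.period_pos
  have := hx.injOn (x₁ := 0) (x₂ := T / 2) ⟨le_rfl, hT⟩ ⟨by linarith, by linarith⟩
    ((congrFun hconst 0).trans (congrFun hconst (T / 2)).symm)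
  linarith

end IsClosedOrbit

/-! ### The rate function as a Lyapunov function -/

section Lyapunov

variable {n : ℕ} {b : EuclideanSpace ℝ (Fin n) → EuclideanSpace ℝ (Fin n)}
  {D : Matrix (Fin n) (Fin n) ℝ} {φ : EuclideanSpace ℝ (Fin n) → ℝ}
  {x : ℝ → EuclideanSpace ℝ (Fin n)} {T : ℝ} {𝒟 : Set (EuclideanSpace ℝ (Fin n))}

theorem fderiv_field_eq (y : EuclideanSpace ℝ (Fin n))
    (h : fderiv ℝ φ y (circField b D φ y) = 0) :
    fderiv ℝ φ y (b y) = -inner ℝ (gradient φ y) (diffCLM D (gradient φ y)) := by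
  rw [circField, map_add, diffAct_eq] at h
  rw [inner_gradient_left]
  linarith

theorem fderiv_field_nonpos (hD : D.PosDef) (y : EuclideanSpace ℝ (Fin n))
    (h : fderiv ℝ φ y (circField b D φ y) = 0) : fderiv ℝ φ y (b y) ≤ 0 := by
  rw [fderiv_field_eq y h, neg_nonpos]
  by_cases h0 : gradient φ y = 0
  · simp [h0]
  · exact (inner_diffCLM_pos hD h0).le

/-- The rate function is nonincreasing along the orbit and periodic in time. Moving the starting
time by enough periods past any other time gives the inequality in both directions. -/
theorem IsClosedOrbit.potential_const (hx : IsClosedOrbit b x T) (hD : D.PosDef)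
    (hφ : Differentiable ℝ φ)
    (hHJ : ∀ y ∈ range x, fderiv ℝ φ y (circField b D φ y) = 0) (s t : ℝ) : φ (x s) = φ (x t) := by
  have hd : ∀ t, HasDerivAt (fun t => φ (x t)) (fderiv ℝ φ (x t) (b (x t))) t := fun t =>
    (hφ (x t)).hasFDerivAt.comp_hasDerivAt t (hx.solves t)
  have hanti : Antitone fun t => φ (x t) := antitone_of_hasDerivAt_nonpos hd fun t =>
    fderiv_field_nonpos hD _ (hHJ _ (mem_range_self t))
  have hle : ∀ s t, φ (x s) ≤ φ (x t) := by
    intro s t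
    obtain ⟨k, hk⟩ := exists_nat_gt ((t - s) / T)
    rw [div_lt_iff₀ hx.period_pos] at hk
    have h1 : x s = x (s + k * T) := by
      have := hx.periodic.nat_mul k s
      exact this.symm
    rw [h1]
    exact hanti (by linarith)
  exact le_antisymm (hle s t) (hle t s)

/-- The derivative of the constant value along the orbit equals −⟨∇φ, D∇φ⟩, which vanishes only for
∇φ = 0. -/
theorem IsClosedOrbit.gradient_eq_zero (hx : IsClosedOrbit b x T) (hD : D.PosDef)
    (hφ : Differentiable ℝ φ)
    (hHJ : ∀ y ∈ range x, fderiv ℝ φ y (circField b D φ y) = 0) (t : ℝ) :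
    gradient φ (x t) = 0 := by
  have hd : HasDerivAt (fun t => φ (x t)) (fderiv ℝ φ (x t) (b (x t))) t :=
    (hφ (x t)).hasFDerivAt.comp_hasDerivAt t (hx.solves t)
  have hc : (fun t => φ (x t)) = fun _ => φ (x 0) :=
    funext fun t => hx.potential_const hD hφ hHJ t 0
  rw [hc] at hd
  have h0 := hd.unique (hasDerivAt_const t _)
  rw [fderiv_field_eq _ (hHJ _ (mem_range_self t)), neg_eq_zero] at h0
  by_contra hne
  exact (inner_diffCLM_pos hD hne).ne' h0

theorem antitoneOn_potential (hD : D.PosDef) (hφ : Differentiable ℝ φ)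
    (hHJ : ∀ y ∈ 𝒟, fderiv ℝ φ y (circField b D φ y) = 0) {z : ℝ → EuclideanSpace ℝ (Fin n)}
    (hz : ∀ t, 0 ≤ t → HasDerivWithinAt z (b (z t)) (Ici 0) t) (hz𝒟 : ∀ t, 0 ≤ t → z t ∈ 𝒟) :
    AntitoneOn (fun t => φ (z t)) (Ici 0) := by
  refine antitoneOn_of_hasDerivWithinAt_nonpos (f' := fun t => fderiv ℝ φ (z t) (b (z t)))
    (convex_Ici 0) ?_ ?_ ?_
  · exact fun t ht => hφ.continuous.continuousAt.comp_continuousWithinAt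
      (hz t ht).continuousWithinAt
  · intro t ht
    have ht' : 0 ≤ t := interior_subset ht
    exact ((hφ (z t)).hasFDerivAt.comp_hasDerivWithinAt t (hz t ht')).mono interior_subset
  · intro t ht
    have ht' : 0 ≤ t := interior_subset ht
    exact fderiv_field_nonpos hD _ (hHJ _ (hz𝒟 t ht'))

/-- The trajectory from y lowers φ and comes arbitrarily close to Γ, near which φ exceeds its value
on Γ minus any η > 0. -/
theorem IsClosedOrbit.potential_le (hx : IsClosedOrbit b x T) (hD : D.PosDef)
    (hφ : Differentiable ℝ φ) (hcycle : range x ⊆ 𝒟)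
    (hHJ : ∀ y ∈ 𝒟, fderiv ℝ φ y (circField b D φ y) = 0)
    (hattr : AttractedWithin b 𝒟 (range x)) {y : EuclideanSpace ℝ (Fin n)} (hy : y ∈ 𝒟) :
    φ (x 0) ≤ φ y := by
  obtain ⟨z, hz0, hz, hz𝒟, hlim⟩ := hattr y hy
  have hanti := antitoneOn_potential hD hφ hHJ hz hz𝒟
  refine le_of_forall_pos_le_add fun η hη => ?_
  have hU : IsOpen {w | φ (x 0) - η < φ w} := isOpen_lt continuous_const hφ.continuous
  obtain ⟨r, hr, hsub⟩ := hx.isCompact_range.exists_thickening_subset_open hU (by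
    rintro _ ⟨t, rfl⟩
    have := hx.potential_const hD hφ (fun y hy => hHJ y (hcycle hy)) t 0
    simp only [mem_ofPred_eq, this]
    linarith)
  obtain ⟨t, ht0, ht⟩ := ((eventually_ge_atTop (0 : ℝ)).and (hlim.eventually_lt_const hr)).exists
  have h1 : z t ∈ Metric.thickening r (range x) :=
    (Metric.mem_thickening_iff_infDist_lt ⟨x 0, mem_range_self 0⟩).2 ht
  have h2 := hsub h1
  have h3 := hanti (mem_Ici.2 le_rfl) (mem_Ici.2 ht0) ht0
  simp only [mem_ofPred_eq, hz0] at h2 h3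
  linarith

/-- A point of the basin at the minimal level of the rate function lies on the cycle, if this is so
near the cycle. -/
theorem IsClosedOrbit.mem_range_of_potential_le (hx : IsClosedOrbit b x T) (hb : ContDiff ℝ 1 b)
    (hD : D.PosDef) (h𝒟 : IsCompact 𝒟)
    (hφ : Differentiable ℝ φ) (hcycle : range x ⊆ 𝒟)
    (hHJ : ∀ y ∈ 𝒟, fderiv ℝ φ y (circField b D φ y) = 0)
    (hattr : AttractedWithin b 𝒟 (range x)) {δ : ℝ} (hδ : 0 < δ)
    (hloc : ∀ y, Metric.infDist y (range x) ≤ δ → φ y ≤ φ (x 0) → y ∈ range x)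
    {y : EuclideanSpace ℝ (Fin n)} (hy : y ∈ 𝒟) (hle : φ y ≤ φ (x 0)) : y ∈ range x := by
  obtain ⟨z, hz0, hz, hz𝒟, hlim⟩ := hattr y hy
  have hanti := antitoneOn_potential hD hφ hHJ hz hz𝒟
  obtain ⟨t, ht0, ht⟩ := ((eventually_ge_atTop (0 : ℝ)).and (hlim.eventually_lt_const hδ)).exists
  have h3 := hanti (mem_Ici.2 le_rfl) (mem_Ici.2 ht0) ht0
  simp only [hz0] at h3
  -- Once close to Γ at no higher level, the trajectory is on Γ by the local hypothesis.
  obtain ⟨s, hs⟩ := hloc (z t) ht.le (h3.trans hle)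
  obtain ⟨R, hR⟩ := h𝒟.isBounded.subset_closedBall 0
  obtain ⟨K, hK⟩ := exists_lipschitzOnWith_closedBall hb R
  have hder : ∀ r, HasDerivAt (fun r => x (r + (s - t))) (b (x (r + (s - t)))) r := fun r =>
    (hx.solves (r + (s - t))).comp_add_const r (s - t)
  -- Backward uniqueness from time t: the trajectory was on the cycle from the start.
  have huniq := ODE_solution_unique_of_mem_Icc_left (v := fun _ => b)
    (s := fun _ => Metric.closedBall 0 R) (K := K) (f := z) (g := fun r => x (r + (s - t)))
    (a := 0) (b := t) (fun _ _ => hK)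
    (fun r hr => ((hz r hr.1).continuousWithinAt).mono fun w hw => hw.1)
    (fun r hr => ((hz r hr.1.le).hasDerivAt (Ici_mem_nhds hr.1)).hasDerivWithinAt)
    (fun r hr => hR (hz𝒟 r hr.1.le))
    (fun r _ => (hder r).continuousAt.continuousWithinAt)
    (fun r _ => (hder r).hasDerivWithinAt)
    (fun r _ => hR (hcycle (mem_range_self _)))
    (by simp [hs])
  have := huniq (left_mem_Icc.2 ht0)
  rw [hz0] at this
  rw [this]
  exact mem_range_self _

end Lyapunov

/-! ### Uniform Taylor expansions -/

set_option maxSynthPendingDepth 3 in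
/-- Uniform third order Taylor expansion of a `C⁴` function on a ball. -/
theorem exists_taylor_three_bound {E : Type*} [NormedAddCommGroup E] [NormedSpace ℝ E]
    [FiniteDimensional ℝ E] {φ : E → ℝ} (hφ : ContDiff ℝ 4 φ) (R : ℝ) :
    ∃ C : ℝ, 0 ≤ C ∧ ∀ y ∈ Metric.closedBall (0 : E) R,
      ‖fderiv ℝ (fderiv ℝ (fderiv ℝ φ)) y‖ ≤ C ∧ ∀ w : E, ‖w‖ ≤ 1 →
      |φ (y + w) - φ y - fderiv ℝ φ y w - fderiv ℝ (fderiv ℝ φ) y w w / 2 -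
        fderiv ℝ (fderiv ℝ (fderiv ℝ φ)) y w w w / 6| ≤ C * ‖w‖ ^ 4 := by
  have := FiniteDimensional.proper_real E
  have c1 : ContDiff ℝ 3 (fderiv ℝ φ) := hφ.fderiv_right (by norm_num)
  have c2 : ContDiff ℝ 2 (fderiv ℝ (fderiv ℝ φ)) := c1.fderiv_right (by norm_num)
  have c3 : ContDiff ℝ 1 (fderiv ℝ (fderiv ℝ (fderiv ℝ φ))) := c2.fderiv_right (by norm_num)
  have d0 : Differentiable ℝ φ := hφ.differentiable (by norm_num)
  have d1 := c1.differentiable (by norm_num)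
  have d2 := c2.differentiable (by norm_num)
  -- The third derivative is Lipschitz on a ball enlarged by 1, which contains y + s w for ‖w‖ ≤ 1.
  obtain ⟨K, hK⟩ := exists_lipschitzOnWith_closedBall c3 (R + 1)
  obtain ⟨B, hB⟩ := (isCompact_closedBall (0 : E) R).exists_bound_of_continuousOn
    c3.continuous.continuousOn
  refine ⟨max B K, K.2.trans (le_max_right _ _), fun y hy => ⟨(hB y hy).trans (le_max_left _ _),
    fun w hw => ?_⟩⟩
  have hline : ∀ s : ℝ, HasDerivAt (fun s : ℝ => y + s • w) w s := fun s => by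
    simpa using ((hasDerivAt_id s).smul_const w).const_add y
  have hy0 : y ∈ Metric.closedBall (0 : E) (R + 1) :=
    Metric.closedBall_subset_closedBall (by linarith) hy
  have key := abs_sub_taylor_three_le (f := fun s : ℝ => φ (y + s • w))
    (f1 := fun s => fderiv ℝ φ (y + s • w) w)
    (f2 := fun s => fderiv ℝ (fderiv ℝ φ) (y + s • w) w w)
    (f3 := fun s => fderiv ℝ (fderiv ℝ (fderiv ℝ φ)) (y + s • w) w w w)
    (K := K * ‖w‖ ^ 4)
    (fun s _ => (d0 _).hasFDerivAt.comp_hasDerivAt s (hline s))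
    (fun s _ => ((d1 _).hasFDerivAt.comp_hasDerivAt s (hline s)).clm_apply
      (hasDerivAt_const s w) |>.congr_deriv (by simp))
    (fun s _ => (((d2 _).hasFDerivAt.comp_hasDerivAt s (hline s)).clm_apply
      (hasDerivAt_const s w)).clm_apply (hasDerivAt_const s w) |>.congr_deriv (by simp))
    (fun s hs => by
      have hsw : ‖s • w‖ ≤ ‖w‖ := by
        rw [norm_smul, Real.norm_eq_abs, abs_of_nonneg hs.1]
        exact mul_le_of_le_one_left (norm_nonneg _) hs.2
      have hys : y + s • w ∈ Metric.closedBall (0 : E) (R + 1) := by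
        rw [mem_closedBall_zero_iff] at hy ⊢
        exact (norm_add_le _ _).trans (add_le_add hy (hsw.trans hw))
      have h1 := hK.norm_sub_le hys hy0
      rw [add_sub_cancel_left] at h1
      set L := fderiv ℝ (fderiv ℝ (fderiv ℝ φ)) (y + s • w) -
        fderiv ℝ (fderiv ℝ (fderiv ℝ φ)) y with hL
      have h2 : fderiv ℝ (fderiv ℝ (fderiv ℝ φ)) (y + s • w) w w w -
          fderiv ℝ (fderiv ℝ (fderiv ℝ φ)) (y + (0 : ℝ) • w) w w w = L w w w := by
        simp [hL]
      rw [h2, ← Real.norm_eq_abs]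
      calc ‖L w w w‖ ≤ ‖L w w‖ * ‖w‖ := (L w w).le_opNorm w
        _ ≤ (‖L w‖ * ‖w‖) * ‖w‖ := by gcongr; exact (L w).le_opNorm w
        _ ≤ ((‖L‖ * ‖w‖) * ‖w‖) * ‖w‖ := by gcongr; exact L.le_opNorm w
        _ ≤ (((K * ‖w‖) * ‖w‖) * ‖w‖) * ‖w‖ := by gcongr; exact h1.trans (by gcongr)
        _ = K * ‖w‖ ^ 4 := by ring)
  simp only [one_smul, zero_smul, add_zero] at key
  exact key.trans (by gcongr; exact le_max_right _ _)

/-- Uniform first order Taylor expansion of a `C²` function on a ball. -/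
theorem exists_taylor_one_bound {E : Type*} [NormedAddCommGroup E] [NormedSpace ℝ E]
    [FiniteDimensional ℝ E] {ω : E → ℝ} (hω : ContDiff ℝ 2 ω) (R : ℝ) :
    ∃ C : ℝ, 0 ≤ C ∧ ∀ y ∈ Metric.closedBall (0 : E) R,
      |ω y| ≤ C ∧ ‖fderiv ℝ ω y‖ ≤ C ∧ ∀ w : E, ‖w‖ ≤ 1 →
      |ω (y + w) - ω y - fderiv ℝ ω y w| ≤ C * ‖w‖ ^ 2 := by
  have := FiniteDimensional.proper_real E
  have c1 : ContDiff ℝ 1 (fderiv ℝ ω) := hω.fderiv_right (by norm_num)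
  have d0 : Differentiable ℝ ω := hω.differentiable (by norm_num)
  obtain ⟨K, hK⟩ := exists_lipschitzOnWith_closedBall c1 (R + 1)
  obtain ⟨B, hB⟩ := (isCompact_closedBall (0 : E) R).exists_bound_of_continuousOn
    c1.continuous.continuousOn
  obtain ⟨B', hB'⟩ := (isCompact_closedBall (0 : E) R).exists_bound_of_continuousOn
    hω.continuous.continuousOn
  refine ⟨max (max B B') K, K.2.trans (le_max_right _ _), fun y hy =>
    ⟨(hB' y hy).trans ((le_max_right _ _).trans (le_max_left _ _)),
    (hB y hy).trans ((le_max_left _ _).trans (le_max_left _ _)), fun w hw => ?_⟩⟩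
  have hy0 : y ∈ Metric.closedBall (0 : E) (R + 1) :=
    Metric.closedBall_subset_closedBall (by linarith) hy
  have h := (convex_closedBall y ‖w‖).norm_image_sub_le_of_norm_fderiv_le' (𝕜 := ℝ) (f := ω)
    (φ := fderiv ℝ ω y) (C := K * ‖w‖) (x := y) (y := y + w) (fun z _ => d0 z)
    (fun z hz => by
      rw [mem_closedBall_iff_norm] at hz
      have hz' : z ∈ Metric.closedBall (0 : E) (R + 1) := by
        rw [mem_closedBall_zero_iff] at hy ⊢
        calc ‖z‖ = ‖y + (z - y)‖ := by rw [add_sub_cancel]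
          _ ≤ R + 1 := (norm_add_le _ _).trans (add_le_add hy (hz.trans hw))
      exact (hK.norm_sub_le hz' hy0).trans (by gcongr))
    (Metric.mem_closedBall_self (norm_nonneg _)) (by simp)
  rw [add_sub_cancel_left, Real.norm_eq_abs] at h
  refine h.trans ?_
  rw [mul_assoc, ← pow_two]
  gcongr
  exact le_max_right _ _

/-! ### The Hessian on the cycle -/

/-- The direction of the field `b`. -/
noncomputable def unitField {E : Type*} [NormedAddCommGroup E] [NormedSpace ℝ E] (b : E → E)
    (y : E) : E := ‖b y‖⁻¹ • b y

theorem norm_unitField {E : Type*} [NormedAddCommGroup E] [NormedSpace ℝ E] {b : E → E}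
    {y : E} (h : b y ≠ 0) : ‖unitField b y‖ = 1 := by
  rw [unitField, norm_smul, norm_inv, norm_norm, inv_mul_cancel₀ (norm_ne_zero_iff.2 h)]

/-- The Hessian completed by the projection onto the direction of `b`. -/
noncomputable def completedHessian {n : ℕ}
    (b : EuclideanSpace ℝ (Fin n) → EuclideanSpace ℝ (Fin n))
    (φ : EuclideanSpace ℝ (Fin n) → ℝ) (y : EuclideanSpace ℝ (Fin n)) :
    EuclideanSpace ℝ (Fin n) →ₗ[ℝ] EuclideanSpace ℝ (Fin n) :=
  hessian φ y + (innerₛₗ ℝ (unitField b y)).smulRight (unitField b y)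

section Hessian

variable {n : ℕ} {b : EuclideanSpace ℝ (Fin n) → EuclideanSpace ℝ (Fin n)}
  {D : Matrix (Fin n) (Fin n) ℝ} {φ : EuclideanSpace ℝ (Fin n) → ℝ}
  {x : ℝ → EuclideanSpace ℝ (Fin n)} {T : ℝ} {𝒟 : Set (EuclideanSpace ℝ (Fin n))}

theorem contDiff_gradient {k m : WithTop ℕ∞} (hφ : ContDiff ℝ m φ) (h : k + 1 ≤ m) :
    ContDiff ℝ k (gradient φ) :=
  (InnerProductSpace.toDual ℝ (EuclideanSpace ℝ (Fin n))).symm.contDiff.comp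
    (hφ.fderiv_right h)

theorem inner_hessian_left (hφ : ContDiff ℝ 2 φ) (y v w : EuclideanSpace ℝ (Fin n)) :
    inner ℝ (hessian φ y v) w = fderiv ℝ (fderiv ℝ φ) y v w := by
  have hd : DifferentiableAt ℝ (fderiv ℝ φ) y :=
    (hφ.fderiv_right (m := 1) (by norm_num)).differentiable one_ne_zero y
  have h : HasFDerivAt (gradient φ)
      ((InnerProductSpace.toDual ℝ (EuclideanSpace ℝ (Fin n))).symm.toContinuousLinearEquiv.toContinuousLinearMap.comp
        (fderiv ℝ (fderiv ℝ φ) y)) y :=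
    (InnerProductSpace.toDual ℝ
      (EuclideanSpace ℝ (Fin n))).symm.toContinuousLinearEquiv.hasFDerivAt.comp y hd.hasFDerivAt
  rw [hessian, h.fderiv]
  exact InnerProductSpace.toDual_symm_apply

theorem hessian_isSymmetric (hφ : ContDiff ℝ 2 φ) (y : EuclideanSpace ℝ (Fin n)) :
    (hessian φ y).IsSymmetric := by
  intro v w
  rw [real_inner_comm _ v, inner_hessian_left hφ, inner_hessian_left hφ]
  exact (hφ.contDiffAt.isSymmSndFDerivAt (by simp)) v w

theorem completedHessian_isSymmetric (hφ : ContDiff ℝ 2 φ) (y : EuclideanSpace ℝ (Fin n)) :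
    (completedHessian b φ y).IsSymmetric := by
  intro v w
  simp only [completedHessian, LinearMap.add_apply, inner_add_left, inner_add_right,
    hessian_isSymmetric hφ y v w, LinearMap.smulRight_apply, innerₛₗ_apply_apply,
    inner_smul_left, inner_smul_right, RCLike.conj_to_real]
  rw [real_inner_comm v]
  ring

theorem inner_completedHessian (hφ : ContDiff ℝ 2 φ) (y w : EuclideanSpace ℝ (Fin n)) :
    inner ℝ (completedHessian b φ y w) w =
      fderiv ℝ (fderiv ℝ φ) y w w + inner ℝ (unitField b y) w ^ 2 := by
  rw [completedHessian, LinearMap.add_apply, inner_add_left, inner_hessian_left hφ]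
  simp [inner_smul_left, pow_two]

-- The Taylor expansion at y along s w, divided by s² with s → 0 from the right; the first order
-- term is absent at a minimum.
set_option maxSynthPendingDepth 3 in
theorem snd_fderiv_nonneg_of_isLocalMin (hφ : ContDiff ℝ 4 φ) {y : EuclideanSpace ℝ (Fin n)}
    (hmin : IsLocalMin φ y) (w : EuclideanSpace ℝ (Fin n)) :
    0 ≤ fderiv ℝ (fderiv ℝ φ) y w w := by
  obtain ⟨C, hC, hT⟩ := exists_taylor_three_bound hφ ‖y‖
  have hT' := (hT y (by simp)).2
  set A := fderiv ℝ (fderiv ℝ φ) y w w with hA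
  set B := fderiv ℝ (fderiv ℝ (fderiv ℝ φ)) y w w w with hB
  have hlim : Tendsto (fun s : ℝ => A / 2 + s * B / 6 + C * s ^ 2 * ‖w‖ ^ 4) (𝓝[>] 0)
      (𝓝 (A / 2)) := by
    have : Continuous fun s : ℝ => A / 2 + s * B / 6 + C * s ^ 2 * ‖w‖ ^ 4 := by fun_prop
    have h := this.tendsto 0
    simp only [zero_mul, zero_div, add_zero, ne_eq, OfNat.ofNat_ne_zero, not_false_eq_true,
      zero_pow, mul_zero] at h
    exact h.mono_left nhdsWithin_le_nhds
  have hcont : Tendsto (fun s : ℝ => y + s • w) (𝓝[>] 0) (𝓝 y) := by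
    have : Continuous fun s : ℝ => y + s • w := by fun_prop
    have h := this.tendsto 0
    simp only [zero_smul, add_zero] at h
    exact h.mono_left nhdsWithin_le_nhds
  have hsmall : ∀ᶠ s : ℝ in 𝓝[>] 0, ‖s • w‖ ≤ 1 := by
    have : Continuous fun s : ℝ => ‖s • w‖ := by fun_prop
    have h := this.tendsto 0
    simp only [zero_smul, norm_zero] at h
    exact ((h.mono_left nhdsWithin_le_nhds).eventually_lt_const one_pos).mono fun s hs => hs.le
  have hge : ∀ᶠ s : ℝ in 𝓝[>] 0, 0 ≤ A / 2 + s * B / 6 + C * s ^ 2 * ‖w‖ ^ 4 := by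
    filter_upwards [hcont.eventually hmin, hsmall, self_mem_nhdsWithin] with s h1 h2 h3
    have hs : 0 < s := h3
    have h4 := hT' _ h2
    rw [hmin.fderiv_eq_zero] at h4
    simp only [zero_apply, map_smul, smul_apply,
      smul_eq_mul, ← hA, ← hB, norm_smul, Real.norm_eq_abs, abs_of_pos hs] at h4
    have h5 := (abs_le.1 h4).2
    have h6 : 0 ≤ s ^ 2 * (A / 2 + s * B / 6 + C * s ^ 2 * ‖w‖ ^ 4) := by nlinarith
    exact nonneg_of_mul_nonneg_right h6 (by positivity)
  have := ge_of_tendsto hlim hge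
  linarith

/-- Differentiating ∇φ = 0 in time along the orbit. -/
theorem IsClosedOrbit.hessian_field (hx : IsClosedOrbit b x T) (hφ : ContDiff ℝ 2 φ)
    (hgrad : ∀ t, gradient φ (x t) = 0) (t : ℝ) : hessian φ (x t) (b (x t)) = 0 := by
  have hd : DifferentiableAt ℝ (gradient φ) (x t) :=
    (contDiff_gradient hφ (k := 1) (by norm_num)).differentiable one_ne_zero _
  have h1 := hd.hasFDerivAt.comp_hasDerivAt t (hx.solves t)
  have h2 : gradient φ ∘ x = fun _ => 0 := funext hgrad
  rw [h2] at h1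
  exact h1.unique (hasDerivAt_const t _)

/-- On the cycle the completed Hessian is uniformly positive definite. -/
theorem IsClosedOrbit.exists_completedHessian_lower_bound (hx : IsClosedOrbit b x T)
    (hb : ContDiff ℝ 1 b) (hφ : ContDiff ℝ 4 φ) (hmin : ∀ y ∈ range x, IsLocalMin φ y)
    (hgrad : ∀ t, gradient φ (x t) = 0)
    (hker : ∀ y ∈ range x, Module.finrank ℝ (LinearMap.ker (hessian φ y)) ≤ 1) :
    ∃ lam : ℝ, 0 < lam ∧ ∀ y ∈ range x, ∀ w,
      lam * ‖w‖ ^ 2 ≤ inner ℝ (completedHessian b φ y w) w := by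
  have hφ2 : ContDiff ℝ 2 φ := hφ.of_le (by norm_num)
  have hpos : ∀ y ∈ range x, ∀ w, w ≠ 0 → 0 < inner ℝ (completedHessian b φ y w) w := by
    rintro _ ⟨t, rfl⟩ w hw
    rw [inner_completedHessian hφ2]
    have h0 := snd_fderiv_nonneg_of_isLocalMin hφ (hmin _ (mem_range_self t))
    have h1 := h0 w
    by_contra hcon
    have h2 : fderiv ℝ (fderiv ℝ φ) (x t) w w = 0 := by
      nlinarith [sq_nonneg (inner ℝ (unitField b (x t)) w)]
    have h3 : inner ℝ (unitField b (x t)) w = 0 := by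
      have : inner ℝ (unitField b (x t)) w ^ 2 = 0 :=
        le_antisymm (by linarith) (sq_nonneg _)
      exact pow_eq_zero_iff two_ne_zero |>.1 this
    -- A null vector w of a nonnegative form lies in its kernel: with v = Hw, the form at w + s v is
    -- 2s‖v‖² + s²c, nonnegative for all s only if v = 0.
    have h4 : hessian φ (x t) w = 0 := by
      set v := hessian φ (x t) w with hv
      set c := fderiv ℝ (fderiv ℝ φ) (x t) v v with hc
      have hc0 : 0 ≤ c := h0 v
      have h5 : ∀ s : ℝ, 0 ≤ 2 * s * ‖v‖ ^ 2 + s ^ 2 * c := by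
        intro s
        have h6 := h0 (w + s • v)
        have h7 : fderiv ℝ (fderiv ℝ φ) (x t) w v = ‖v‖ ^ 2 := by
          rw [← inner_hessian_left hφ2, ← hv, real_inner_self_eq_norm_sq]
        have h8 : fderiv ℝ (fderiv ℝ φ) (x t) v w = ‖v‖ ^ 2 := by
          rw [← h7]
          exact (hφ2.contDiffAt.isSymmSndFDerivAt (by simp)) v w
        simp only [map_add, map_smul, add_apply,
          smul_apply, smul_eq_mul, h2, h7, h8, ← hc] at h6
        nlinarith
      -- Nearly the minimizer −‖v‖²/c; the added 1 allows c = 0.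
      have h9 := h5 (-(‖v‖ ^ 2) / (c + 1))
      have h10 : 2 * (-(‖v‖ ^ 2) / (c + 1)) * ‖v‖ ^ 2 + (-(‖v‖ ^ 2) / (c + 1)) ^ 2 * c =
          -(‖v‖ ^ 4 * (c + 2) / (c + 1) ^ 2) := by
        field_simp
        ring
      rw [h10] at h9
      by_contra hne
      have hvpos : 0 < ‖v‖ := norm_pos_iff.2 hne
      have : 0 < ‖v‖ ^ 4 * (c + 2) / (c + 1) ^ 2 := by positivity
      linarith
    have hbt := hx.field_ne_zero hb t
    -- The kernel is spanned by b, so w is a multiple of b; being also orthogonal to b, it is zero.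
    obtain ⟨c, hc⟩ := exists_smul_eq_of_finrank_ker_le_one hbt (hx.hessian_field hφ2 hgrad t)
      (hker _ (mem_range_self t)) h4
    rw [← hc, unitField, inner_smul_left, inner_smul_right, real_inner_self_eq_norm_sq] at h3
    have hbn : ‖b (x t)‖ ≠ 0 := norm_ne_zero_iff.2 hbt
    simp [hbn] at h3
    apply hw
    rw [← hc, h3, zero_smul]
  have hcont : ContinuousOn (fun q : EuclideanSpace ℝ (Fin n) × EuclideanSpace ℝ (Fin n) =>
      inner ℝ (completedHessian b φ q.1 q.2) q.2) (range x ×ˢ Metric.sphere 0 1) := by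
    simp_rw [inner_completedHessian hφ2]
    have c2 : Continuous (fderiv ℝ (fderiv ℝ φ)) :=
      (hφ2.fderiv_right (m := 1) (by norm_num)).continuous_fderiv one_ne_zero
    have cu : ContinuousOn (fun q : EuclideanSpace ℝ (Fin n) × EuclideanSpace ℝ (Fin n) =>
        unitField b q.1) (range x ×ˢ Metric.sphere 0 1) := by
      have hbc : Continuous fun q : EuclideanSpace ℝ (Fin n) × EuclideanSpace ℝ (Fin n) => b q.1 :=
        hb.continuous.comp continuous_fst
      refine ContinuousOn.smul (ContinuousOn.inv₀ hbc.norm.continuousOn ?_) hbc.continuousOn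
      rintro ⟨_, w⟩ ⟨⟨t, rfl⟩, _⟩
      exact norm_ne_zero_iff.2 (hx.field_ne_zero hb t)
    refine ContinuousOn.add (by fun_prop) ((cu.inner continuousOn_snd).pow 2)
  have hK : IsCompact (range x ×ˢ Metric.sphere (0 : EuclideanSpace ℝ (Fin n)) 1) :=
    hx.isCompact_range.prod (isCompact_sphere _ _)
  have hne : (range x ×ˢ Metric.sphere (0 : EuclideanSpace ℝ (Fin n)) 1).Nonempty :=
    ⟨(x 0, unitField b (x 0)), mem_range_self 0, by
      simpa using norm_unitField (hx.field_ne_zero hb 0)⟩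
  -- The uniform bound is the minimum over the compact product of the cycle and the unit sphere,
  -- extended to all w by homogeneity.
  obtain ⟨⟨y₀, w₀⟩, ⟨hy₀, hw₀⟩, hm⟩ := hK.exists_isMinOn hne hcont
  refine ⟨inner ℝ (completedHessian b φ y₀ w₀) w₀, hpos y₀ hy₀ w₀ (by
    rintro rfl; simp at hw₀), fun y hy w => ?_⟩
  by_cases hw : w = 0
  · simp [hw]
  have hwn : ‖w‖ ≠ 0 := norm_ne_zero_iff.2 hw
  have h1 := isMinOn_iff.1 hm (y, ‖w‖⁻¹ • w) ⟨hy, by simp [norm_smul, hwn]⟩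
  simp only [map_smul, inner_smul_left, inner_smul_right, RCLike.conj_to_real] at h1
  have h2 : ‖w‖⁻¹ * (‖w‖⁻¹ * inner ℝ (completedHessian b φ y w) w) * ‖w‖ ^ 2 =
    inner ℝ (completedHessian b φ y w) w := by field_simp
  rw [← h2]
  gcongr

/-- On the cycle, `√v` is the inverse root of the determinant of the completed Hessian. -/
theorem IsClosedOrbit.sqrt_scaledVariance (hx : IsClosedOrbit b x T)
    (hb : ContDiff ℝ 1 b) (hφ : ContDiff ℝ 2 φ) (hgrad : ∀ t, gradient φ (x t) = 0)
    (hker : ∀ y ∈ range x, Module.finrank ℝ (LinearMap.ker (hessian φ y)) ≤ 1)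
    {y : EuclideanSpace ℝ (Fin n)} (hy : y ∈ range x) :
    Real.sqrt (scaledVariance φ y) =
      1 / Real.sqrt (LinearMap.det (completedHessian b φ y)) := by
  obtain ⟨t, rfl⟩ := hy
  rw [scaledVariance, prodNonzeroEigenvalues_eq_det (hessian_isSymmetric hφ _)
    (norm_unitField (hx.field_ne_zero hb t)) ?_ (hker _ (mem_range_self t)), ← completedHessian,
    Real.sqrt_div zero_le_one, Real.sqrt_one]
  rw [unitField, map_smul, hx.hessian_field hφ hgrad t, smul_zero]

end Hessian

/-! ### Geometry of the normal tube -/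

section TubeGeometry

variable {n : ℕ} {b : EuclideanSpace ℝ (Fin n) → EuclideanSpace ℝ (Fin n)}
  {x : ℝ → EuclideanSpace ℝ (Fin n)} {T : ℝ}

/-- A nearest point of the orbit is critical for the squared distance, so the segment to it is
normal. -/
theorem IsClosedOrbit.exists_infDist_normal (hx : IsClosedOrbit b x T)
    (y : EuclideanSpace ℝ (Fin n)) :
    ∃ t ∈ Ico 0 T, inner ℝ (b (x t)) (y - x t) = 0 ∧
      ‖y - x t‖ = Metric.infDist y (range x) := by
  obtain ⟨_, ⟨t', rfl⟩, ht'⟩ :=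
    hx.isCompact_range.exists_infDist_eq_dist ⟨x 0, mem_range_self 0⟩ y
  obtain ⟨t, htm, ht⟩ := hx.exists_mem_Ico t'
  rw [ht, dist_eq_norm] at ht'
  refine ⟨t, htm, ?_, ht'.symm⟩
  have hmin : IsLocalMin (fun s => ‖y - x s‖ ^ 2) t := by
    refine Eventually.of_forall fun s => ?_
    have : ‖y - x t‖ ≤ ‖y - x s‖ := by
      rw [← ht', ← dist_eq_norm]
      exact Metric.infDist_le_dist_of_mem (mem_range_self s)
    exact pow_le_pow_left₀ (norm_nonneg _) this 2
  have hd := ((hx.solves t).const_sub y).norm_sq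
  have h0 := hmin.hasDerivAt_eq_zero hd
  simp only [inner_neg_right, mul_neg, neg_eq_zero, mul_eq_zero, OfNat.ofNat_ne_zero,
    false_or] at h0
  rw [real_inner_comm]
  exact h0

/-- Every point has a normal foot at its nearest point. The description as a closed neighbourhood
gives measurability of the tube and its inclusion in 𝒟. -/
theorem IsClosedOrbit.normalTube_eq (hx : IsClosedOrbit b x T) (δ : ℝ) :
    normalTube x δ (Ico 0 T) = {y | Metric.infDist y (range x) ≤ δ} := by
  ext y
  constructor
  · rintro ⟨t, -, -, h⟩
    refine le_trans (Metric.infDist_le_dist_of_mem (mem_range_self t)) ?_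
    rwa [dist_eq_norm]
  · intro h
    obtain ⟨t, ht, h1, h2⟩ := hx.exists_infDist_normal y
    exact ⟨t, ht, by rwa [hx.deriv_eq], h2.le.trans h⟩

theorem IsClosedOrbit.exists_bounds (hx : IsClosedOrbit b x T) (hb : ContDiff ℝ 1 b) :
    ∃ m B L : ℝ, 0 < m ∧ 0 < B ∧ 0 < L ∧ (∀ t, m ≤ ‖b (x t)‖) ∧ (∀ t, ‖b (x t)‖ ≤ B) ∧
      ∀ s t, ‖b (x s) - b (x t)‖ ≤ L * |s - t| := by
  have hbc : ContinuousOn (fun y => ‖b y‖) (range x) := hb.continuous.norm.continuousOn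
  obtain ⟨m, hm, hm'⟩ := hx.isCompact_range.exists_forall_le' (a := 0) hbc (by
    rintro _ ⟨t, rfl⟩
    exact norm_pos_iff.2 (hx.field_ne_zero hb t))
  obtain ⟨B, hB⟩ := hx.isCompact_range.exists_bound_of_continuousOn hb.continuous.continuousOn
  obtain ⟨R, hR⟩ := hx.isCompact_range.isBounded.subset_closedBall 0
  obtain ⟨K, hK⟩ := exists_lipschitzOnWith_closedBall hb R
  have hB0 : 0 < B := hm.trans_le ((hm' _ (mem_range_self 0)).trans (hB _ (mem_range_self 0)))
  refine ⟨m, B, K * B + 1, hm, hB0, by positivity, fun t => hm' _ (mem_range_self t),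
    fun t => hB _ (mem_range_self t), fun s t => ?_⟩
  have h1 := hK.norm_sub_le (hR (mem_range_self s)) (hR (mem_range_self t))
  have h2 : ‖x s - x t‖ ≤ B * ‖s - t‖ :=
    convex_univ.norm_image_sub_le_of_norm_hasDerivWithin_le
      (fun r _ => (hx.solves r).hasDerivWithinAt) (fun r _ => hB _ (mem_range_self r))
      (mem_univ t) (mem_univ s)
  rw [Real.norm_eq_abs] at h2
  calc _ ≤ K * ‖x s - x t‖ := h1
    _ ≤ K * (B * |s - t|) := by gcongr
    _ ≤ (K * B + 1) * |s - t| := by nlinarith [abs_nonneg (s - t)]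

/-- Small normal discs centred at different points of the orbit are disjoint. -/
theorem IsClosedOrbit.exists_normal_injective (hx : IsClosedOrbit b x T) (hb : ContDiff ℝ 1 b) :
    ∃ δ₀ : ℝ, 0 < δ₀ ∧ ∀ s ∈ Ico 0 T, ∀ t ∈ Ico 0 T, ∀ v w : EuclideanSpace ℝ (Fin n),
      inner ℝ (b (x s)) v = 0 → inner ℝ (b (x t)) w = 0 → ‖v‖ ≤ δ₀ → ‖w‖ ≤ δ₀ →
      x s + v = x t + w → s = t := by
  obtain ⟨m, B, L, hm, hB, hL, hmle, hBle, hLip⟩ := hx.exists_bounds hb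
  have hT := hx.period_pos
  set τ := m / (4 * L) with hτ
  have hτ0 : 0 < τ := by positivity
  have hKc : IsCompact {q : ℝ × ℝ | q ∈ Icc 0 T ×ˢ Icc 0 T ∧ τ ≤ |q.1 - q.2| ∧
      |q.1 - q.2| ≤ T - τ} := by
    refine (isCompact_Icc.prod isCompact_Icc).inter_right ?_
    have hc : Continuous fun q : ℝ × ℝ => |q.1 - q.2| := by fun_prop
    exact (isClosed_le continuous_const hc).inter (isClosed_le hc continuous_const)
  have hxc := hx.continuous
  -- Times that stay at least τ apart modulo the period give points at a positive distance, by
  -- compactness.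
  obtain ⟨m', hm', hfar⟩ := hKc.exists_forall_le' (f := fun q : ℝ × ℝ => ‖x q.1 - x q.2‖) (a := 0)
    (by fun_prop) (by
      rintro ⟨s, t⟩ ⟨-, h1, h2⟩
      rw [norm_pos_iff, sub_ne_zero]
      intro heq
      obtain ⟨k, hk⟩ := hx.exists_int_of_eq heq
      have hk' : |s - t| = |(k : ℝ)| * T := by
        rw [show s - t = k * T by linarith [show s = t + k * T from hk], abs_mul, abs_of_pos hT]
      simp only [hk'] at h1 h2
      have hk0 : k ≠ 0 := by
        rintro rfl
        simp at h1
        linarith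
      have hk1 : (1 : ℝ) ≤ |(k : ℝ)| := by exact_mod_cast Int.one_le_abs hk0
      nlinarith)
  set δ₀ := min (m ^ 2 / (4 * L)) (m' / 4) with hδ₀
  have hδpos : 0 < δ₀ := by positivity
  have hnear : ∀ s t, |s - t| ≤ τ → ∀ v w : EuclideanSpace ℝ (Fin n),
      inner ℝ (b (x s)) v = 0 → inner ℝ (b (x t)) w = 0 → ‖v‖ ≤ δ₀ →
      x s + v = x t + w → s = t := by
    intro s t hst v w hv hw hvδ heq
    by_contra hne
    have hpos : 0 < |s - t| := abs_pos.2 (sub_ne_zero.2 hne)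
    have h1 : ‖x s - x t - (s - t) • b (x t)‖ ≤ L * |s - t| * |s - t| := by
      have hd : ∀ r ∈ uIcc t s, HasDerivWithinAt (fun r => x r - r • b (x t))
          (b (x r) - b (x t)) (uIcc t s) r := fun r _ => by
        have := (hx.solves r).sub ((hasDerivAt_id r).smul_const (b (x t)))
        rw [one_smul] at this
        exact this.hasDerivWithinAt
      have h2 := (convex_uIcc t s).norm_image_sub_le_of_norm_hasDerivWithin_le
        (C := L * |s - t|) hd (fun r hr => (hLip r t).trans (by
          gcongr L * ?_
          exact abs_sub_left_of_mem_uIcc hr)) left_mem_uIcc right_mem_uIcc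
      rw [Real.norm_eq_abs] at h2
      have e : x s - x t - (s - t) • b (x t) = x s - s • b (x t) - (x t - t • b (x t)) := by
        module
      rwa [e]
    -- Both discs are normal, so only the difference of the two velocities pairs with v. The
    -- displacement along b is thus at most L|s − t|δ₀, too small against |s − t|‖b‖².
    have h3 : inner ℝ (b (x t)) (x s - x t) = -inner ℝ (b (x t) - b (x s)) v := by
      have : x s - x t = w - v := by
        rw [sub_eq_sub_iff_add_eq_add, heq, add_comm]
      rw [this, inner_sub_right, hw, inner_sub_left, hv]
      ring
    have h4 : |inner ℝ (b (x t)) (x s - x t)| ≤ L * |s - t| * δ₀ := by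
      rw [h3, abs_neg]
      refine (abs_real_inner_le_norm _ _).trans ?_
      have := hLip t s
      rw [abs_sub_comm] at this
      gcongr
    have h5 : |inner ℝ (b (x t)) (x s - x t - (s - t) • b (x t))| ≤
        ‖b (x t)‖ * (L * |s - t| * |s - t|) :=
      (abs_real_inner_le_norm _ _).trans (by gcongr)
    rw [inner_sub_right, inner_smul_right, real_inner_self_eq_norm_sq] at h5
    have h6 : |s - t| * ‖b (x t)‖ ^ 2 ≤
        ‖b (x t)‖ * (L * |s - t| * |s - t|) + L * |s - t| * δ₀ := by
      have h7 : |(s - t) * ‖b (x t)‖ ^ 2| = |s - t| * ‖b (x t)‖ ^ 2 := by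
        rw [abs_mul, abs_of_nonneg (sq_nonneg ‖b (x t)‖)]
      rw [← h7]
      have h8 := abs_sub_abs_le_abs_sub ((s - t) * ‖b (x t)‖ ^ 2)
        (inner ℝ (b (x t)) (x s - x t))
      rw [abs_sub_comm] at h8
      linarith
    have h9 : ‖b (x t)‖ ^ 2 ≤ ‖b (x t)‖ * (L * |s - t|) + L * δ₀ := by
      have : |s - t| * ‖b (x t)‖ ^ 2 ≤ |s - t| * (‖b (x t)‖ * (L * |s - t|) + L * δ₀) := by
        linarith
      exact le_of_mul_le_mul_left this hpos
    have h10 : L * |s - t| ≤ m / 4 := by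
      calc L * |s - t| ≤ L * τ := by gcongr
        _ = m / 4 := by rw [hτ]; field_simp
    have h11 : L * δ₀ ≤ m ^ 2 / 4 := by
      calc L * δ₀ ≤ L * (m ^ 2 / (4 * L)) := by gcongr; exact min_le_left _ _
        _ = m ^ 2 / 4 := by field_simp
    have h12 := hmle t
    have h13 : ‖b (x t)‖ * (L * |s - t|) ≤ ‖b (x t)‖ * (m / 4) := by gcongr
    nlinarith
  refine ⟨δ₀, hδpos, fun s hs t ht v w hv hw hvδ hwδ heq => ?_⟩
  rcases le_or_gt |s - t| τ with hc | hc
  · exact hnear s t hc v w hv hw hvδ heq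
  rcases le_or_gt |s - t| (T - τ) with hc' | hc'
  · exfalso
    have h1 := hfar (s, t) ⟨⟨Ico_subset_Icc_self hs, Ico_subset_Icc_self ht⟩, hc.le, hc'⟩
    have h2 : x s - x t = w - v := by
      rw [sub_eq_sub_iff_add_eq_add, heq, add_comm]
    simp only [h2] at h1
    have h3 : ‖w - v‖ ≤ δ₀ + δ₀ := (norm_sub_le _ _).trans (add_le_add hwδ hvδ)
    have h4 : δ₀ ≤ m' / 4 := min_le_right _ _
    linarith
  -- Times near opposite ends of the period are close on the circle; shifting one by T reduces to
  -- the near case and contradicts the half-open interval.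
  · exfalso
    rcases le_total 0 (s - t) with h | h
    · rw [abs_of_nonneg h] at hc'
      have e : x (s - T) = x s := hx.periodic.sub_eq s
      have := hnear (s - T) t (by rw [abs_le]; constructor <;> linarith [hs.2, ht.1]) v w
        (by rwa [e]) hw hvδ (by rwa [e])
      linarith [hs.2, ht.1]
    · rw [abs_of_nonpos h] at hc'
      have e : x (s + T) = x s := hx.periodic s
      have := hnear (s + T) t (by rw [abs_le]; constructor <;> linarith [ht.2, hs.1]) v w
        (by rwa [e]) hw hvδ (by rwa [e])
      linarith [ht.2, hs.1]

end TubeGeometry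

/-! ### Normal projection, curvature and the auxiliary Gaussian weight -/

/-- Orthogonal projection along the field `b`. -/
noncomputable def normalProj {E : Type*} [NormedAddCommGroup E] [InnerProductSpace ℝ E]
    (b : E → E) (y : E) : E →L[ℝ] E :=
  ContinuousLinearMap.id ℝ E - (innerSL ℝ (unitField b y)).smulRight (unitField b y)

/-- The curvature vector of the orbit of `b` through `y`. -/
noncomputable def curvField {E : Type*} [NormedAddCommGroup E] [NormedSpace ℝ E]
    (b : E → E) (y : E) : E := ‖b y‖⁻¹ • fderiv ℝ (unitField b) y (b y)

/-- The density of the centred Gaussian law of variance `ε`. -/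
noncomputable def gaussWeight (ε σ : ℝ) : ℝ :=
  Real.exp (-σ ^ 2 / (2 * ε)) / Real.sqrt (2 * Real.pi * ε)

/-- The integral of `p` over the normal disc of radius `δ` at `y`, weighted with the Jacobian of the
normal coordinates and smeared out with a Gaussian law in the direction of `b`. -/
noncomputable def discIntegral {n : ℕ}
    (b : EuclideanSpace ℝ (Fin n) → EuclideanSpace ℝ (Fin n)) (δ ε : ℝ)
    (p : EuclideanSpace ℝ (Fin n) → ℝ) (y : EuclideanSpace ℝ (Fin n)) : ℝ :=
  ∫ w in {w | ‖normalProj b y w‖ ≤ δ}, p (y + normalProj b y w) *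
    ((1 - inner ℝ (curvField b y) w) * gaussWeight ε (inner ℝ (unitField b y) w))

section NormalProj

variable {E : Type*} [NormedAddCommGroup E] [InnerProductSpace ℝ E] {b : E → E} {y : E}

theorem normalProj_apply (b : E → E) (y w : E) :
    normalProj b y w = w - inner ℝ (unitField b y) w • unitField b y := rfl

theorem inner_unitField_normalProj (h : b y ≠ 0) (w : E) :
    inner ℝ (unitField b y) (normalProj b y w) = 0 := by
  rw [normalProj_apply, inner_sub_right, inner_smul_right, real_inner_self_eq_norm_sq,
    norm_unitField h]
  ring

theorem norm_sq_eq_normalProj (h : b y ≠ 0) (w : E) :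
    ‖w‖ ^ 2 = ‖normalProj b y w‖ ^ 2 + inner ℝ (unitField b y) w ^ 2 := by
  have h1 : w = normalProj b y w + inner ℝ (unitField b y) w • unitField b y := by
    rw [normalProj_apply, sub_add_cancel]
  have h2 := norm_add_sq_eq_norm_sq_add_norm_sq_real (x := normalProj b y w)
    (y := inner ℝ (unitField b y) w • unitField b y) (by
      rw [inner_smul_right, real_inner_comm (unitField b y) (normalProj b y w),
        inner_unitField_normalProj h, mul_zero])
  rw [← h1, norm_smul, norm_unitField h, mul_one, Real.norm_eq_abs] at h2
  nlinarith [sq_abs (inner ℝ (unitField b y) w)]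

theorem norm_normalProj_le (h : b y ≠ 0) (w : E) : ‖normalProj b y w‖ ≤ ‖w‖ := by
  refine le_of_sq_le_sq ?_ (norm_nonneg _)
  rw [norm_sq_eq_normalProj h w]
  linarith [sq_nonneg (inner ℝ (unitField b y) w)]

theorem normalProj_of_inner_eq_zero {w : E} (h : inner ℝ (b y) w = 0) : normalProj b y w = w := by
  rw [normalProj_apply, unitField, inner_smul_left, h, mul_zero, zero_smul, sub_zero]

theorem normalProj_unitField (h : b y ≠ 0) : normalProj b y (unitField b y) = 0 := by
  rw [normalProj_apply, real_inner_self_eq_norm_sq, norm_unitField h]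
  simp

theorem contDiffAt_unitField (hb : ContDiff ℝ 1 b) (h : b y ≠ 0) :
    ContDiffAt ℝ 1 (unitField b) y :=
  ((hb.contDiffAt.norm ℝ h).inv (norm_ne_zero_iff.2 h)).smul hb.contDiffAt

theorem continuousAt_curvField (hb : ContDiff ℝ 1 b) (h : b y ≠ 0) :
    ContinuousAt (curvField b) y := by
  have h1 : ContinuousAt (fderiv ℝ (unitField b)) y :=
    ((contDiffAt_unitField hb h).fderiv_right (m := 0) (by norm_num)).continuousAt
  have h2 := hb.continuous.continuousAt (x := y)
  exact (h2.norm.inv₀ (norm_ne_zero_iff.2 h)).smul (h1.clm_apply h2)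

/-- Differentiating ‖u‖² = 1 in the direction b. -/
theorem inner_unitField_curvField (hb : ContDiff ℝ 1 b) (h : b y ≠ 0) :
    inner ℝ (unitField b y) (curvField b y) = 0 := by
  have hd : DifferentiableAt ℝ (unitField b) y :=
    (contDiffAt_unitField hb h).differentiableAt one_ne_zero
  have h1 : (fun z => inner ℝ (unitField b z) (unitField b z)) =ᶠ[𝓝 y] fun _ => (1 : ℝ) := by
    filter_upwards [hb.continuous.continuousAt.eventually_ne h] with z hz
    rw [real_inner_self_eq_norm_sq, norm_unitField hz, one_pow]
  have h2 := h1.fderiv_eq (𝕜 := ℝ)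
  have h3 := congrArg (fun L : E →L[ℝ] ℝ => L (b y)) h2
  simp only [fderiv_inner_apply ℝ hd hd] at h3
  rw [real_inner_comm (unitField b y) (fderiv ℝ (unitField b) y (b y))] at h3
  have h4 : inner ℝ (unitField b y) (fderiv ℝ (unitField b) y (b y)) = 0 := by
    simp at h3
    linarith
  rw [curvField, inner_smul_right, h4, mul_zero]

end NormalProj

section GaussWeight

theorem gaussWeight_nonneg (ε σ : ℝ) : 0 ≤ gaussWeight ε σ := by
  unfold gaussWeight
  positivity

theorem continuous_gaussWeight (ε : ℝ) : Continuous (gaussWeight ε) := by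
  unfold gaussWeight
  fun_prop

theorem integral_gaussWeight {ε : ℝ} (hε : 0 < ε) : ∫ σ, gaussWeight ε σ = 1 := by
  have h : ∀ σ : ℝ, gaussWeight ε σ =
      Real.exp (-(1 / (2 * ε)) * σ ^ 2) / Real.sqrt (2 * Real.pi * ε) := by
    intro σ
    rw [gaussWeight]
    congr 2
    ring
  simp_rw [h]
  rw [integral_div, integral_gaussian]
  have : Real.pi / (1 / (2 * ε)) = 2 * Real.pi * ε := by field_simp
  rw [this, div_self]
  positivity

theorem integrable_gaussWeight {ε : ℝ} (hε : 0 < ε) : Integrable (gaussWeight ε) := by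
  apply Integrable.of_integral_ne_zero
  rw [integral_gaussWeight hε]
  exact one_ne_zero

end GaussWeight

/-! ### Jacobian and integration in normal coordinates -/

/-- A reflection argument: the determinant of the differential of the normal coordinates. -/
theorem abs_det_eq_of_swap {E : Type*} [NormedAddCommGroup E] [InnerProductSpace ℝ E]
    [FiniteDimensional ℝ E] {u : E} (hu : ‖u‖ = 1) {c : ℝ} {k : E} (A : ℝ × E →ₗ[ℝ] ℝ × E)
    (hA1 : ∀ q, inner ℝ u (A q).2 = c * q.1)
    (hA2 : ∀ q, (A q).2 - inner ℝ u (A q).2 • u + (A q).1 • u = q.2 + q.1 • k) :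
    |LinearMap.det A| = |c| := by
  have huu : inner ℝ u u = 1 := by rw [real_inner_self_eq_norm_sq, hu, one_pow]
  -- S exchanges the scalar coordinate with the u component of the vector: an involution, hence of
  -- determinant ±1.
  set S : ℝ × E →ₗ[ℝ] ℝ × E := LinearMap.prod ((innerₛₗ ℝ u).comp (LinearMap.snd ℝ ℝ E))
    (LinearMap.snd ℝ ℝ E - ((innerₛₗ ℝ u).smulRight u).comp (LinearMap.snd ℝ ℝ E) +
      (LinearMap.fst ℝ ℝ E).smulRight u) with hS
  have hSapp : ∀ q : ℝ × E, S q = (inner ℝ u q.2, q.2 - inner ℝ u q.2 • u + q.1 • u) := fun q => rfl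
  have hSS : S.comp S = LinearMap.id := by
    refine LinearMap.ext fun q => ?_
    rw [LinearMap.comp_apply, hSapp, hSapp q]
    simp only [inner_add_right, inner_sub_right, inner_smul_right, huu]
    refine Prod.ext ?_ ?_
    · simp
    · simp
  have hdetS : |LinearMap.det S| = 1 := by
    have := congrArg LinearMap.det hSS
    rw [LinearMap.det_comp, LinearMap.det_id] at this
    rw [← pow_eq_one_iff_of_nonneg (abs_nonneg _) two_ne_zero, sq_abs, pow_two, this]
  -- After the exchange A becomes the identity plus a rank one map, with determinant 1 + (c − 1) =
  -- c.
  have hSA : S.comp A = LinearMap.transvection (LinearMap.fst ℝ ℝ E) (c - 1, k) := by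
    refine LinearMap.ext fun q => ?_
    rw [LinearMap.comp_apply, hSapp, hA2, hA1, LinearMap.transvection.apply]
    refine Prod.ext ?_ ?_
    · simp; ring
    · simp
  have h := congrArg (fun L => |LinearMap.det L|) hSA
  simp only [LinearMap.det_comp, abs_mul, hdetS, one_mul, LinearMap.transvection.det] at h
  rw [h]
  simp

section ChangeOfVariables

variable {n : ℕ} {b : EuclideanSpace ℝ (Fin n) → EuclideanSpace ℝ (Fin n)}
  {x : ℝ → EuclideanSpace ℝ (Fin n)} {T : ℝ}

/-- Normal coordinates along the curve `x`, with an extra direction. -/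
noncomputable def tubeMap (b : EuclideanSpace ℝ (Fin n) → EuclideanSpace ℝ (Fin n))
    (x : ℝ → EuclideanSpace ℝ (Fin n)) (q : ℝ × EuclideanSpace ℝ (Fin n)) :
    ℝ × EuclideanSpace ℝ (Fin n) :=
  (inner ℝ (unitField b (x q.1)) q.2, x q.1 + normalProj b (x q.1) q.2)

/-- The u component of the derivative of x + Pw has no part in dw, and its part in dt is ‖b‖ − u'·w
= ‖b‖(1 − κ·w), where u' = ‖b‖κ. The remaining components differ from the swapped identity only by a
multiple of dt, so `abs_det_eq_of_swap` applies. -/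
theorem IsClosedOrbit.exists_hasFDerivAt_tubeMap (hx : IsClosedOrbit b x T) (hb : ContDiff ℝ 1 b)
    (q : ℝ × EuclideanSpace ℝ (Fin n)) :
    ∃ A : ℝ × EuclideanSpace ℝ (Fin n) →L[ℝ] ℝ × EuclideanSpace ℝ (Fin n),
      HasFDerivAt (tubeMap b x) A q ∧
      |A.det| = ‖b (x q.1)‖ * |1 - inner ℝ (curvField b (x q.1)) q.2| := by
  obtain ⟨t, w⟩ := q
  have hbt := hx.field_ne_zero hb t
  have hbn : ‖b (x t)‖ ≠ 0 := norm_ne_zero_iff.2 hbt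
  set β := ‖b (x t)‖ with hβ
  set u := unitField b (x t) with hu
  set u' := fderiv ℝ (unitField b) (x t) (b (x t)) with hu'
  have hκ : u' = β • curvField b (x t) := by
    rw [curvField, ← hβ, smul_smul, mul_inv_cancel₀ hbn, one_smul]
  have huu' : inner ℝ u u' = 0 := by
    rw [hκ, inner_smul_right, inner_unitField_curvField hb hbt, mul_zero]
  have huu : inner ℝ u u = 1 := by rw [real_inner_self_eq_norm_sq, norm_unitField hbt, one_pow]
  have hub : b (x t) = β • u := by
    rw [hu, unitField, ← hβ, smul_smul, mul_inv_cancel₀ hbn, one_smul]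
  have hud : HasDerivAt (fun s => unitField b (x s)) u' t :=
    (((contDiffAt_unitField hb hbt).differentiableAt one_ne_zero).hasFDerivAt).comp_hasDerivAt t
      (hx.solves t)
  have h1 : HasFDerivAt (fun q : ℝ × EuclideanSpace ℝ (Fin n) => unitField b (x q.1))
      ((ContinuousLinearMap.toSpanSingleton ℝ u').comp
        (ContinuousLinearMap.fst ℝ ℝ (EuclideanSpace ℝ (Fin n)))) (t, w) :=
    HasFDerivAt.comp (g := fun s => unitField b (x s)) (t, w) hud.hasFDerivAt hasFDerivAt_fst
  have h2 : HasFDerivAt (fun q : ℝ × EuclideanSpace ℝ (Fin n) => x q.1)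
      ((ContinuousLinearMap.toSpanSingleton ℝ (b (x t))).comp
        (ContinuousLinearMap.fst ℝ ℝ (EuclideanSpace ℝ (Fin n)))) (t, w) :=
    (hx.solves t).hasFDerivAt.comp (t, w) hasFDerivAt_fst
  have h3 := h1.inner ℝ (hasFDerivAt_snd (𝕜 := ℝ) (p := (t, w)))
  have h4 := h3.prodMk (h2.add ((hasFDerivAt_snd (𝕜 := ℝ) (p := (t, w))).sub (h3.smul h1)))
  obtain ⟨A, hA, happ⟩ : ∃ A : ℝ × EuclideanSpace ℝ (Fin n) →L[ℝ] ℝ × EuclideanSpace ℝ (Fin n),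
      HasFDerivAt (tubeMap b x) A (t, w) ∧ ∀ q, A q = (inner ℝ u q.2 + inner ℝ (q.1 • u') w,
        q.1 • b (x t) + (q.2 - (inner ℝ u w • (q.1 • u') +
          (inner ℝ u q.2 + inner ℝ (q.1 • u') w) • u))) := ⟨_, h4, fun q => rfl⟩
  refine ⟨A, hA, ?_⟩
  have hu'w : inner ℝ u' w = β * inner ℝ (curvField b (x t)) w := by
    rw [hκ, inner_smul_left]
    rfl
  have hA1 : ∀ q, inner ℝ u (A q).2 = β * (1 - inner ℝ (curvField b (x t)) w) * q.1 := by
    intro q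
    rw [happ, hub]
    simp only [inner_add_right, inner_sub_right, inner_smul_right, inner_smul_left, huu, huu',
      hu'w, RCLike.conj_to_real]
    ring
  have hdet := abs_det_eq_of_swap (norm_unitField hbt)
    (c := β * (1 - inner ℝ (curvField b (x t)) w))
    (k := (β * inner ℝ (curvField b (x t)) w) • u - inner ℝ u w • u')
    (A := A.toLinearMap) hA1 (by
      intro q
      have h5 := hA1 q
      simp only [ContinuousLinearMap.coe_coe]
      rw [h5, happ, hub]
      simp only [inner_smul_left, hu'w, RCLike.conj_to_real]
      module)
  refine hdet.trans ?_
  rw [abs_mul, hβ, abs_norm]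

/-- The auxiliary coordinate is unconstrained: over y in the disc at x t, the value σ is reached at
w = (y − x t) + σu. -/
theorem IsClosedOrbit.tubeMap_image (hx : IsClosedOrbit b x T) (hb : ContDiff ℝ 1 b) (δ : ℝ)
    (S : Set ℝ) :
    tubeMap b x '' {q | q.1 ∈ S ∧ ‖normalProj b (x q.1) q.2‖ ≤ δ} =
      univ ×ˢ normalTube x δ S := by
  ext ⟨σ, y⟩
  constructor
  · rintro ⟨⟨t, w⟩, ⟨ht, hw⟩, hq⟩
    obtain ⟨-, rfl⟩ := Prod.mk.inj hq
    refine ⟨mem_univ _, t, ht, ?_, ?_⟩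
    · rw [hx.deriv_eq, add_sub_cancel_left]
      have := inner_unitField_normalProj (hx.field_ne_zero hb t) w
      rw [unitField, inner_smul_left] at this
      exact (mul_eq_zero.1 this).resolve_left
        (inv_ne_zero (norm_ne_zero_iff.2 (hx.field_ne_zero hb t)))
    · rwa [add_sub_cancel_left]
  · rintro ⟨-, t, ht, hy, hyδ⟩
    rw [hx.deriv_eq] at hy
    have hbt := hx.field_ne_zero hb t
    have h1 : normalProj b (x t) ((y - x t) + σ • unitField b (x t)) = y - x t := by
      rw [map_add, map_smul, normalProj_unitField hbt, smul_zero, add_zero,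
        normalProj_of_inner_eq_zero hy]
    refine ⟨(t, (y - x t) + σ • unitField b (x t)), ⟨ht, by rwa [h1]⟩, ?_⟩
    refine Prod.ext ?_ ?_
    · simp only [tubeMap]
      rw [inner_add_right, inner_smul_right, real_inner_self_eq_norm_sq, norm_unitField hbt,
        unitField, inner_smul_left, hy]
      simp
    · simp only [tubeMap]
      rw [h1, add_sub_cancel]

/-- Integrals over a normal tube in normal coordinates. -/
theorem IsClosedOrbit.integral_normalTube (hx : IsClosedOrbit b x T) (hb : ContDiff ℝ 1 b)
    {δ ε : ℝ} (hε : 0 < ε)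
    (hinj : ∀ s ∈ Ico 0 T, ∀ t ∈ Ico 0 T, ∀ v w : EuclideanSpace ℝ (Fin n),
      inner ℝ (b (x s)) v = 0 → inner ℝ (b (x t)) w = 0 → ‖v‖ ≤ δ → ‖w‖ ≤ δ →
      x s + v = x t + w → s = t)
    (hcurv : ∀ t w, ‖normalProj b (x t) w‖ ≤ δ → 0 ≤ 1 - inner ℝ (curvField b (x t)) w)
    {p : EuclideanSpace ℝ (Fin n) → ℝ} {S : Set ℝ} (hS : MeasurableSet S) (hST : S ⊆ Ico 0 T)
    (hp : IntegrableOn p (normalTube x δ S)) :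
    IntegrableOn (fun t => discIntegral b δ ε p (x t) * ‖deriv x t‖) S ∧
    ∫ y in normalTube x δ S, p y = ∫ t in S, discIntegral b δ ε p (x t) * ‖deriv x t‖ := by
  have huc : Continuous fun t => unitField b (x t) := by
    refine continuous_iff_continuousAt.2 fun t => ?_
    exact (contDiffAt_unitField hb (hx.field_ne_zero hb t)).continuousAt.comp
      hx.continuous.continuousAt
  have hPc : Continuous fun q : ℝ × EuclideanSpace ℝ (Fin n) => normalProj b (x q.1) q.2 := by
    simp_rw [normalProj_apply]
    have h1 : Continuous fun q : ℝ × EuclideanSpace ℝ (Fin n) => unitField b (x q.1) :=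
      huc.comp continuous_fst
    fun_prop
  set A : Set (ℝ × EuclideanSpace ℝ (Fin n)) :=
    {q | q.1 ∈ S ∧ ‖normalProj b (x q.1) q.2‖ ≤ δ} with hA
  have hAm : MeasurableSet A :=
    (measurable_fst hS).inter (isClosed_le hPc.norm continuous_const).measurableSet
  choose F' hF' hdet using hx.exists_hasFDerivAt_tubeMap hb
  have hperp : ∀ t w, inner ℝ (b (x t)) (normalProj b (x t) w) = 0 := by
    intro t w
    have := inner_unitField_normalProj (hx.field_ne_zero hb t) w
    rw [unitField, inner_smul_left] at this
    exact (mul_eq_zero.1 this).resolve_left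
      (inv_ne_zero (norm_ne_zero_iff.2 (hx.field_ne_zero hb t)))
  have hinjOn : InjOn (tubeMap b x) A := by
    rintro ⟨s, v⟩ ⟨hs, hv⟩ ⟨t, w⟩ ⟨ht, hw⟩ heq
    obtain ⟨h1, h2⟩ := Prod.mk.inj heq
    simp only at h1 h2 hs ht hv hw
    have hst : s = t := hinj s (hST hs) t (hST ht) _ _ (hperp s v) (hperp t w) hv hw h2
    subst hst
    have h3 := add_left_cancel h2
    rw [normalProj_apply, normalProj_apply, h1] at h3
    rw [sub_left_inj.1 h3]
  -- The weight in the auxiliary coordinate has total mass one, so the integral of g over line times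
  -- tube is that of p over the tube.
  set g : ℝ × EuclideanSpace ℝ (Fin n) → ℝ := fun q => gaussWeight ε q.1 * p q.2 with hg
  set f : ℝ × EuclideanSpace ℝ (Fin n) → ℝ := fun q => ‖b (x q.1)‖ *
    (p (x q.1 + normalProj b (x q.1) q.2) * ((1 - inner ℝ (curvField b (x q.1)) q.2) *
      gaussWeight ε (inner ℝ (unitField b (x q.1)) q.2))) with hf
  have hfg : ∀ q ∈ A, |(F' q).det| • g (tubeMap b x q) = f q := by
    intro q hq
    rw [hdet, abs_of_nonneg (hcurv _ _ hq.2), hg, hf, tubeMap, smul_eq_mul]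
    ring
  have hHaar : (volume : Measure (ℝ × EuclideanSpace ℝ (Fin n))).IsAddHaarMeasure := by
    rw [Measure.volume_eq_prod]
    infer_instance
  have hgi : IntegrableOn g (tubeMap b x '' A) := by
    rw [hx.tubeMap_image hb, IntegrableOn, Measure.volume_eq_prod, ← Measure.prod_restrict,
      Measure.restrict_univ]
    exact (integrable_gaussWeight hε).mul_prod hp
  have hfi : IntegrableOn f A := by
    rw [integrableOn_image_iff_integrableOn_abs_det_fderiv_smul volume hAm
      (fun q _ => (hF' q).hasFDerivWithinAt) hinjOn] at hgi
    exact hgi.congr_fun hfg hAm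
  have hint : ∫ y in normalTube x δ S, p y = ∫ q in A, f q := by
    have h1 := integral_image_eq_integral_abs_det_fderiv_smul volume hAm
      (fun q _ => (hF' q).hasFDerivWithinAt) hinjOn g
    rw [setIntegral_congr_fun hAm hfg, hx.tubeMap_image hb, Measure.volume_eq_prod,
      setIntegral_prod_mul, setIntegral_univ, integral_gaussWeight hε, one_mul] at h1
    exact h1
  have hfi' : Integrable (A.indicator f) (volume.prod volume) := by
    rw [← Measure.volume_eq_prod]
    exact (integrable_indicator_iff hAm).2 hfi
  -- By Fubini, the slice at time t is the disc integral times the speed.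
  have hslice : ∀ t, ∫ w, A.indicator f (t, w) =
      S.indicator (fun t => discIntegral b δ ε p (x t) * ‖deriv x t‖) t := by
    intro t
    by_cases ht : t ∈ S
    · rw [indicator_of_mem ht, discIntegral, hx.deriv_eq, mul_comm, ← integral_const_mul,
        ← integral_indicator]
      · refine integral_congr_ae (Eventually.of_forall fun w => ?_)
        change A.indicator f (t, w) = _
        by_cases hw : ‖normalProj b (x t) w‖ ≤ δ
        · rw [indicator_of_mem (show (t, w) ∈ A from ⟨ht, hw⟩), indicator_of_mem (by exact hw)]
        · rw [indicator_of_notMem (show (t, w) ∉ A from fun h => hw h.2),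
            indicator_of_notMem (by exact hw)]
      · exact (isClosed_le (normalProj b (x t)).continuous.norm continuous_const).measurableSet
    · rw [indicator_of_notMem ht]
      have : ∀ w, A.indicator f (t, w) = 0 := fun w => indicator_of_notMem (fun h => ht h.1) _
      simp [this]
  refine ⟨?_, ?_⟩
  · have := hfi'.integral_prod_left
    simp_rw [hslice] at this
    exact (integrable_indicator_iff hS).1 this
  · rw [hint, ← integral_indicator hAm, Measure.volume_eq_prod, integral_prod _ hfi']
    simp_rw [hslice]
    rw [integral_indicator hS]

end ChangeOfVariables

/-! ### Continuity of the disc integral -/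

theorem measurableSet_normalDisc {n : ℕ}
    {b : EuclideanSpace ℝ (Fin n) → EuclideanSpace ℝ (Fin n)} (y : EuclideanSpace ℝ (Fin n))
    (δ : ℝ) : MeasurableSet {w | ‖normalProj b y w‖ ≤ δ} :=
  (isClosed_le (normalProj b y).continuous.norm continuous_const).measurableSet

/-- The set lies in the frontier of a convex cylinder, since scaling by 1 + s leaves the cylinder,
and frontiers of convex sets are null. -/
theorem volume_norm_normalProj_eq {n : ℕ}
    (b : EuclideanSpace ℝ (Fin n) → EuclideanSpace ℝ (Fin n)) (y : EuclideanSpace ℝ (Fin n))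
    {δ : ℝ} (hδ : 0 < δ) : volume {w | ‖normalProj b y w‖ = δ} = 0 := by
  have hconv : Convex ℝ {w | ‖normalProj b y w‖ ≤ δ} := by
    have h := (convex_closedBall (0 : EuclideanSpace ℝ (Fin n)) δ).linear_preimage
      (normalProj b y).toLinearMap
    convert! h using 1
    ext w
    simp
  suffices hsub : {w | ‖normalProj b y w‖ = δ} ⊆ frontier {w | ‖normalProj b y w‖ ≤ δ} from
    measure_mono_null hsub (hconv.addHaar_frontier volume)
  intro w hw
  refine ⟨subset_closure (le_of_eq hw), fun hint => ?_⟩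
  have hw' : ‖normalProj b y w‖ = δ := hw
  have hcont : Tendsto (fun s : ℝ => (1 + s) • w) (𝓝[>] 0) (𝓝 w) := by
    have : Continuous fun s : ℝ => (1 + s) • w := by fun_prop
    have h := this.tendsto 0
    simp only [add_zero, one_smul] at h
    exact h.mono_left nhdsWithin_le_nhds
  obtain ⟨s, hs, hs0⟩ :=
    ((hcont.eventually (mem_interior_iff_mem_nhds.1 hint)).and self_mem_nhdsWithin).exists
  have hs0' : 0 < s := hs0
  have h1 : ‖normalProj b y ((1 + s) • w)‖ ≤ δ := hs
  rw [map_smul, norm_smul, hw', Real.norm_eq_abs, abs_of_pos (by linarith)] at h1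
  nlinarith

theorem inner_curvField_normalProj {E : Type*} [NormedAddCommGroup E] [InnerProductSpace ℝ E]
    {b : E → E} {y : E} (hb : ContDiff ℝ 1 b) (h : b y ≠ 0) (w : E) :
    inner ℝ (curvField b y) (normalProj b y w) = inner ℝ (curvField b y) w := by
  rw [normalProj_apply, inner_sub_right, inner_smul_right,
    real_inner_comm (unitField b y) (curvField b y), inner_unitField_curvField hb h]
  ring

theorem abs_inner_curvField_le {E : Type*} [NormedAddCommGroup E] [InnerProductSpace ℝ E]
    {b : E → E} {y : E} (hb : ContDiff ℝ 1 b) (h : b y ≠ 0) (w : E) :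
    |inner ℝ (curvField b y) w| ≤ ‖curvField b y‖ * ‖normalProj b y w‖ := by
  rw [← inner_curvField_normalProj hb h]
  exact abs_real_inner_le_norm _ _

/-- On the cylinder ‖w‖² ≤ δ² + ⟨u, w⟩², so the weight in one direction is dominated by a Gaussian
on the whole space that does not depend on y. -/
theorem gaussWeight_le {E : Type*} [NormedAddCommGroup E] [InnerProductSpace ℝ E]
    {b : E → E} {y : E} (h : b y ≠ 0) {δ ε : ℝ} (hε : 0 < ε) {w : E}
    (hw : ‖normalProj b y w‖ ≤ δ) :
    gaussWeight ε (inner ℝ (unitField b y) w) ≤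
      Real.exp (δ ^ 2 / (2 * ε)) / Real.sqrt (2 * Real.pi * ε) *
        Real.exp (-(1 / (2 * ε)) * ‖w‖ ^ 2) := by
  rw [gaussWeight, div_mul_eq_mul_div, ← Real.exp_add]
  gcongr
  rw [norm_sq_eq_normalProj h w]
  have h1 : ‖normalProj b y w‖ ^ 2 ≤ δ ^ 2 := by gcongr
  have h2 : δ ^ 2 / (2 * ε) + -(1 / (2 * ε)) * (‖normalProj b y w‖ ^ 2 +
      inner ℝ (unitField b y) w ^ 2) = (δ ^ 2 - ‖normalProj b y w‖ ^ 2 -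
      inner ℝ (unitField b y) w ^ 2) / (2 * ε) := by field_simp; ring
  rw [h2]
  gcongr
  linarith

/-- Dominated convergence. The cylinder of integration moves with y, but its indicator is locally
constant in y except where ‖Pw‖ = δ, a null set. -/
theorem continuousAt_discIntegral {n : ℕ}
    {b : EuclideanSpace ℝ (Fin n) → EuclideanSpace ℝ (Fin n)} (hb : ContDiff ℝ 1 b)
    {y₀ : EuclideanSpace ℝ (Fin n)} (h₀ : b y₀ ≠ 0) {δ ε : ℝ} (hδ : 0 < δ) (hε : 0 < ε)
    {p : EuclideanSpace ℝ (Fin n) → ℝ} (hp : Continuous p) :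
    ContinuousAt (discIntegral b δ ε p) y₀ := by
  have heq : discIntegral b δ ε p = fun y => ∫ w, {w | ‖normalProj b y w‖ ≤ δ}.indicator
      (fun w => p (y + normalProj b y w) * ((1 - inner ℝ (curvField b y) w) *
        gaussWeight ε (inner ℝ (unitField b y) w))) w := by
    ext y
    rw [discIntegral, integral_indicator (measurableSet_normalDisc y δ)]
  rw [heq]
  have hgc := continuous_gaussWeight ε
  have hu := (contDiffAt_unitField hb h₀).continuousAt
  have hκ := continuousAt_curvField hb h₀
  have hPw : ∀ w, ContinuousAt (fun y => normalProj b y w) y₀ := by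
    intro w
    simp_rw [normalProj_apply]
    fun_prop
  obtain ⟨B, hB⟩ := (isCompact_closedBall y₀ (1 + δ)).exists_bound_of_continuousOn hp.continuousOn
  set K := ‖curvField b y₀‖ + 1 with hK
  have hB0 : 0 ≤ B := (norm_nonneg _).trans (hB y₀ (Metric.mem_closedBall_self (by positivity)))
  refine continuousAt_of_dominated (bound := fun w => B * ((1 + K * δ) *
    (Real.exp (δ ^ 2 / (2 * ε)) / Real.sqrt (2 * Real.pi * ε) *
        Real.exp (-(1 / (2 * ε)) * ‖w‖ ^ 2)))) ?_ ?_ ?_ ?_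
  · refine Eventually.of_forall fun y => ?_
    refine AEStronglyMeasurable.indicator (Continuous.aestronglyMeasurable ?_)
      (measurableSet_normalDisc y δ)
    fun_prop
  · have e1 : ∀ᶠ y in 𝓝 y₀, ‖curvField b y‖ < K :=
      hκ.norm.eventually_lt_const (by linarith)
    filter_upwards [e1, hb.continuous.continuousAt.eventually_ne h₀,
      Metric.closedBall_mem_nhds y₀ one_pos] with y h1 h2 h3
    refine Eventually.of_forall fun w => ?_
    by_cases hw : ‖normalProj b y w‖ ≤ δ
    · rw [indicator_of_mem (by exact hw), norm_mul, norm_mul]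
      gcongr
      · apply hB
        rw [mem_closedBall_iff_norm] at h3 ⊢
        calc ‖y + normalProj b y w - y₀‖ = ‖(y - y₀) + normalProj b y w‖ := by congr 1; abel
          _ ≤ 1 + δ := (norm_add_le _ _).trans (add_le_add h3 hw)
      · have h4 := abs_inner_curvField_le hb h2 w
        have h5 : ‖curvField b y‖ * ‖normalProj b y w‖ ≤ K * δ := by gcongr
        calc |1 - inner ℝ (curvField b y) w| ≤ |1| + |inner ℝ (curvField b y) w| := abs_sub _ _
          _ ≤ 1 + K * δ := by rw [abs_one]; linarith
      · rw [Real.norm_eq_abs, abs_of_nonneg (gaussWeight_nonneg _ _)]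
        exact gaussWeight_le h2 hε hw
    · rw [indicator_of_notMem (by exact hw), norm_zero]
      positivity
  · exact ((((integrable_exp_neg_mul_sq_norm (by positivity)).const_mul _).const_mul _).const_mul _)
  · have hnull : ∀ᵐ w, ‖normalProj b y₀ w‖ ≠ δ := by
      rw [ae_iff]
      simpa using volume_norm_normalProj_eq b y₀ hδ
    filter_upwards [hnull] with w hw
    have hn := (hPw w).norm
    rcases lt_or_gt_of_ne hw with hlt | hgt
    · have : (fun y => {w | ‖normalProj b y w‖ ≤ δ}.indicator
          (fun w => p (y + normalProj b y w) * ((1 - inner ℝ (curvField b y) w) *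
            gaussWeight ε (inner ℝ (unitField b y) w))) w) =ᶠ[𝓝 y₀] fun y =>
          p (y + normalProj b y w) * ((1 - inner ℝ (curvField b y) w) *
            gaussWeight ε (inner ℝ (unitField b y) w)) := by
        filter_upwards [hn.eventually_lt_const hlt] with y hy
        exact indicator_of_mem (show w ∈ {w | ‖normalProj b y w‖ ≤ δ} from hy.le) _
      refine ContinuousAt.congr ?_ this.symm
      have a1 : ContinuousAt (fun y => p (y + normalProj b y w)) y₀ :=
        hp.continuousAt.comp (continuousAt_id.add (hPw w))
      have a2 : ContinuousAt (fun y => gaussWeight ε (inner ℝ (unitField b y) w)) y₀ :=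
        hgc.continuousAt.comp (hu.inner continuousAt_const)
      exact a1.mul ((continuousAt_const.sub (hκ.inner continuousAt_const)).mul a2)
    · have : (fun y => {w | ‖normalProj b y w‖ ≤ δ}.indicator
          (fun w => p (y + normalProj b y w) * ((1 - inner ℝ (curvField b y) w) *
            gaussWeight ε (inner ℝ (unitField b y) w))) w) =ᶠ[𝓝 y₀] fun _ => 0 := by
        filter_upwards [hn.eventually_const_lt hgt] with y hy
        exact indicator_of_notMem (show w ∉ {w | ‖normalProj b y w‖ ≤ δ} from not_le.2 hy) _
      exact continuousAt_const.congr this.symm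

/-! ### Laplace expansion across the cycle -/

/-- A closed orbit attracting a compact domain, together with a rate function that solves the
Hamilton–Jacobi equation and a positive prefactor. -/
structure IsWKBCycle {n : ℕ} (b : EuclideanSpace ℝ (Fin n) → EuclideanSpace ℝ (Fin n))
    (D : Matrix (Fin n) (Fin n) ℝ) (x : ℝ → EuclideanSpace ℝ (Fin n)) (T : ℝ)
    (𝒟 : Set (EuclideanSpace ℝ (Fin n))) (φ ω : EuclideanSpace ℝ (Fin n) → ℝ) : Prop where
  field_contDiff : ContDiff ℝ 1 b
  posDef : D.PosDef
  orbit : IsClosedOrbit b x T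
  isCompact : IsCompact 𝒟
  cycle_subset : range x ⊆ interior 𝒟
  attracted : AttractedWithin b 𝒟 (range x)
  rate_contDiff : ContDiff ℝ 4 φ
  prefactor_contDiff : ContDiff ℝ 2 ω
  prefactor_pos : ∀ y ∈ 𝒟, 0 < ω y
  hamilton_jacobi : ∀ y ∈ 𝒟, fderiv ℝ φ y (circField b D φ y) = 0
  finrank_ker_le : ∀ y ∈ range x, Module.finrank ℝ (LinearMap.ker (hessian φ y)) ≤ 1

/-- The leading order of the marginal density on the cycle, up to normalization. -/
noncomputable def leadingDensity {n : ℕ}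
    (b : EuclideanSpace ℝ (Fin n) → EuclideanSpace ℝ (Fin n))
    (φ ω : EuclideanSpace ℝ (Fin n) → ℝ) (y : EuclideanSpace ℝ (Fin n)) : ℝ :=
  ω y / Real.sqrt (LinearMap.det (completedHessian b φ y))

namespace IsWKBCycle

variable {n : ℕ} {b : EuclideanSpace ℝ (Fin n) → EuclideanSpace ℝ (Fin n)}
  {D : Matrix (Fin n) (Fin n) ℝ} {x : ℝ → EuclideanSpace ℝ (Fin n)} {T : ℝ}
  {𝒟 : Set (EuclideanSpace ℝ (Fin n))} {φ ω : EuclideanSpace ℝ (Fin n) → ℝ}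

theorem field_ne_zero (h : IsWKBCycle b D x T 𝒟 φ ω) {y : EuclideanSpace ℝ (Fin n)}
    (hy : y ∈ range x) : b y ≠ 0 := by
  obtain ⟨t, rfl⟩ := hy
  exact h.orbit.field_ne_zero h.field_contDiff t

theorem rate_differentiable (h : IsWKBCycle b D x T 𝒟 φ ω) : Differentiable ℝ φ :=
  h.rate_contDiff.differentiable (by norm_num)

theorem subset (h : IsWKBCycle b D x T 𝒟 φ ω) : range x ⊆ 𝒟 := h.cycle_subset.trans interior_subset

theorem rate_eq (h : IsWKBCycle b D x T 𝒟 φ ω) {y : EuclideanSpace ℝ (Fin n)}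
    (hy : y ∈ range x) : φ y = φ (x 0) := by
  obtain ⟨t, rfl⟩ := hy
  exact h.orbit.potential_const h.posDef h.rate_differentiable
    (fun y hy => h.hamilton_jacobi y (h.subset hy)) t 0

theorem gradient_eq_zero (h : IsWKBCycle b D x T 𝒟 φ ω) (t : ℝ) : gradient φ (x t) = 0 :=
  h.orbit.gradient_eq_zero h.posDef h.rate_differentiable
    (fun y hy => h.hamilton_jacobi y (h.subset hy)) t

theorem fderiv_rate_eq_zero (h : IsWKBCycle b D x T 𝒟 φ ω) {y : EuclideanSpace ℝ (Fin n)}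
    (hy : y ∈ range x) : fderiv ℝ φ y = 0 := by
  obtain ⟨t, rfl⟩ := hy
  rw [← toDual_gradient, h.gradient_eq_zero, map_zero]

theorem rate_le (h : IsWKBCycle b D x T 𝒟 φ ω) {y : EuclideanSpace ℝ (Fin n)}
    (hy : y ∈ 𝒟) : φ (x 0) ≤ φ y :=
  h.orbit.potential_le h.posDef h.rate_differentiable h.subset h.hamilton_jacobi h.attracted hy

theorem isLocalMin (h : IsWKBCycle b D x T 𝒟 φ ω) {y : EuclideanSpace ℝ (Fin n)}
    (hy : y ∈ range x) : IsLocalMin φ y := by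
  filter_upwards [mem_interior_iff_mem_nhds.1 (h.cycle_subset hy)] with z hz
  rw [h.rate_eq hy]
  exact h.rate_le hz

theorem exists_lower_bound (h : IsWKBCycle b D x T 𝒟 φ ω) :
    ∃ lam : ℝ, 0 < lam ∧ ∀ y ∈ range x, ∀ w,
      lam * ‖w‖ ^ 2 ≤ inner ℝ (completedHessian b φ y w) w :=
  h.orbit.exists_completedHessian_lower_bound h.field_contDiff h.rate_contDiff
    (fun _ hy => h.isLocalMin hy) h.gradient_eq_zero h.finrank_ker_le

/-- The Hessian annihilates u. The quadratic term of φ(y + Pw) may therefore be written in w itself,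
and with ⟨u, w⟩² added it becomes the form of the completed Hessian. -/
theorem snd_fderiv_normalProj (h : IsWKBCycle b D x T 𝒟 φ ω) {y : EuclideanSpace ℝ (Fin n)}
    (hy : y ∈ range x) (w : EuclideanSpace ℝ (Fin n)) :
    fderiv ℝ (fderiv ℝ φ) y (normalProj b y w) (normalProj b y w) =
      fderiv ℝ (fderiv ℝ φ) y w w := by
  have hφ2 : ContDiff ℝ 2 φ := h.rate_contDiff.of_le (by norm_num)
  have hu : hessian φ y (unitField b y) = 0 := by
    obtain ⟨t, rfl⟩ := hy
    rw [unitField, map_smul, h.orbit.hessian_field hφ2 h.gradient_eq_zero t, smul_zero]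
  have h1 : hessian φ y (normalProj b y w) = hessian φ y w := by
    rw [normalProj_apply, map_sub, map_smul, hu, smul_zero, sub_zero]
  rw [← inner_hessian_left hφ2, ← inner_hessian_left hφ2, h1,
    hessian_isSymmetric hφ2 y w, h1, ← hessian_isSymmetric hφ2 y w]

theorem exists_curvField_bound (h : IsWKBCycle b D x T 𝒟 φ ω) :
    ∃ K : ℝ, 0 < K ∧ ∀ y ∈ range x, ‖curvField b y‖ ≤ K := by
  obtain ⟨K, hK⟩ := h.orbit.isCompact_range.exists_bound_of_continuousOn
    (f := curvField b) fun y hy =>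
      (continuousAt_curvField h.field_contDiff (h.field_ne_zero hy)).continuousWithinAt
  exact ⟨|K| + 1, by positivity, fun y hy => (hK y hy).trans (by linarith [le_abs_self K])⟩

end IsWKBCycle

namespace IsWKBCycle

variable {n : ℕ} {b : EuclideanSpace ℝ (Fin n) → EuclideanSpace ℝ (Fin n)}
  {D : Matrix (Fin n) (Fin n) ℝ} {x : ℝ → EuclideanSpace ℝ (Fin n)} {T : ℝ}
  {𝒟 : Set (EuclideanSpace ℝ (Fin n))} {φ ω : EuclideanSpace ℝ (Fin n) → ℝ}

set_option maxSynthPendingDepth 3 in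
/-- Taylor expansions in the normal directions, with constants that are uniform on the cycle. -/
theorem exists_expansion (h : IsWKBCycle b D x T 𝒟 φ ω) :
    ∃ C lam δ₀ : ℝ, 0 ≤ C ∧ 0 < lam ∧ 0 < δ₀ ∧ δ₀ ≤ 1 ∧ C * δ₀ ≤ 1 / 2 ∧ ∀ y ∈ range x,
      ‖fderiv ℝ (fderiv ℝ (fderiv ℝ φ)) y‖ ≤ C ∧ |ω y| ≤ C ∧ ‖fderiv ℝ ω y‖ ≤ C ∧
      ‖curvField b y‖ ≤ C ∧
      (∀ w, lam * ‖w‖ ^ 2 ≤ inner ℝ (completedHessian b φ y w) w) ∧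
      ∀ w, ‖normalProj b y w‖ ≤ δ₀ →
        |φ (y + normalProj b y w) - φ (x 0) - fderiv ℝ (fderiv ℝ φ) y w w / 2 -
          fderiv ℝ (fderiv ℝ (fderiv ℝ φ)) y (normalProj b y w) (normalProj b y w)
            (normalProj b y w) / 6| ≤ C * ‖normalProj b y w‖ ^ 4 ∧
        |φ (y + normalProj b y w) - φ (x 0) - fderiv ℝ (fderiv ℝ φ) y w w / 2| ≤
          lam / 4 * ‖normalProj b y w‖ ^ 2 ∧
        |ω (y + normalProj b y w) - ω y - fderiv ℝ ω y (normalProj b y w)| ≤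
          C * ‖normalProj b y w‖ ^ 2 := by
  obtain ⟨lam, hlam, hM⟩ := h.exists_lower_bound
  obtain ⟨K, hK, hκ⟩ := h.exists_curvField_bound
  obtain ⟨R, hR⟩ := h.orbit.isCompact_range.isBounded.subset_closedBall 0
  obtain ⟨C₁, hC₁, h₁⟩ := exists_taylor_three_bound h.rate_contDiff R
  obtain ⟨C₂, hC₂, h₂⟩ := exists_taylor_one_bound h.prefactor_contDiff R
  set C := K + C₁ + C₂ with hC
  have hC0 : 0 < C := by positivity
  -- Radius 1 is for Taylor's formula, 1/(2C) keeps |κ·w| ≤ 1/2, and lam/(8C) keeps the cubic and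
  -- quartic terms together below lam/4 times the square.
  refine ⟨C, lam, min 1 (min (1 / (2 * C)) (lam / (8 * C))), hC0.le, hlam, by positivity,
    min_le_left _ _, ?_, fun y hy => ?_⟩
  · calc C * min 1 (min (1 / (2 * C)) (lam / (8 * C))) ≤ C * (1 / (2 * C)) := by
          gcongr
          exact (min_le_right _ _).trans (min_le_left _ _)
      _ = 1 / 2 := by field_simp
  obtain ⟨a1, a2⟩ := h₁ y (hR hy)
  obtain ⟨a3, a4, a5⟩ := h₂ y (hR hy)
  refine ⟨a1.trans (by linarith), a3.trans (by linarith), a4.trans (by linarith),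
    (hκ y hy).trans (by linarith), hM y hy, fun w hw => ?_⟩
  set v := normalProj b y w with hv
  have hv1 : ‖v‖ ≤ 1 := hw.trans (min_le_left _ _)
  have hvC : C * ‖v‖ ≤ lam / 8 := by
    calc C * ‖v‖ ≤ C * (lam / (8 * C)) := by
          gcongr
          exact hw.trans ((min_le_right _ _).trans (min_le_right _ _))
      _ = lam / 8 := by field_simp
  have e1 : |φ (y + v) - φ (x 0) - fderiv ℝ (fderiv ℝ φ) y w w / 2 -
      fderiv ℝ (fderiv ℝ (fderiv ℝ φ)) y v v v / 6| ≤ C * ‖v‖ ^ 4 := by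
    have := a2 v hv1
    rw [h.fderiv_rate_eq_zero hy, zero_apply, sub_zero, h.snd_fderiv_normalProj hy,
      h.rate_eq hy] at this
    refine this.trans ?_
    gcongr
    linarith
  refine ⟨e1, ?_, (a5 v hv1).trans ?_⟩
  · have e2 : |fderiv ℝ (fderiv ℝ (fderiv ℝ φ)) y v v v| ≤ C * ‖v‖ ^ 3 := by
      calc ‖fderiv ℝ (fderiv ℝ (fderiv ℝ φ)) y v v v‖
          ≤ ‖fderiv ℝ (fderiv ℝ (fderiv ℝ φ)) y v v‖ * ‖v‖ := ContinuousLinearMap.le_opNorm _ _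
        _ ≤ ‖fderiv ℝ (fderiv ℝ (fderiv ℝ φ)) y v‖ * ‖v‖ * ‖v‖ := by
            gcongr; exact ContinuousLinearMap.le_opNorm _ _
        _ ≤ C * ‖v‖ * ‖v‖ * ‖v‖ := by
            gcongr
            exact (ContinuousLinearMap.le_opNorm _ _).trans (by gcongr; exact a1.trans (by linarith))
        _ = C * ‖v‖ ^ 3 := by ring
    have e3 : C * ‖v‖ ^ 3 ≤ lam / 8 * ‖v‖ ^ 2 := by
      calc C * ‖v‖ ^ 3 = C * ‖v‖ * ‖v‖ ^ 2 := by ring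
        _ ≤ lam / 8 * ‖v‖ ^ 2 := by gcongr
    have e4 : C * ‖v‖ ^ 4 ≤ C * ‖v‖ ^ 3 := by
      gcongr C * ?_
      exact pow_le_pow_of_le_one (norm_nonneg _) hv1 (by norm_num)
    rw [abs_le] at e1 e2 ⊢
    have e5 : 0 ≤ C * ‖v‖ ^ 3 := by positivity
    constructor <;> linarith [e1.1, e1.2, e2.1, e2.2]
  · gcongr
    linarith

/-- The rate function has strict minima on the cycle. -/
theorem mem_range_of_rate_le (h : IsWKBCycle b D x T 𝒟 φ ω) {y : EuclideanSpace ℝ (Fin n)}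
    (hy : y ∈ 𝒟) (hle : φ y ≤ φ (x 0)) : y ∈ range x := by
  obtain ⟨C, lam, δ₀, hC, hlam, hδ₀, -, -, hexp⟩ := h.exists_expansion
  refine h.orbit.mem_range_of_potential_le h.field_contDiff h.posDef h.isCompact
    h.rate_differentiable h.subset h.hamilton_jacobi h.attracted hδ₀ (fun z hz hz0 => ?_) hy hle
  obtain ⟨t, -, ht, hzt⟩ := h.orbit.exists_infDist_normal z
  obtain ⟨-, -, -, -, hM, hw⟩ := hexp (x t) (mem_range_self t)
  have hP := normalProj_of_inner_eq_zero ht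
  obtain ⟨-, h2, -⟩ := hw (z - x t) (by rw [hP, hzt]; exact hz)
  rw [hP, add_sub_cancel, abs_le] at h2
  have h3 := hM (z - x t)
  rw [inner_completedHessian (h.rate_contDiff.of_le (by norm_num)), unitField, inner_smul_left, ht]
    at h3
  -- The quadratic part is at least lam/2 and the error at most lam/4 times the squared distance to
  -- the foot.
  have h4 : lam * ‖z - x t‖ ^ 2 ≤ 0 := by
    simp only [mul_zero, ne_eq, OfNat.ofNat_ne_zero, not_false_eq_true, zero_pow, add_zero] at h3
    linarith [h2.1]
  have h5 : ‖z - x t‖ ^ 2 ≤ 0 := by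
    by_contra hcon
    have := mul_pos hlam (not_le.1 hcon)
    linarith
  have h6 : z - x t = 0 := norm_eq_zero.1 (pow_eq_zero_iff two_ne_zero |>.1
    (le_antisymm h5 (sq_nonneg _)))
  exact ⟨t, (sub_eq_zero.1 h6).symm⟩

-- An instance of `laplace_expansion` on the cylinder over the disc. The auxiliary square ⟨u, w⟩²/2
-- makes the exponent nondegenerate with quadratic form the completed Hessian; the amplitude is ω
-- times the Jacobian, and 1 − κ·w contributes only an odd linear term.
set_option maxSynthPendingDepth 3 in
theorem exists_laplace (h : IsWKBCycle b D x T 𝒟 φ ω) :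
    ∃ δ₀ : ℝ, 0 < δ₀ ∧ δ₀ ≤ 1 ∧
      (∀ y ∈ range x, ∀ w, ‖normalProj b y w‖ ≤ δ₀ → |inner ℝ (curvField b y) w| ≤ 1 / 2) ∧
      ∀ δ ∈ Ioc 0 δ₀, ∃ K : ℝ, ∀ y ∈ range x, ∀ ε ∈ Ioc (0 : ℝ) 1,
        IntegrableOn (fun w => ω (y + normalProj b y w) * (1 - inner ℝ (curvField b y) w) *
          Real.exp (-(φ (y + normalProj b y w) - φ (x 0) + inner ℝ (unitField b y) w ^ 2 / 2) / ε))
          {w | ‖normalProj b y w‖ ≤ δ} ∧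
        |(∫ w in {w | ‖normalProj b y w‖ ≤ δ},
          ω (y + normalProj b y w) * (1 - inner ℝ (curvField b y) w) *
          Real.exp (-(φ (y + normalProj b y w) - φ (x 0) + inner ℝ (unitField b y) w ^ 2 / 2) / ε))
          - leadingDensity b φ ω y * Real.sqrt (2 * Real.pi * ε) ^ n| ≤ K * ε * Real.sqrt ε ^ n := by
  obtain ⟨C, lam, δ₀, hC, hlam, hδ₀, hδ₀1, hCδ, hexp⟩ := h.exists_expansion
  have hκ : ∀ y ∈ range x, ∀ w, ‖normalProj b y w‖ ≤ δ₀ →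
      |inner ℝ (curvField b y) w| ≤ 1 / 2 := by
    intro y hy w hw
    obtain ⟨-, -, -, h4, -⟩ := hexp y hy
    refine (abs_inner_curvField_le h.field_contDiff (h.field_ne_zero hy) w).trans ?_
    exact (mul_le_mul h4 hw (norm_nonneg _) hC).trans hCδ
  refine ⟨δ₀, hδ₀, hδ₀1, hκ, fun δ hδ => ?_⟩
  -- In the common constant, C² comes from products of the curvature with ω or ∇ω, and 2C from the
  -- bound 1 − κ·w ≤ 2.
  obtain ⟨K, hK⟩ := laplace_expansion (V := EuclideanSpace ℝ (Fin n)) (C := C + C ^ 2 + 2 * C)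
    (by positivity) hlam hδ.1
  refine ⟨K, fun y hy ε hε => ?_⟩
  obtain ⟨h1, h2, h3, h4, hM, hw⟩ := hexp y hy
  have hby := h.field_ne_zero hy
  have hP := fun w => norm_normalProj_le hby w
  have hcφ := h.rate_contDiff.continuous
  have hcω := h.prefactor_contDiff.continuous
  have hφ2 : ContDiff ℝ 2 φ := h.rate_contDiff.of_le (by norm_num)
  set P := normalProj b y with hPdef
  have := hK (completedHessian b φ y) {w | ‖P w‖ ≤ δ}
    (fun w => φ (y + P w) - φ (x 0) + inner ℝ (unitField b y) w ^ 2 / 2)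
    (fun w => ω (y + P w) * (1 - inner ℝ (curvField b y) w))
    (fun w => fderiv ℝ (fderiv ℝ (fderiv ℝ φ)) y (P w) (P w) (P w) / 6)
    (fun w => fderiv ℝ ω y (P w) - ω y * inner ℝ (curvField b y) w) (ω y)
    (completedHessian_isSymmetric hφ2 y) hM (measurableSet_normalDisc y δ)
    (fun w hw => by simpa using hw) (fun w hw => ?_) (by fun_prop) (by fun_prop) (by fun_prop)
    (by fun_prop) (fun w => ?_) (fun w => ?_) (fun w => ?_) (fun w => ?_)
    (fun w hwδ => ?_) (fun w hwδ => ?_) (fun w hwδ => ?_) (h2.trans ?_) ε hε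
  · rw [finrank_euclideanSpace_fin] at this
    refine ⟨this.1, ?_⟩
    rw [leadingDensity, div_mul_comm, mul_comm (_ / _) (ω y)]
    exact this.2
  · rw [mem_closedBall_zero_iff] at hw
    exact (hP w).trans hw
  · simp only [map_neg, neg_apply]
    ring
  · simp only [map_neg, inner_neg_right]
    ring
  · have e2 : |fderiv ℝ (fderiv ℝ (fderiv ℝ φ)) y (P w) (P w) (P w)| ≤ C * ‖w‖ ^ 3 := by
      calc ‖fderiv ℝ (fderiv ℝ (fderiv ℝ φ)) y (P w) (P w) (P w)‖
          ≤ ‖fderiv ℝ (fderiv ℝ (fderiv ℝ φ)) y (P w) (P w)‖ * ‖P w‖ :=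
            ContinuousLinearMap.le_opNorm _ _
        _ ≤ ‖fderiv ℝ (fderiv ℝ (fderiv ℝ φ)) y (P w)‖ * ‖P w‖ * ‖P w‖ := by
            gcongr; exact ContinuousLinearMap.le_opNorm _ _
        _ ≤ C * ‖P w‖ * ‖P w‖ * ‖P w‖ := by
            gcongr
            exact (ContinuousLinearMap.le_opNorm _ _).trans (by gcongr)
        _ = C * ‖P w‖ ^ 3 := by ring
        _ ≤ C * ‖w‖ ^ 3 := by gcongr; exact hP w
    rw [abs_div, abs_of_pos (by norm_num : (0 : ℝ) < 6), div_le_iff₀ (by norm_num)]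
    have : 0 ≤ C * ‖w‖ ^ 3 := by positivity
    have : 0 ≤ C ^ 2 * ‖w‖ ^ 3 := by positivity
    linarith
  · have e1 : |fderiv ℝ ω y (P w)| ≤ C * ‖w‖ :=
      (ContinuousLinearMap.le_opNorm _ _).trans (mul_le_mul h3 (hP w) (norm_nonneg _) hC)
    have e2 : |ω y * inner ℝ (curvField b y) w| ≤ C * (C * ‖w‖) := by
      rw [abs_mul]
      refine mul_le_mul h2 ((abs_real_inner_le_norm _ _).trans ?_) (abs_nonneg _) hC
      gcongr
    have := abs_sub (fderiv ℝ ω y (P w)) (ω y * inner ℝ (curvField b y) w)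
    have e3 : 0 ≤ C * ‖w‖ := by positivity
    linarith
  · rw [inner_completedHessian hφ2]
    have := (hw w (hwδ.trans hδ.2)).1
    have e : φ (y + P w) - φ (x 0) + inner ℝ (unitField b y) w ^ 2 / 2 -
        (fderiv ℝ (fderiv ℝ φ) y w w + inner ℝ (unitField b y) w ^ 2) / 2 -
        fderiv ℝ (fderiv ℝ (fderiv ℝ φ)) y (P w) (P w) (P w) / 6 =
        φ (y + P w) - φ (x 0) - fderiv ℝ (fderiv ℝ φ) y w w / 2 -
        fderiv ℝ (fderiv ℝ (fderiv ℝ φ)) y (P w) (P w) (P w) / 6 := by ring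
    rw [e]
    refine this.trans ?_
    have : 0 ≤ C ^ 2 := by positivity
    gcongr
    · linarith
    · exact hP w
  · rw [inner_completedHessian hφ2]
    have := (hw w (hwδ.trans hδ.2)).2.1
    have e : φ (y + P w) - φ (x 0) + inner ℝ (unitField b y) w ^ 2 / 2 -
        (fderiv ℝ (fderiv ℝ φ) y w w + inner ℝ (unitField b y) w ^ 2) / 2 =
        φ (y + P w) - φ (x 0) - fderiv ℝ (fderiv ℝ φ) y w w / 2 := by ring
    rw [e]
    refine this.trans ?_
    gcongr
    exact hP w
  · have e1 := (hw w (hwδ.trans hδ.2)).2.2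
    have e2 := hκ y hy w (hwδ.trans hδ.2)
    set κ := inner ℝ (curvField b y) w with hκdef
    have e3 : |fderiv ℝ ω y (P w) * κ| ≤ C ^ 2 * ‖w‖ ^ 2 := by
      rw [abs_mul]
      calc _ ≤ (C * ‖w‖) * (C * ‖w‖) := by
            refine mul_le_mul ?_ ((abs_real_inner_le_norm _ _).trans (by gcongr)) (abs_nonneg _)
              (by positivity)
            exact (ContinuousLinearMap.le_opNorm _ _).trans (mul_le_mul h3 (hP w)
              (norm_nonneg _) hC)
        _ = _ := by ring
    have e4 : |(ω (y + P w) - ω y - fderiv ℝ ω y (P w)) * (1 - κ)| ≤ C * ‖w‖ ^ 2 * 2 := by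
      rw [abs_mul]
      refine mul_le_mul (e1.trans ?_) ?_ (abs_nonneg _) (by positivity)
      · gcongr; exact hP w
      · rw [abs_le] at e2 ⊢
        constructor <;> linarith [e2.1, e2.2]
    have e : ω (y + P w) * (1 - κ) - ω y - (fderiv ℝ ω y (P w) - ω y * κ) =
        (ω (y + P w) - ω y - fderiv ℝ ω y (P w)) * (1 - κ) - fderiv ℝ ω y (P w) * κ := by ring
    rw [e]
    refine (abs_sub _ _).trans ?_
    have : 0 ≤ C * ‖w‖ ^ 2 := by positivity
    linarith
  · have : 0 ≤ C ^ 2 := by positivity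
    linarith

end IsWKBCycle

/-! ### Regularity of the leading density, families and tube radii -/

/-- The determinant is a polynomial in matrix entries that are C¹. Differentiability of the leading
density along the cycle is needed for the final integration by parts. -/
theorem contDiffAt_det_completedHessian {n : ℕ}
    {b : EuclideanSpace ℝ (Fin n) → EuclideanSpace ℝ (Fin n)} {φ : EuclideanSpace ℝ (Fin n) → ℝ}
    {y : EuclideanSpace ℝ (Fin n)} (hb : ContDiff ℝ 1 b) (hy : b y ≠ 0) (hφ : ContDiff ℝ 3 φ) :
    ContDiffAt ℝ 1 (fun z => LinearMap.det (completedHessian b φ z)) y := by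
  have c1 : ContDiff ℝ 2 (fderiv ℝ φ) := hφ.fderiv_right (by norm_num)
  have c2 : ContDiff ℝ 1 (fderiv ℝ (fderiv ℝ φ)) := c1.fderiv_right (by norm_num)
  have hφ2 : ContDiff ℝ 2 φ := hφ.of_le (by norm_num)
  have hu := contDiffAt_unitField hb hy
  set e := EuclideanSpace.basisFun (Fin n) ℝ with he
  have hentry : ∀ z i j, LinearMap.toMatrix e.toBasis e.toBasis (completedHessian b φ z) i j =
      fderiv ℝ (fderiv ℝ φ) z (e j) (e i) +
        inner ℝ (unitField b z) (e j) * inner ℝ (unitField b z) (e i) := by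
    intro z i j
    rw [LinearMap.toMatrix_apply, OrthonormalBasis.coe_toBasis_repr_apply, e.repr_apply_apply,
      real_inner_comm, OrthonormalBasis.coe_toBasis, completedHessian, LinearMap.add_apply,
      inner_add_left, inner_hessian_left hφ2]
    simp [inner_smul_left]
  have hdet : ∀ z, LinearMap.det (completedHessian b φ z) =
      ∑ σ : Equiv.Perm (Fin n), ((Equiv.Perm.sign σ : ℤ) : ℝ) *
        ∏ i, (fderiv ℝ (fderiv ℝ φ) z (e i) (e (σ i)) +
        inner ℝ (unitField b z) (e i) * inner ℝ (unitField b z) (e (σ i))) := by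
    intro z
    rw [← LinearMap.det_toMatrix e.toBasis, Matrix.det_apply']
    simp_rw [hentry]
  simp_rw [hdet]
  refine ContDiffAt.sum fun σ _ => contDiffAt_const.mul ?_
  refine contDiffAt_prod fun i _ => ?_
  exact ((c2.contDiffAt.clm_apply contDiffAt_const).clm_apply contDiffAt_const).add
    ((hu.inner ℝ contDiffAt_const).mul (hu.inner ℝ contDiffAt_const))

/-- A single term of the exponential series; it trades the gap of φ off the tube for any power of ε.
-/
theorem exp_neg_div_le_pow {c ε : ℝ} (hc : 0 < c) (hε : 0 < ε) (k : ℕ) :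
    Real.exp (-c / ε) ≤ k.factorial / c ^ k * ε ^ k := by
  have h := Real.pow_div_factorial_le_exp (c / ε) (by positivity) k
  rw [neg_div, Real.exp_neg]
  calc (Real.exp (c / ε))⁻¹ ≤ ((c / ε) ^ k / k.factorial)⁻¹ := by gcongr
    _ = _ := by rw [div_pow]; field_simp

/-- A family of stationary densities in WKB form around an attracting closed orbit. -/
structure IsWKBFamily {n : ℕ} (b : EuclideanSpace ℝ (Fin n) → EuclideanSpace ℝ (Fin n))
    (D : Matrix (Fin n) (Fin n) ℝ) (x : ℝ → EuclideanSpace ℝ (Fin n)) (T : ℝ)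
    (𝒟 : Set (EuclideanSpace ℝ (Fin n))) (φ ω : EuclideanSpace ℝ (Fin n) → ℝ)
    (π : ℝ → EuclideanSpace ℝ (Fin n) → ℝ) (a : ℝ → ℝ) (ε₁ C : ℝ) : Prop
    extends IsWKBCycle b D x T 𝒟 φ ω where
  eps_pos : 0 < ε₁
  eps_le_one : ε₁ ≤ 1
  const_pos : 0 < C
  stationary : ∀ ε ∈ Ioo 0 ε₁, IsStationaryDensity b D ε (π ε)
  amplitude_pos : ∀ ε ∈ Ioo 0 ε₁, 0 < a ε
  abs_sub_le : ∀ ε ∈ Ioo 0 ε₁, ∀ y ∈ 𝒟, |π ε y - a ε * (ω y * Real.exp (-φ y / ε))| ≤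
    C * ε * (a ε * (ω y * Real.exp (-φ y / ε)))
  integral_compl_le : ∀ ε ∈ Ioo 0 ε₁, ∫ y in 𝒟ᶜ, π ε y ≤ C * ε

/-- Radii of tubes around the cycle on which normal coordinates and the Laplace expansion work. -/
structure IsTubeRadius {n : ℕ} (b : EuclideanSpace ℝ (Fin n) → EuclideanSpace ℝ (Fin n))
    (x : ℝ → EuclideanSpace ℝ (Fin n)) (T : ℝ)
    (𝒟 : Set (EuclideanSpace ℝ (Fin n))) (φ ω : EuclideanSpace ℝ (Fin n) → ℝ) (δ : ℝ) : Prop where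
  pos : 0 < δ
  injective : ∀ s ∈ Ico 0 T, ∀ t ∈ Ico 0 T, ∀ v w : EuclideanSpace ℝ (Fin n),
    inner ℝ (b (x s)) v = 0 → inner ℝ (b (x t)) w = 0 → ‖v‖ ≤ δ → ‖w‖ ≤ δ →
    x s + v = x t + w → s = t
  curv_le : ∀ y ∈ range x, ∀ w, ‖normalProj b y w‖ ≤ δ → |inner ℝ (curvField b y) w| ≤ 1 / 2
  subset : {y | Metric.infDist y (range x) ≤ δ} ⊆ 𝒟
  laplace : ∃ K : ℝ, ∀ y ∈ range x, ∀ ε ∈ Ioc (0 : ℝ) 1,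
    IntegrableOn (fun w => ω (y + normalProj b y w) * (1 - inner ℝ (curvField b y) w) *
      Real.exp (-(φ (y + normalProj b y w) - φ (x 0) + inner ℝ (unitField b y) w ^ 2 / 2) / ε))
      {w | ‖normalProj b y w‖ ≤ δ} ∧
    |(∫ w in {w | ‖normalProj b y w‖ ≤ δ},
      ω (y + normalProj b y w) * (1 - inner ℝ (curvField b y) w) *
      Real.exp (-(φ (y + normalProj b y w) - φ (x 0) + inner ℝ (unitField b y) w ^ 2 / 2) / ε))
      - leadingDensity b φ ω y * Real.sqrt (2 * Real.pi * ε) ^ n| ≤ K * ε * Real.sqrt ε ^ n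

/-- The mass scale of the densities near the cycle. -/
noncomputable def massScale (n : ℕ) (φ₀ : ℝ) (a : ℝ → ℝ) (ε : ℝ) : ℝ :=
  a ε * Real.exp (-φ₀ / ε) / Real.sqrt (2 * Real.pi * ε) * Real.sqrt (2 * Real.pi * ε) ^ n

namespace IsWKBCycle

variable {n : ℕ} {b : EuclideanSpace ℝ (Fin n) → EuclideanSpace ℝ (Fin n)}
  {D : Matrix (Fin n) (Fin n) ℝ} {x : ℝ → EuclideanSpace ℝ (Fin n)} {T : ℝ}
  {𝒟 : Set (EuclideanSpace ℝ (Fin n))} {φ ω : EuclideanSpace ℝ (Fin n) → ℝ}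

theorem exists_isTubeRadius (h : IsWKBCycle b D x T 𝒟 φ ω) :
    ∃ δ₀ : ℝ, 0 < δ₀ ∧ ∀ δ ∈ Ioc 0 δ₀, IsTubeRadius b x T 𝒟 φ ω δ := by
  obtain ⟨δ₁, h₁, -, hκ, hL⟩ := h.exists_laplace
  obtain ⟨δ₂, h₂, hinj⟩ := h.orbit.exists_normal_injective h.field_contDiff
  obtain ⟨δ₃, h₃, hsub⟩ := h.orbit.isCompact_range.exists_cthickening_subset_open
    isOpen_interior h.cycle_subset
  refine ⟨min δ₁ (min δ₂ δ₃), by positivity, fun δ ⟨hδ0, hδ⟩ => ?_⟩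
  obtain ⟨hd1, hd2, hd3⟩ : δ ≤ δ₁ ∧ δ ≤ δ₂ ∧ δ ≤ δ₃ := by simpa using hδ
  refine ⟨hδ0, ?_, fun y hy w hw => hκ y hy w (hw.trans hd1), fun y hy => ?_, hL δ ⟨hδ0, hd1⟩⟩
  · intro s hs t ht v w hv hw hvδ hwδ
    exact hinj s hs t ht v w hv hw (hvδ.trans hd2) (hwδ.trans hd2)
  · refine interior_subset (hsub ?_)
    exact Metric.mem_cthickening_of_dist_le _ _ _ _ (h.orbit.isCompact_range.exists_infDist_eq_dist
      ⟨x 0, mem_range_self 0⟩ y).choose_spec.1 (by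
        rw [← (h.orbit.isCompact_range.exists_infDist_eq_dist
      ⟨x 0, mem_range_self 0⟩ y).choose_spec.2]; exact le_trans hy hd3)

theorem det_pos (h : IsWKBCycle b D x T 𝒟 φ ω) {y : EuclideanSpace ℝ (Fin n)}
    (hy : y ∈ range x) : 0 < LinearMap.det (completedHessian b φ y) := by
  obtain ⟨lam, hlam, hM⟩ := h.exists_lower_bound
  refine det_pos_of_inner_pos (completedHessian_isSymmetric
    (h.rate_contDiff.of_le (by norm_num)) y) fun w hw => ?_
  refine lt_of_lt_of_le ?_ (hM y hy w)
  have := norm_pos_iff.2 hw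
  positivity

theorem leadingDensity_pos (h : IsWKBCycle b D x T 𝒟 φ ω) {y : EuclideanSpace ℝ (Fin n)}
    (hy : y ∈ range x) : 0 < leadingDensity b φ ω y :=
  div_pos (h.prefactor_pos y (h.subset hy)) (Real.sqrt_pos.2 (h.det_pos hy))

theorem contDiffAt_leadingDensity (h : IsWKBCycle b D x T 𝒟 φ ω) {y : EuclideanSpace ℝ (Fin n)}
    (hy : y ∈ range x) : ContDiffAt ℝ 1 (leadingDensity b φ ω) y := by
  have h1 := contDiffAt_det_completedHessian h.field_contDiff (h.field_ne_zero hy)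
    (h.rate_contDiff.of_le (by norm_num))
  have h2 := h.det_pos hy
  exact (h.prefactor_contDiff.of_le (by norm_num)).contDiffAt.div (h1.sqrt h2.ne')
    (Real.sqrt_ne_zero'.2 h2)

theorem continuousOn_leadingDensity (h : IsWKBCycle b D x T 𝒟 φ ω) :
    ContinuousOn (leadingDensity b φ ω) (range x) := fun _ hy =>
  (h.contDiffAt_leadingDensity hy).continuousAt.continuousWithinAt

theorem exists_leadingDensity_le (h : IsWKBCycle b D x T 𝒟 φ ω) :
    ∃ B : ℝ, 0 < B ∧ ∀ y ∈ range x, leadingDensity b φ ω y ≤ B := by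
  obtain ⟨B, hB⟩ := h.orbit.isCompact_range.exists_bound_of_continuousOn
    h.continuousOn_leadingDensity
  exact ⟨|B| + 1, by positivity, fun y hy =>
    (le_abs_self _).trans ((hB y hy).trans (by linarith [le_abs_self B]))⟩

theorem continuous_leadingDensity_comp (h : IsWKBCycle b D x T 𝒟 φ ω) :
    Continuous fun t => leadingDensity b φ ω (x t) :=
  h.continuousOn_leadingDensity.comp_continuous h.orbit.continuous fun t => mem_range_self t

theorem continuous_norm_deriv (h : IsWKBCycle b D x T 𝒟 φ ω) :
    Continuous fun t => ‖deriv x t‖ := by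
  simp_rw [h.orbit.deriv_eq]
  exact (h.field_contDiff.continuous.comp h.orbit.continuous).norm

theorem arcIntegral_leadingDensity_pos (h : IsWKBCycle b D x T 𝒟 φ ω) :
    0 < arcIntegral x T (leadingDensity b φ ω) := by
  rw [arcIntegral, integral_Ico_eq_integral_Ioc, ← intervalIntegral.integral_of_le
    h.orbit.period_pos.le]
  refine intervalIntegral.intervalIntegral_pos_of_pos
    ((h.continuous_leadingDensity_comp.mul h.continuous_norm_deriv).intervalIntegrable _ _)
    (fun t => ?_) h.orbit.period_pos
  have h1 := h.leadingDensity_pos (mem_range_self t)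
  have h2 : 0 < ‖deriv x t‖ := by
    rw [h.orbit.deriv_eq]
    exact norm_pos_iff.2 (h.field_ne_zero (mem_range_self t))
  exact mul_pos h1 h2

end IsWKBCycle

/-! ### Mass near the cycle and normalization -/

namespace IsWKBFamily

variable {n : ℕ} {b : EuclideanSpace ℝ (Fin n) → EuclideanSpace ℝ (Fin n)}
  {D : Matrix (Fin n) (Fin n) ℝ} {x : ℝ → EuclideanSpace ℝ (Fin n)} {T : ℝ}
  {𝒟 : Set (EuclideanSpace ℝ (Fin n))} {φ ω : EuclideanSpace ℝ (Fin n) → ℝ}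
  {π : ℝ → EuclideanSpace ℝ (Fin n) → ℝ} {a : ℝ → ℝ} {ε₁ C : ℝ}

theorem massScale_pos (h : IsWKBFamily b D x T 𝒟 φ ω π a ε₁ C) {ε : ℝ} (hε : ε ∈ Ioo 0 ε₁) :
    0 < massScale n (φ (x 0)) a ε := by
  have := h.amplitude_pos ε hε
  have := hε.1
  unfold massScale
  positivity

/-- The weight 1 − κ·w is positive on the disc, so replacing π_ε by its WKB leading term costs a
relative error O(ε) under the integral; the Laplace expansion does the rest. -/
theorem exists_abs_discIntegral_sub_le (h : IsWKBFamily b D x T 𝒟 φ ω π a ε₁ C) {δ : ℝ}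
    (hδ : IsTubeRadius b x T 𝒟 φ ω δ) :
    ∃ K : ℝ, 0 < K ∧ ∀ ε ∈ Ioo 0 ε₁, ∀ y ∈ range x,
      IntegrableOn (fun w => π ε (y + normalProj b y w) * ((1 - inner ℝ (curvField b y) w) *
        gaussWeight ε (inner ℝ (unitField b y) w))) {w | ‖normalProj b y w‖ ≤ δ} ∧
      |discIntegral b δ ε (π ε) y - massScale n (φ (x 0)) a ε * leadingDensity b φ ω y| ≤
        K * ε * massScale n (φ (x 0)) a ε := by
  obtain ⟨K, hK⟩ := hδ.laplace
  obtain ⟨B, hB, hBle⟩ := h.exists_leadingDensity_le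
  have hC := h.const_pos
  refine ⟨C * (B + |K|) + |K|, by positivity, fun ε hε y hy => ?_⟩
  have hε0 := hε.1
  have hε1 : ε ≤ 1 := hε.2.le.trans h.eps_le_one
  obtain ⟨hi, hL⟩ := hK y hy ε ⟨hε.1, hε1⟩
  have ha := h.amplitude_pos ε hε
  have hπc := (h.stationary ε hε).contDiff.continuous
  have hφc := h.rate_contDiff.continuous
  have hωc := h.prefactor_contDiff.continuous
  set P := normalProj b y with hP
  set L := leadingDensity b φ ω y with hLdef
  have hL0 : 0 < L := h.leadingDensity_pos hy
  -- The division by √(2πε) is the normalization of the auxiliary Gaussian; it lowers the Laplace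
  -- power from n to n − 1, the dimension of the disc.
  set s := a ε * Real.exp (-φ (x 0) / ε) / Real.sqrt (2 * Real.pi * ε) with hs
  have hs0 : 0 < s := by positivity
  set r := Real.sqrt (2 * Real.pi * ε) ^ n with hr
  have hr0 : 0 < r := by positivity
  set Ω := {w | ‖P w‖ ≤ δ} with hΩ
  have hΩm : MeasurableSet Ω := measurableSet_normalDisc y δ
  set f : EuclideanSpace ℝ (Fin n) → ℝ := fun w => ω (y + P w) * (1 - inner ℝ (curvField b y) w) *
      Real.exp (-(φ (y + P w) - φ (x 0) + inner ℝ (unitField b y) w ^ 2 / 2) / ε) with hf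
  set F : EuclideanSpace ℝ (Fin n) → ℝ := fun w => π ε (y + P w) *
    ((1 - inner ℝ (curvField b y) w) * gaussWeight ε (inner ℝ (unitField b y) w)) with hF
  have hdist : ∀ w ∈ Ω, |F w - s * f w| ≤ C * ε * (s * f w) := by
    intro w hw
    have hκ := (abs_le.1 (hδ.curv_le y hy w hw)).2
    have hmem : y + P w ∈ 𝒟 := by
      refine hδ.subset ((Metric.infDist_le_dist_of_mem hy).trans ?_)
      rw [dist_eq_norm, add_sub_cancel_left]
      exact hw
    have h1 := h.abs_sub_le ε hε _ hmem
    have hg := gaussWeight_nonneg ε (inner ℝ (unitField b y) w)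
    have hq : 0 ≤ (1 - inner ℝ (curvField b y) w) * gaussWeight ε (inner ℝ (unitField b y) w) :=
      mul_nonneg (by linarith) hg
    have h2 : s * f w = a ε * (ω (y + P w) * Real.exp (-φ (y + P w) / ε)) *
        ((1 - inner ℝ (curvField b y) w) * gaussWeight ε (inner ℝ (unitField b y) w)) := by
      have h3 : Real.exp (-φ (x 0) / ε) * Real.exp (-(φ (y + P w) - φ (x 0) +
          inner ℝ (unitField b y) w ^ 2 / 2) / ε) = Real.exp (-φ (y + P w) / ε) *
          Real.exp (-inner ℝ (unitField b y) w ^ 2 / (2 * ε)) := by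
        rw [← Real.exp_add, ← Real.exp_add]
        congr 1
        field_simp
        ring
      rw [hs, hf, gaussWeight]
      calc _ = a ε * ω (y + P w) * (1 - inner ℝ (curvField b y) w) / Real.sqrt (2 * Real.pi * ε) *
            (Real.exp (-φ (x 0) / ε) * Real.exp (-(φ (y + P w) - φ (x 0) +
            inner ℝ (unitField b y) w ^ 2 / 2) / ε)) := by ring
        _ = _ := by rw [h3]; ring
    rw [h2, hF, ← sub_mul, abs_mul, abs_of_nonneg hq]
    exact (mul_le_mul_of_nonneg_right h1 hq).trans_eq (by ring)
  have hFc : Continuous F := by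
    have := continuous_gaussWeight ε
    fun_prop
  have hsi : IntegrableOn (fun w => s * f w) Ω := hi.const_mul s
  have hdi : IntegrableOn (fun w => F w - s * f w) Ω := by
    refine (hsi.const_mul (C * ε)).mono' ?_ ((ae_restrict_iff' hΩm).2 (Eventually.of_forall hdist))
    exact hFc.aestronglyMeasurable.sub hsi.1
  have hFi : IntegrableOn F Ω := by
    refine (hdi.add hsi).congr (Eventually.of_forall fun w => ?_)
    simp
  have h1 : |(∫ w in Ω, F w) - s * ∫ w in Ω, f w| ≤ C * ε * (s * ∫ w in Ω, f w) := by
    rw [← integral_const_mul, ← integral_sub hFi hsi, ← integral_const_mul]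
    refine abs_integral_le_integral_abs.trans ?_
    exact setIntegral_mono_on hdi.abs (hsi.const_mul _) hΩm hdist
  have hrr : Real.sqrt ε ^ n ≤ r := by
    rw [hr]
    gcongr
    nlinarith [Real.pi_gt_three]
  have h2 : |(∫ w in Ω, f w) - L * r| ≤ |K| * ε * r := by
    refine hL.trans ?_
    gcongr
    exact le_abs_self K
  have h3 : ∫ w in Ω, f w ≤ (B + |K|) * r := by
    have h4 := (abs_le.1 h2).2
    have h5 : L * r ≤ B * r := by gcongr; exact hBle y hy
    have h6 : |K| * ε * r ≤ |K| * 1 * r := by gcongr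
    linarith
  have hscale : massScale n (φ (x 0)) a ε = s * r := rfl
  rw [hscale]
  refine ⟨hFi, ?_⟩
  change |(∫ w in Ω, F w) - s * r * L| ≤ _
  have h7 : (∫ w in Ω, F w) - s * r * L = ((∫ w in Ω, F w) - s * ∫ w in Ω, f w) +
      s * ((∫ w in Ω, f w) - L * r) := by ring
  rw [h7]
  refine (abs_add_le _ _).trans ?_
  rw [abs_mul, abs_of_pos hs0]
  calc _ ≤ C * ε * (s * ((B + |K|) * r)) + s * (|K| * ε * r) := by
        gcongr
        exact h1.trans (by gcongr)
    _ = _ := by ring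

end IsWKBFamily

namespace IsWKBFamily

variable {n : ℕ} {b : EuclideanSpace ℝ (Fin n) → EuclideanSpace ℝ (Fin n)}
  {D : Matrix (Fin n) (Fin n) ℝ} {x : ℝ → EuclideanSpace ℝ (Fin n)} {T : ℝ}
  {𝒟 : Set (EuclideanSpace ℝ (Fin n))} {φ ω : EuclideanSpace ℝ (Fin n) → ℝ}
  {π : ℝ → EuclideanSpace ℝ (Fin n) → ℝ} {a : ℝ → ℝ} {ε₁ C : ℝ}

theorem integral_normalTube (h : IsWKBFamily b D x T 𝒟 φ ω π a ε₁ C) {δ : ℝ}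
    (hδ : IsTubeRadius b x T 𝒟 φ ω δ) {ε : ℝ} (hε : ε ∈ Ioo 0 ε₁)
    {p : EuclideanSpace ℝ (Fin n) → ℝ} {S : Set ℝ} (hS : MeasurableSet S) (hST : S ⊆ Ico 0 T)
    (hp : IntegrableOn p (normalTube x δ S)) :
    IntegrableOn (fun t => discIntegral b δ ε p (x t) * ‖deriv x t‖) S ∧
    ∫ y in normalTube x δ S, p y = ∫ t in S, discIntegral b δ ε p (x t) * ‖deriv x t‖ :=
  h.orbit.integral_normalTube h.field_contDiff hε.1 hδ.injective (fun t w hw => by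
    have := (abs_le.1 (hδ.curv_le (x t) (mem_range_self t) w hw)).2
    linarith) hS hST hp

theorem exists_abs_integral_normalTube_sub_le (h : IsWKBFamily b D x T 𝒟 φ ω π a ε₁ C) {δ : ℝ}
    (hδ : IsTubeRadius b x T 𝒟 φ ω δ) :
    ∃ K : ℝ, 0 < K ∧ ∀ ε ∈ Ioo 0 ε₁,
      |(∫ y in normalTube x δ (Ico 0 T), π ε y) -
        massScale n (φ (x 0)) a ε * arcIntegral x T (leadingDensity b φ ω)| ≤
        K * ε * massScale n (φ (x 0)) a ε := by
  obtain ⟨K, hK, hKle⟩ := h.exists_abs_discIntegral_sub_le hδ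
  have hci : IntegrableOn (fun t => ‖deriv x t‖) (Ico 0 T) :=
    (h.continuous_norm_deriv.continuousOn.integrableOn_compact isCompact_Icc).mono_set
      Ico_subset_Icc_self
  have hLi : IntegrableOn (fun t => leadingDensity b φ ω (x t) * ‖deriv x t‖) (Ico 0 T) :=
    ((h.continuous_leadingDensity_comp.mul
      h.continuous_norm_deriv).continuousOn.integrableOn_compact isCompact_Icc).mono_set
      Ico_subset_Icc_self
  refine ⟨K * ((∫ t in Ico 0 T, ‖deriv x t‖) + 1), ?_, fun ε hε => ?_⟩
  · have : 0 ≤ ∫ t in Ico 0 T, ‖deriv x t‖ := integral_nonneg fun _ => norm_nonneg _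
    positivity
  have hA := h.massScale_pos hε
  have hε0 := hε.1
  obtain ⟨h1, h2⟩ := h.integral_normalTube hδ hε (p := π ε) measurableSet_Ico subset_rfl
    (h.stationary ε hε).integrable.integrableOn
  rw [h2, arcIntegral, ← integral_const_mul, ← integral_sub h1 (hLi.const_mul _)]
  set A := massScale n (φ (x 0)) a ε
  refine abs_integral_le_integral_abs.trans ?_
  calc _ ≤ ∫ t in Ico 0 T, K * ε * A * ‖deriv x t‖ := by
        refine integral_mono (h1.sub (hLi.const_mul _)).abs (hci.const_mul _) fun t => ?_
        change |discIntegral b δ ε (π ε) (x t) * ‖deriv x t‖ -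
          A * (leadingDensity b φ ω (x t) * ‖deriv x t‖)| ≤ _
        rw [← mul_assoc, ← sub_mul, abs_mul, abs_norm]
        gcongr
        exact (hKle ε hε (x t) (mem_range_self t)).2
    _ ≤ _ := by
        rw [integral_const_mul]
        have : 0 ≤ K * ε * A := by positivity
        linarith

theorem measurableSet_normalTube (h : IsWKBFamily b D x T 𝒟 φ ω π a ε₁ C) (δ : ℝ) :
    MeasurableSet (normalTube x δ (Ico 0 T)) := by
  rw [h.orbit.normalTube_eq]
  exact (isClosed_le (Metric.continuous_infDist_pt _) continuous_const).measurableSet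

/-- On the compact part of 𝒟 at distance at least δ from Γ the rate function has a minimum above its
value on Γ, so the mass there is exponentially small relative to the scale. -/
theorem exists_integral_diff_le (h : IsWKBFamily b D x T 𝒟 φ ω π a ε₁ C) {δ : ℝ} (hδ : 0 < δ) :
    ∃ K : ℝ, 0 < K ∧ ∀ ε ∈ Ioo 0 ε₁, ∫ y in 𝒟 \ normalTube x δ (Ico 0 T), π ε y ≤
      K * ε * massScale n (φ (x 0)) a ε := by
  have hφc := h.rate_contDiff.continuous
  have hωc := h.prefactor_contDiff.continuous
  have hC := h.const_pos
  obtain ⟨B, hB⟩ := h.isCompact.exists_bound_of_continuousOn hωc.continuousOn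
  obtain ⟨c, hc, hcle⟩ : ∃ c : ℝ, φ (x 0) < c ∧
      ∀ y ∈ 𝒟 ∩ {y | δ ≤ Metric.infDist y (range x)}, c ≤ φ y := by
    refine (h.isCompact.inter_right (isClosed_le continuous_const
      (Metric.continuous_infDist_pt _))).exists_forall_le' hφc.continuousOn fun y hy => ?_
    by_contra hcon
    have h1 := h.mem_range_of_rate_le hy.1 (not_lt.1 hcon)
    have h2 : δ ≤ Metric.infDist y (range x) := hy.2
    rw [Metric.infDist_zero_of_mem h1] at h2
    linarith
  set V := volume.real 𝒟
  -- Of the n + 1 powers of ε, n are spent against (2πε)^{(n−1)/2} in the mass scale, and one is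
  -- left for the error.
  set Q := (n + 1).factorial / (c - φ (x 0)) ^ (n + 1) with hQ
  have hc' : 0 < c - φ (x 0) := sub_pos.2 hc
  have hQ0 : 0 < Q := by positivity
  refine ⟨(1 + C) * (|B| + 1) * Q * Real.sqrt (2 * Real.pi) * (V + 1), by positivity,
    fun ε hε => ?_⟩
  have hε0 := hε.1
  have hε1 : ε ≤ 1 := hε.2.le.trans h.eps_le_one
  have ha := h.amplitude_pos ε hε
  have hmeas : MeasurableSet (𝒟 \ normalTube x δ (Ico 0 T)) :=
    h.isCompact.isClosed.measurableSet.diff (h.measurableSet_normalTube δ)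
  set s := a ε * Real.exp (-φ (x 0) / ε) with hs
  have hs0 : 0 < s := by positivity
  have hpt : ∀ y ∈ 𝒟 \ normalTube x δ (Ico 0 T), ‖π ε y‖ ≤
      (1 + C) * (|B| + 1) * s * (Q * ε ^ (n + 1)) := by
    intro y hy
    have h1 := (abs_le.1 (h.abs_sub_le ε hε y hy.1)).2
    have hω := h.prefactor_pos y hy.1
    have hωB : ω y ≤ |B| + 1 :=
      (le_abs_self _).trans ((hB y hy.1).trans (by linarith [le_abs_self B]))
    have h2 : c ≤ φ y := by
      refine hcle y ⟨hy.1, ?_⟩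
      have := hy.2
      rw [h.orbit.normalTube_eq] at this
      exact le_of_lt (not_le.1 (show ¬ Metric.infDist y (range x) ≤ δ from this))
    have h3 : Real.exp (-φ y / ε) ≤ Real.exp (-φ (x 0) / ε) * (Q * ε ^ (n + 1)) := by
      calc Real.exp (-φ y / ε) ≤ Real.exp (-c / ε) := by gcongr
        _ = Real.exp (-φ (x 0) / ε) * Real.exp (-(c - φ (x 0)) / ε) := by
            rw [← Real.exp_add]
            congr 1
            ring
        _ ≤ _ := by
            gcongr
            exact exp_neg_div_le_pow hc' hε0 _
    rw [Real.norm_eq_abs, abs_of_nonneg ((h.stationary ε hε).nonneg y)]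
    have h4 : a ε * (ω y * Real.exp (-φ y / ε)) ≤
        a ε * ((|B| + 1) * (Real.exp (-φ (x 0) / ε) * (Q * ε ^ (n + 1)))) := by gcongr
    have h5 : 0 ≤ a ε * (ω y * Real.exp (-φ y / ε)) := by positivity
    calc π ε y ≤ (1 + C * ε) * (a ε * (ω y * Real.exp (-φ y / ε))) := by linarith
      _ ≤ (1 + C * 1) * (a ε * ((|B| + 1) * (Real.exp (-φ (x 0) / ε) * (Q * ε ^ (n + 1))))) := by
          gcongr
      _ = _ := by rw [hs]; ring
  have hfin : volume (𝒟 \ normalTube x δ (Ico 0 T)) < ⊤ :=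
    (measure_mono sdiff_subset).trans_lt h.isCompact.measure_lt_top
  have h6 := norm_setIntegral_le_of_norm_le_const hfin hpt
  have h7 : volume.real (𝒟 \ normalTube x δ (Ico 0 T)) ≤ V + 1 :=
    (measureReal_mono sdiff_subset h.isCompact.measure_lt_top.ne).trans (by linarith)
  have hscale : s * ε ^ n ≤ Real.sqrt (2 * Real.pi) * massScale n (φ (x 0)) a ε := by
    have e1 : ε ^ n ≤ Real.sqrt (2 * Real.pi * ε) ^ n := by
      gcongr
      refine Real.le_sqrt_of_sq_le ?_
      nlinarith [Real.pi_gt_three]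
    have e2 : 1 ≤ Real.sqrt (2 * Real.pi) / Real.sqrt (2 * Real.pi * ε) := by
      rw [one_le_div (by positivity)]
      refine Real.sqrt_le_sqrt ?_
      nlinarith [Real.pi_gt_three]
    calc s * ε ^ n ≤ s * Real.sqrt (2 * Real.pi * ε) ^ n := by gcongr
      _ ≤ s * Real.sqrt (2 * Real.pi * ε) ^ n *
          (Real.sqrt (2 * Real.pi) / Real.sqrt (2 * Real.pi * ε)) :=
          le_mul_of_one_le_right (by positivity) e2
      _ = _ := by rw [massScale, hs]; ring
  calc _ ≤ (1 + C) * (|B| + 1) * s * (Q * ε ^ (n + 1)) * (V + 1) :=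
        (le_abs_self _).trans (h6.trans (by gcongr))
    _ = (1 + C) * (|B| + 1) * Q * (V + 1) * ε * (s * ε ^ n) := by ring
    _ ≤ (1 + C) * (|B| + 1) * Q * (V + 1) * ε *
        (Real.sqrt (2 * Real.pi) * massScale n (φ (x 0)) a ε) := by
        have : 0 ≤ V := measureReal_nonneg
        gcongr
    _ = _ := by ring

/-- The normalization of the densities fixes the mass scale. -/
theorem exists_abs_massScale_sub_le (h : IsWKBFamily b D x T 𝒟 φ ω π a ε₁ C) {δ : ℝ}
    (hδ : IsTubeRadius b x T 𝒟 φ ω δ) :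
    ∃ K ε₂ : ℝ, 0 < K ∧ 0 < ε₂ ∧ ε₂ ≤ ε₁ ∧ ∀ ε ∈ Ioo 0 ε₂,
      |massScale n (φ (x 0)) a ε - 1 / arcIntegral x T (leadingDensity b φ ω)| ≤ K * ε ∧
      massScale n (φ (x 0)) a ε ≤ K ∧
      ∫ y in (normalTube x δ (Ico 0 T))ᶜ, π ε y ≤ K * ε := by
  obtain ⟨K₁, hK₁, h₁⟩ := h.exists_abs_integral_normalTube_sub_le hδ
  obtain ⟨K₂, hK₂, h₂⟩ := h.exists_integral_diff_le hδ.pos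
  have hZ := h.arcIntegral_leadingDensity_pos
  set Z := arcIntegral x T (leadingDensity b φ ω) with hZdef
  have hC := h.const_pos
  have hε₁ := h.eps_pos
  set N := normalTube x δ (Ico 0 T) with hN
  have hNm : MeasurableSet N := h.measurableSet_normalTube δ
  have hN𝒟 : N ⊆ 𝒟 := by
    rw [hN, h.orbit.normalTube_eq]
    exact hδ.subset
  -- An a priori bound for A: the estimate of |1 − AZ| contains A itself, and the choice of ε₂ makes
  -- that term at most AZ/2, which is absorbed.
  set B := 2 * (1 + C) / Z with hB
  have hB0 : 0 < B := by positivity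
  set Q := (K₁ + K₂) * B + C with hQ
  have hQ0 : 0 < Q := by positivity
  refine ⟨Q / Z + B + Q, min ε₁ (Z / (2 * (K₁ + K₂))), by positivity, by positivity,
    min_le_left _ _, fun ε hε => ?_⟩
  obtain ⟨he1, he2⟩ := lt_min_iff.1 hε.2
  have hε' : ε ∈ Ioo 0 ε₁ := ⟨hε.1, he1⟩
  have hε0 := hε.1
  have hA := h.massScale_pos hε'
  set A := massScale n (φ (x 0)) a ε with hAdef
  have h1 := h₁ ε hε'
  have h2 := h₂ ε hε'
  have h3 := h.integral_compl_le ε hε'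
  have hst := h.stationary ε hε'
  have hi := hst.integrable
  have hnn : ∀ S : Set (EuclideanSpace ℝ (Fin n)), 0 ≤ ∫ y in S, π ε y :=
    fun S => integral_nonneg hst.nonneg
  have e1 : (∫ y in N, π ε y) + ∫ y in Nᶜ, π ε y = 1 := by
    rw [integral_add_compl hNm hi, hst.integral_eq_one]
  have e2 : ∫ y in Nᶜ, π ε y = (∫ y in 𝒟 \ N, π ε y) + ∫ y in 𝒟ᶜ, π ε y := by
    have hset : Nᶜ = (𝒟 \ N) ∪ 𝒟ᶜ := by
      ext z
      have := @hN𝒟 z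
      simp only [mem_compl_iff, mem_union, Set.mem_sdiff]
      tauto
    rw [hset]
    exact setIntegral_union (disjoint_compl_right.mono_left sdiff_subset)
      h.isCompact.isClosed.measurableSet.compl hi.integrableOn hi.integrableOn
  -- Total mass one is split into the tube, the rest of 𝒟, and the outside.
  have hAZ : |1 - A * Z| ≤ (K₁ + K₂) * ε * A + C * ε := by
    have := hnn (𝒟 \ N)
    have := hnn 𝒟ᶜ
    rw [abs_le] at h1 ⊢
    have e0 : 0 ≤ K₂ * ε * A := by positivity
    have e0' : 0 ≤ C * ε := by positivity
    constructor <;> linarith [h1.1, h1.2]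
  have hAB : A ≤ B := by
    have e3 : (K₁ + K₂) * ε ≤ Z / 2 := by
      have := he2.le
      rw [le_div_iff₀ (by positivity)] at this
      linarith
    have e4 : (K₁ + K₂) * ε * A ≤ Z / 2 * A := by gcongr
    have e5 := (abs_le.1 hAZ).1
    have e6 : C * ε ≤ C * 1 := by
      gcongr
      exact he1.le.trans h.eps_le_one
    rw [hB, le_div_iff₀ hZ]
    linarith
  have hAQ : (K₁ + K₂) * ε * A + C * ε ≤ Q * ε := by
    have : (K₁ + K₂) * ε * A ≤ (K₁ + K₂) * ε * B := by gcongr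
    rw [hQ]
    linarith
  refine ⟨?_, ?_, ?_⟩
  · have e7 : A - 1 / Z = -((1 - A * Z) / Z) := by field_simp; ring
    rw [e7, abs_neg, abs_div, abs_of_pos hZ, div_le_iff₀ hZ]
    have e8 : (Q / Z + B + Q) * ε * Z = Q * ε + (B + Q) * ε * Z := by field_simp; ring
    rw [e8]
    have : 0 ≤ (B + Q) * ε * Z := by positivity
    linarith
  · have : 0 < Q / Z := by positivity
    linarith
  · have e9 : K₂ * ε * A ≤ (K₁ + K₂) * ε * A := by
      gcongr
      linarith
    have : 0 ≤ (Q / Z + B) * ε := by positivity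
    rw [e2]
    linarith

theorem isMarginalDensity_discIntegral (h : IsWKBFamily b D x T 𝒟 φ ω π a ε₁ C) {δ : ℝ}
    (hδ : IsTubeRadius b x T 𝒟 φ ω δ) {ε : ℝ} (hε : ε ∈ Ioo 0 ε₁) :
    IsMarginalDensity (π ε) x T δ (discIntegral b δ ε (π ε)) where
  continuousOn := fun _ hy => (continuousAt_discIntegral h.field_contDiff (h.field_ne_zero hy)
    hδ.pos hε.1 (h.stationary ε hε).contDiff.continuous).continuousWithinAt
  mass_eq := fun _ hS hST => (h.integral_normalTube hδ hε hS hST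
    (h.stationary ε hε).integrable.integrableOn).2

/-- The local expansion times the normalized scale; this is the asymptotic formula for the marginal
density. -/
theorem exists_abs_discIntegral_sub_div_le (h : IsWKBFamily b D x T 𝒟 φ ω π a ε₁ C) {δ : ℝ}
    (hδ : IsTubeRadius b x T 𝒟 φ ω δ) :
    ∃ K ε₂ : ℝ, 0 < K ∧ 0 < ε₂ ∧ ε₂ ≤ ε₁ ∧ ∀ ε ∈ Ioo 0 ε₂, ∀ y ∈ range x,
      |discIntegral b δ ε (π ε) y -
        leadingDensity b φ ω y / arcIntegral x T (leadingDensity b φ ω)| ≤ K * ε := by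
  obtain ⟨K₁, hK₁, h₁⟩ := h.exists_abs_discIntegral_sub_le hδ
  obtain ⟨K₂, ε₂, hK₂, hε₂, hε₂₁, h₂⟩ := h.exists_abs_massScale_sub_le hδ
  obtain ⟨B, hB, hBle⟩ := h.exists_leadingDensity_le
  refine ⟨K₁ * K₂ + K₂ * B, ε₂, by positivity, hε₂, hε₂₁, fun ε hε y hy => ?_⟩
  have hε' : ε ∈ Ioo 0 ε₁ := ⟨hε.1, hε.2.trans_le hε₂₁⟩
  have hε0 := hε.1
  have h1 := (h₁ ε hε' y hy).2
  obtain ⟨h2, h3, -⟩ := h₂ ε hε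
  have hL := h.leadingDensity_pos hy
  set L := leadingDensity b φ ω y
  set A := massScale n (φ (x 0)) a ε
  set Z := arcIntegral x T (leadingDensity b φ ω)
  have e : discIntegral b δ ε (π ε) y - L / Z = (discIntegral b δ ε (π ε) y - A * L) +
      (A - 1 / Z) * L := by ring
  rw [e]
  refine (abs_add_le _ _).trans ?_
  rw [abs_mul, abs_of_pos hL]
  calc _ ≤ K₁ * ε * K₂ + K₂ * ε * B := by
        gcongr
        · exact h1.trans (by gcongr)
        · exact hBle y hy
    _ = _ := by ring

end IsWKBFamily

/-! ### The weak limit and its invariance -/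

namespace IsWKBFamily

variable {n : ℕ} {b : EuclideanSpace ℝ (Fin n) → EuclideanSpace ℝ (Fin n)}
  {D : Matrix (Fin n) (Fin n) ℝ} {x : ℝ → EuclideanSpace ℝ (Fin n)} {T : ℝ}
  {𝒟 : Set (EuclideanSpace ℝ (Fin n))} {φ ω : EuclideanSpace ℝ (Fin n) → ℝ}
  {π : ℝ → EuclideanSpace ℝ (Fin n) → ℝ} {a : ℝ → ℝ} {ε₁ C : ℝ}

/-- The integrand of the disc integral is nonnegative, so freezing F at the centre costs at most its
oscillation times the disc integral. -/
theorem abs_discIntegral_mul_sub_le (h : IsWKBFamily b D x T 𝒟 φ ω π a ε₁ C) {δ : ℝ}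
    (hδ : IsTubeRadius b x T 𝒟 φ ω δ) {F : EuclideanSpace ℝ (Fin n) → ℝ} (hF : Continuous F)
    {η : ℝ} (hη : ∀ y v, ‖v‖ ≤ δ → |F (y + v) - F y| ≤ η) {ε : ℝ} (hε : ε ∈ Ioo 0 ε₁)
    {y : EuclideanSpace ℝ (Fin n)} (hy : y ∈ range x) :
    |discIntegral b δ ε (fun z => π ε z * F z) y - F y * discIntegral b δ ε (π ε) y| ≤
      η * discIntegral b δ ε (π ε) y := by
  obtain ⟨K, hK, hKle⟩ := h.exists_abs_discIntegral_sub_le hδ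
  have hi := (hKle ε hε y hy).1
  have hΩm : MeasurableSet {w | ‖normalProj b y w‖ ≤ δ} := measurableSet_normalDisc y δ
  set P := normalProj b y with hP
  set ρ : EuclideanSpace ℝ (Fin n) → ℝ := fun w => π ε (y + P w) *
    ((1 - inner ℝ (curvField b y) w) * gaussWeight ε (inner ℝ (unitField b y) w)) with hρ
  have hρ0 : ∀ w ∈ {w | ‖P w‖ ≤ δ}, 0 ≤ ρ w := by
    intro w hw
    have hκ := (abs_le.1 (hδ.curv_le y hy w hw)).2
    exact mul_nonneg ((h.stationary ε hε).nonneg _) (mul_nonneg (by linarith)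
      (gaussWeight_nonneg _ _))
  have hb1 : ∀ w ∈ {w | ‖P w‖ ≤ δ}, |(F (y + P w) - F y) * ρ w| ≤ η * ρ w := by
    intro w hw
    rw [abs_mul, abs_of_nonneg (hρ0 w hw)]
    exact mul_le_mul_of_nonneg_right (hη y _ hw) (hρ0 w hw)
  have hdi : IntegrableOn (fun w => (F (y + P w) - F y) * ρ w) {w | ‖P w‖ ≤ δ} := by
    refine (hi.const_mul η).mono' ?_ ((ae_restrict_iff' hΩm).2 (Eventually.of_forall hb1))
    exact (Continuous.aestronglyMeasurable (by fun_prop)).mul hi.1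
  have e : discIntegral b δ ε (fun z => π ε z * F z) y =
      (∫ w in {w | ‖P w‖ ≤ δ}, (F (y + P w) - F y) * ρ w) + F y * ∫ w in {w | ‖P w‖ ≤ δ}, ρ w := by
    rw [← integral_const_mul, ← integral_add hdi (hi.const_mul _)]
    refine integral_congr_ae (Eventually.of_forall fun w => ?_)
    simp only [hρ]
    ring
  have e' : discIntegral b δ ε (π ε) y = ∫ w in {w | ‖P w‖ ≤ δ}, ρ w := rfl
  rw [e, e', add_sub_cancel_right, ← integral_const_mul]
  exact abs_integral_le_integral_abs.trans
    (setIntegral_mono_on hdi.abs (hi.const_mul _) hΩm hb1)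

/-- The densities concentrate on the cycle. -/
theorem exists_abs_integral_mul_sub_le (h : IsWKBFamily b D x T 𝒟 φ ω π a ε₁ C)
    {F : EuclideanSpace ℝ (Fin n) → ℝ} (hF : Continuous F) (hFc : HasCompactSupport F)
    {η : ℝ} (hη : 0 < η) :
    ∃ K ε₂ : ℝ, 0 < ε₂ ∧ ε₂ ≤ ε₁ ∧ ∀ ε ∈ Ioo 0 ε₂,
      |(∫ y, π ε y * F y) - arcIntegral x T (fun y => F y * leadingDensity b φ ω y) /
        arcIntegral x T (leadingDensity b φ ω)| ≤ η + K * ε := by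
  obtain ⟨δ₀, hδ₀, hrad⟩ := h.exists_isTubeRadius
  obtain ⟨δ₁, hδ₁, huc⟩ := Metric.uniformContinuous_iff.1
    (hFc.uniformContinuous_of_continuous hF) η hη
  obtain ⟨B, hB⟩ := hF.bounded_above_of_compact_support hFc
  have hB0 : 0 ≤ B := (norm_nonneg _).trans (hB 0)
  -- The tube is thin enough for F to vary by at most η across it; the constant K thus depends on η.
  -- The error has three parts: mass off the tube, variation of F on the discs, and convergence of
  -- the marginal density.
  set δ := min δ₀ (δ₁ / 2)
  have hδ : IsTubeRadius b x T 𝒟 φ ω δ := hrad δ ⟨by positivity, min_le_left _ _⟩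
  have hFδ : ∀ y v, ‖v‖ ≤ δ → |F (y + v) - F y| ≤ η := by
    intro y v hv
    have hlt : dist (y + v) y < δ₁ := by
      rw [dist_eq_norm, add_sub_cancel_left]
      have := hv.trans (min_le_right _ _)
      linarith
    exact (huc hlt).le
  obtain ⟨K₁, ε₂, hK₁, hε₂, hε₂₁, h₁⟩ := h.exists_abs_massScale_sub_le hδ
  obtain ⟨K₂, ε₃, hK₂, hε₃, hε₃₁, h₂⟩ := h.exists_abs_discIntegral_sub_div_le hδ
  set N := normalTube x δ (Ico 0 T) with hN
  have hNm : MeasurableSet N := h.measurableSet_normalTube δ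
  set Z := arcIntegral x T (leadingDensity b φ ω)
  set ℓ := ∫ t in Ico 0 T, ‖deriv x t‖
  have hci : ∀ {f : ℝ → ℝ}, Continuous f → IntegrableOn f (Ico 0 T) := fun hf =>
    (hf.continuousOn.integrableOn_compact isCompact_Icc).mono_set Ico_subset_Icc_self
  have hxc := h.orbit.continuous
  have hdc := h.continuous_norm_deriv
  have hLc := h.continuous_leadingDensity_comp
  refine ⟨B * K₁ + B * K₂ * ℓ, min ε₂ ε₃, by positivity, (min_le_left _ _).trans hε₂₁,
    fun ε hε => ?_⟩
  obtain ⟨he2, he3⟩ := lt_min_iff.1 hε.2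
  have hε0 := hε.1
  have hε' : ε ∈ Ioo 0 ε₁ := ⟨hε.1, he2.trans_le hε₂₁⟩
  have hst := h.stationary ε hε'
  obtain ⟨-, -, h1⟩ := h₁ ε ⟨hε.1, he2⟩
  have h2 := h₂ ε ⟨hε.1, he3⟩
  have hπF : Integrable fun y => π ε y * F y :=
    hst.integrable.mul_bdd (c := B) hF.aestronglyMeasurable (Eventually.of_forall hB)
  have hgc : Continuous fun t => discIntegral b δ ε (π ε) (x t) :=
    (h.isMarginalDensity_discIntegral hδ hε').continuousOn.comp_continuous hxc
      fun t => mem_range_self t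
  obtain ⟨i1, e1⟩ := h.integral_normalTube hδ hε' (p := fun y => π ε y * F y) measurableSet_Ico
    subset_rfl hπF.integrableOn
  obtain ⟨i2, e2⟩ := h.integral_normalTube hδ hε' (p := π ε) measurableSet_Ico
    subset_rfl hst.integrable.integrableOn
  have hFx : Continuous fun t => F (x t) := hF.comp hxc
  have i3 : IntegrableOn (fun t => F (x t) * discIntegral b δ ε (π ε) (x t) * ‖deriv x t‖)
    (Ico 0 T) := hci ((hFx.mul hgc).mul hdc)
  have i4 : IntegrableOn (fun t => F (x t) * leadingDensity b φ ω (x t) * ‖deriv x t‖)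
    (Ico 0 T) := hci ((hFx.mul hLc).mul hdc)
  have s1 : |∫ y in Nᶜ, π ε y * F y| ≤ B * K₁ * ε := by
    refine abs_integral_le_integral_abs.trans ?_
    calc _ ≤ ∫ y in Nᶜ, B * π ε y := by
          refine integral_mono hπF.integrableOn.abs (hst.integrable.integrableOn.const_mul B)
            fun y => ?_
          change |π ε y * F y| ≤ B * π ε y
          rw [abs_mul, abs_of_nonneg (hst.nonneg y), mul_comm]
          exact mul_le_mul_of_nonneg_right (hB y) (hst.nonneg y)
      _ = B * ∫ y in Nᶜ, π ε y := integral_const_mul _ _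
      _ ≤ B * (K₁ * ε) := by gcongr
      _ = _ := by ring
  have s2 : |(∫ y in N, π ε y * F y) -
      ∫ t in Ico 0 T, F (x t) * discIntegral b δ ε (π ε) (x t) * ‖deriv x t‖| ≤ η := by
    rw [e1, ← integral_sub i1 i3]
    refine abs_integral_le_integral_abs.trans ?_
    calc _ ≤ ∫ t in Ico 0 T, η * (discIntegral b δ ε (π ε) (x t) * ‖deriv x t‖) := by
          refine integral_mono (i1.sub i3).abs (i2.const_mul η) fun t => ?_
          change |discIntegral b δ ε (fun y => π ε y * F y) (x t) * ‖deriv x t‖ -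
            F (x t) * discIntegral b δ ε (π ε) (x t) * ‖deriv x t‖| ≤ _
          rw [← sub_mul, abs_mul, abs_norm, ← mul_assoc]
          exact mul_le_mul_of_nonneg_right (h.abs_discIntegral_mul_sub_le hδ hF hFδ hε'
            (mem_range_self t)) (norm_nonneg _)
      _ = η * ∫ y in N, π ε y := by rw [integral_const_mul, e2]
      _ ≤ η * 1 := by
          gcongr
          rw [← hst.integral_eq_one]
          exact setIntegral_le_integral hst.integrable (Eventually.of_forall hst.nonneg)
      _ = η := mul_one η
  have s3 : |(∫ t in Ico 0 T, F (x t) * discIntegral b δ ε (π ε) (x t) * ‖deriv x t‖) -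
      arcIntegral x T (fun y => F y * leadingDensity b φ ω y) / Z| ≤ B * K₂ * ℓ * ε := by
    rw [arcIntegral, ← integral_div, ← integral_sub i3 (i4.div_const _)]
    refine abs_integral_le_integral_abs.trans ?_
    calc _ ≤ ∫ t in Ico 0 T, B * (K₂ * ε) * ‖deriv x t‖ := by
          refine integral_mono (i3.sub (i4.div_const _)).abs (hci (hdc.const_mul _)) fun t => ?_
          change |F (x t) * discIntegral b δ ε (π ε) (x t) * ‖deriv x t‖ -
            F (x t) * leadingDensity b φ ω (x t) * ‖deriv x t‖ / Z| ≤ _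
          have e3 : F (x t) * discIntegral b δ ε (π ε) (x t) * ‖deriv x t‖ -
            F (x t) * leadingDensity b φ ω (x t) * ‖deriv x t‖ / Z = F (x t) *
            (discIntegral b δ ε (π ε) (x t) - leadingDensity b φ ω (x t) / Z) * ‖deriv x t‖ := by
            ring
          rw [e3, abs_mul, abs_mul, abs_norm]
          gcongr
          · exact hB (x t)
          · exact h2 (x t) (mem_range_self t)
      _ = _ := by rw [integral_const_mul]; ring
  rw [← integral_add_compl hNm hπF]
  have e4 : ∀ p q r s : ℝ, p + q - s = (p - r) + (r - s) + q := fun p q r s => by ring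
  rw [e4 _ _ (∫ t in Ico 0 T, F (x t) * discIntegral b δ ε (π ε) (x t) * ‖deriv x t‖)]
  refine (abs_add_three _ _ _).trans ?_
  linarith

/-- The limit of the densities is an invariant measure on the cycle. -/
theorem arcIntegral_fderiv_mul_eq_zero (h : IsWKBFamily b D x T 𝒟 φ ω π a ε₁ C)
    {ψ : EuclideanSpace ℝ (Fin n) → ℝ} (hψ : ContDiff ℝ 2 ψ) (hc : HasCompactSupport ψ) :
    arcIntegral x T (fun y => fderiv ℝ ψ y (b y) * leadingDensity b φ ω y) = 0 := by
  have hb := h.field_contDiff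
  have hZ := h.arcIntegral_leadingDensity_pos
  have hF : Continuous fun y => fderiv ℝ ψ y (b y) :=
    (hψ.continuous_fderiv (by norm_num)).clm_apply hb.continuous
  have hFc : HasCompactSupport fun y => fderiv ℝ ψ y (b y) :=
    HasCompactSupport.intro hc fun y hy => by
      rw [fderiv_of_notMem_tsupport (𝕜 := ℝ) hy]; rfl
  have hG : Continuous (diffOp D ψ) := by
    refine continuous_finsetSum _ fun i _ => ?_
    exact (((hψ.fderiv_right (m := 1) (by norm_num)).clm_apply contDiff_const).continuous_fderiv
      one_ne_zero).clm_apply continuous_const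
  have hGc : HasCompactSupport (diffOp D ψ) := by
    refine HasCompactSupport.intro hc fun y hy => ?_
    refine Finset.sum_eq_zero fun i _ => ?_
    have : y ∉ tsupport fun z => fderiv ℝ ψ z (EuclideanSpace.basisFun (Fin n) ℝ i) :=
      fun hy' => hy (tsupport_fderiv_apply_subset ℝ _ hy')
    rw [fderiv_of_notMem_tsupport (𝕜 := ℝ) this]
    rfl
  obtain ⟨B, hB⟩ := hG.bounded_above_of_compact_support hGc
  set I := arcIntegral x T (fun y => fderiv ℝ ψ y (b y) * leadingDensity b φ ω y)
  set Z := arcIntegral x T (leadingDensity b φ ω)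
  -- By the weak equation the drift integral is −ε times a bounded quantity. For fixed η the limit ε
  -- → 0 leaves η, which is arbitrary.
  have key : |I / Z| ≤ 0 := by
    refine le_of_forall_pos_le_add fun η hη => ?_
    obtain ⟨K, ε₂, hε₂, hε₂₁, hK⟩ := h.exists_abs_integral_mul_sub_le hF hFc hη
    have hbound : ∀ ε ∈ Ioo 0 ε₂, |I / Z| ≤ η + (K + B) * ε := by
      intro ε hε
      have hε0 := hε.1
      have hst := h.stationary ε ⟨hε.1, hε.2.trans_le hε₂₁⟩
      have h1 := hK ε hε
      have i1 : Integrable fun y => π ε y * fderiv ℝ ψ y (b y) :=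
        (hst.contDiff.continuous.mul hF).integrable_of_hasCompactSupport hFc.mul_left
      have i2 : Integrable fun y => π ε y * diffOp D ψ y :=
        (hst.contDiff.continuous.mul hG).integrable_of_hasCompactSupport hGc.mul_left
      have h2 : (∫ y, π ε y * fderiv ℝ ψ y (b y)) = -(ε * ∫ y, π ε y * diffOp D ψ y) := by
        have := hst.integral_generator_eq_zero hb h.posDef hψ hc
        have e : ∀ y, π ε y * (fderiv ℝ ψ y (b y) + ε * diffOp D ψ y) =
            π ε y * fderiv ℝ ψ y (b y) + ε * (π ε y * diffOp D ψ y) := fun y => by ring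
        simp_rw [e] at this
        rw [integral_add i1 (i2.const_mul ε), integral_const_mul] at this
        linarith
      have h3 : |∫ y, π ε y * diffOp D ψ y| ≤ B := by
        refine abs_integral_le_integral_abs.trans ?_
        calc _ ≤ ∫ y, B * π ε y := by
              refine integral_mono i2.abs (hst.integrable.const_mul B) fun y => ?_
              change |π ε y * diffOp D ψ y| ≤ B * π ε y
              rw [abs_mul, abs_of_nonneg (hst.nonneg y), mul_comm]
              exact mul_le_mul_of_nonneg_right (hB y) (hst.nonneg y)
          _ = B := by rw [integral_const_mul, hst.integral_eq_one, mul_one]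
      rw [h2] at h1
      have h4 : ε * |∫ y, π ε y * diffOp D ψ y| ≤ ε * B := by gcongr
      have h5 : |ε * ∫ y, π ε y * diffOp D ψ y| ≤ ε * B := by
        rwa [abs_mul, abs_of_pos hε0]
      rw [abs_le] at h1 h5 ⊢
      constructor <;> linarith [h1.1, h1.2, h5.1, h5.2]
    have hlim : Tendsto (fun ε : ℝ => η + (K + B) * ε) (𝓝[>] 0) (𝓝 (0 + η)) := by
      have hcont : Continuous fun ε : ℝ => η + (K + B) * ε := by fun_prop
      have := hcont.tendsto 0
      rw [mul_zero, add_zero] at this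
      rw [zero_add]
      exact this.mono_left nhdsWithin_le_nhds
    refine ge_of_tendsto hlim ?_
    filter_upwards [Ioo_mem_nhdsGT hε₂] with ε hε using hbound ε hε
  have h0 := abs_nonpos_iff.1 key
  rcases div_eq_zero_iff.1 h0 with h1 | h1
  · exact h1
  · exact absurd h1 hZ.ne'

end IsWKBFamily

/-! ### Constancy of the flux along the cycle -/

namespace IsWKBFamily

variable {n : ℕ} {b : EuclideanSpace ℝ (Fin n) → EuclideanSpace ℝ (Fin n)}
  {D : Matrix (Fin n) (Fin n) ℝ} {x : ℝ → EuclideanSpace ℝ (Fin n)} {T : ℝ}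
  {𝒟 : Set (EuclideanSpace ℝ (Fin n))} {φ ω : EuclideanSpace ℝ (Fin n) → ℝ}
  {π : ℝ → EuclideanSpace ℝ (Fin n) → ℝ} {a : ℝ → ℝ} {ε₁ C : ℝ}

/-- The flux along the cycle is constant. -/
theorem exists_leadingDensity_mul_norm_eq (h : IsWKBFamily b D x T 𝒟 φ ω π a ε₁ C) :
    ∃ c : ℝ, ∀ y ∈ range x, leadingDensity b φ ω y * ‖b y‖ = c := by
  have hb := h.field_contDiff
  have hxc := h.orbit.continuous
  have hT := h.orbit.period_pos
  have hbc := hb.continuous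
  set Φ : EuclideanSpace ℝ (Fin n) → ℝ := fun y => leadingDensity b φ ω y * ‖b y‖ with hΦ
  have hΦ1 : ∀ y ∈ range x, ContDiffAt ℝ 1 Φ y := fun y hy =>
    (h.contDiffAt_leadingDensity hy).mul (hb.contDiffAt.norm ℝ (h.field_ne_zero hy))
  set H : EuclideanSpace ℝ (Fin n) → ℝ := fun y => fderiv ℝ Φ y (b y) with hH
  have hHc : ContinuousOn H (range x) := fun y hy =>
    ((((hΦ1 y hy).fderiv_right (m := 0) (by norm_num)).continuousAt).clm_apply
      hbc.continuousAt).continuousWithinAt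
  have hHx : Continuous fun t => H (x t) := hHc.comp_continuous hxc fun t => mem_range_self t
  have hΦx : ∀ t, HasDerivAt (fun t => Φ (x t)) (H (x t)) t := fun t =>
    ((hΦ1 _ (mem_range_self t)).differentiableAt one_ne_zero).hasFDerivAt.comp_hasDerivAt t
      (h.orbit.solves t)
  -- Integration by parts over one period; boundary terms cancel by periodicity. In time, the
  -- density of the limit measure is Φ, the leading density times the speed, and H is its derivative
  -- along the orbit.
  have hzero : ∀ ψ : EuclideanSpace ℝ (Fin n) → ℝ, ContDiff ℝ 2 ψ → HasCompactSupport ψ →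
      ∫ t in (0 : ℝ)..T, ψ (x t) * H (x t) = 0 := by
    intro ψ hψ hc
    have h1 := h.arcIntegral_fderiv_mul_eq_zero hψ hc
    rw [arcIntegral, integral_Ico_eq_integral_Ioc, ← intervalIntegral.integral_of_le hT.le] at h1
    have hψ' : Continuous fun y => fderiv ℝ ψ y (b y) :=
      (hψ.continuous_fderiv (by norm_num)).clm_apply hbc
    have hψx : ∀ t, HasDerivAt (fun t => ψ (x t)) (fderiv ℝ ψ (x t) (b (x t))) t := fun t =>
      (hψ.differentiable (by norm_num) (x t)).hasFDerivAt.comp_hasDerivAt t (h.orbit.solves t)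
    have h2 := intervalIntegral.integral_mul_deriv_eq_deriv_mul (a := 0) (b := T)
      (u := fun t => ψ (x t)) (v := fun t => Φ (x t))
      (fun t _ => hψx t) (fun t _ => hΦx t) ((hψ'.comp hxc).intervalIntegrable _ _)
      (hHx.intervalIntegrable _ _)
    rw [h2, h.orbit.periodic.eq, sub_self, zero_sub, neg_eq_zero]
    refine Eq.trans ?_ h1
    refine intervalIntegral.integral_congr fun t _ => ?_
    change fderiv ℝ ψ (x t) (b (x t)) * (leadingDensity b φ ω (x t) * ‖b (x t)‖) =
      fderiv ℝ ψ (x t) (b (x t)) * leadingDensity b φ ω (x t) * ‖deriv x t‖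
    rw [h.orbit.deriv_eq]
    ring
  -- Time is pushed forward to ℝⁿ, where the test functions live, so that the fundamental lemma
  -- applies to H on the cycle directly.
  set μ : Measure (EuclideanSpace ℝ (Fin n)) := (volume.restrict (Ioc 0 T)).map x with hμ
  have hxm : Measurable x := hxc.measurable
  have hfin : IsFiniteMeasure μ := by
    rw [hμ]
    infer_instance
  have hΓm : MeasurableSet (range x) := h.orbit.isCompact_range.isClosed.measurableSet
  have hHi : Integrable ((range x).indicator H) μ := by
    rw [integrable_indicator_iff hΓm]
    exact hHc.integrableOn_compact h.orbit.isCompact_range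
  have hae : ∀ᵐ y ∂μ, (range x).indicator H y = 0 := by
    refine ae_eq_zero_of_integral_contDiff_smul_eq_zero hHi.locallyIntegrable fun ψ hψ hc => ?_
    have hm : AEStronglyMeasurable (fun y => ψ y • (range x).indicator H y) μ :=
      hψ.continuous.aestronglyMeasurable.smul hHi.1
    rw [hμ, integral_map hxm.aemeasurable hm, ← intervalIntegral.integral_of_le hT.le]
    refine Eq.trans ?_ (hzero ψ (contDiff_infty.1 hψ 2) hc)
    refine intervalIntegral.integral_congr fun t _ => ?_
    simp only [smul_eq_mul, indicator_of_mem (mem_range_self t)]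
  have hae' := ae_of_ae_map hxm.aemeasurable hae
  -- H vanishes along the orbit at almost every time, and Φ is recovered as its integral.
  have hconst : ∀ t ∈ Icc 0 T, Φ (x t) = Φ (x 0) := by
    intro t ht
    have h3 := intervalIntegral.integral_eq_sub_of_hasDerivAt (a := 0) (b := t)
      (fun s _ => hΦx s) (hHx.intervalIntegrable _ _)
    have h4 : ∫ s in (0 : ℝ)..t, H (x s) = 0 := by
      rw [intervalIntegral.integral_of_le ht.1]
      refine integral_eq_zero_of_ae ?_
      have h5 : ∀ᵐ s ∂volume.restrict (Ioc 0 t), (range x).indicator H (x s) = 0 :=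
        ae_mono (Measure.restrict_mono_set _ (Ioc_subset_Ioc_right ht.2)) hae'
      filter_upwards [h5] with s hs
      rwa [indicator_of_mem (mem_range_self s)] at hs
    linarith
  refine ⟨Φ (x 0), ?_⟩
  rintro _ ⟨t, rfl⟩
  obtain ⟨s, hs, hst⟩ := h.orbit.exists_mem_Ico t
  have := hconst s (Ico_subset_Icc_self hs)
  rwa [← hst] at this

end IsWKBFamily

/-! ### Reduction to globally smooth rate function and prefactor -/

/-- A function that is smooth near a closed set agrees near it with a globally smooth one. -/
theorem ContDiffOn.exists_contDiff_eventuallyEq {E : Type*} [NormedAddCommGroup E]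
    [NormedSpace ℝ E] [FiniteDimensional ℝ E] {k : ℕ} {U s : Set E} {φ : E → ℝ}
    (hφ : ContDiffOn ℝ k φ U) (hU : IsOpen U) (hs : IsClosed s) (hsU : s ⊆ U) :
    ∃ g : E → ℝ, ContDiff ℝ k g ∧ ∀ y ∈ s, g =ᶠ[𝓝 y] φ := by
  -- A cutoff equal to 1 near s and 0 near the complement of U.
  obtain ⟨f, h0, h1, -⟩ := exists_contMDiffMap_zero_one_nhds_of_isClosed (n := k)
    (modelWithCornersSelf ℝ E) hU.isClosed_compl hs (disjoint_compl_left_iff_subset.2 hsU)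
  have hf : ContDiff ℝ k f := f.contMDiff.contDiff
  refine ⟨fun y => f y * φ y, contDiff_iff_contDiffAt.2 fun y => ?_, fun y hy => ?_⟩
  · by_cases hy : y ∈ U
    · exact hf.contDiffAt.mul (hφ.contDiffAt (hU.mem_nhds hy))
    · have h2 : (fun y => f y * φ y) =ᶠ[𝓝 y] fun _ => 0 := by
        filter_upwards [eventually_nhdsSet_iff_forall.1 h0 y hy] with z hz
        rw [hz, zero_mul]
      exact contDiffAt_const.congr_of_eventuallyEq h2
  · filter_upwards [eventually_nhdsSet_iff_forall.1 h1 y hy] with z hz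
    rw [hz, one_mul]

section Congr

variable {n : ℕ} {φ ψ : EuclideanSpace ℝ (Fin n) → ℝ} {y : EuclideanSpace ℝ (Fin n)}

theorem gradient_congr_of_eventuallyEq (h : φ =ᶠ[𝓝 y] ψ) : gradient φ y = gradient ψ y := by
  rw [gradient, gradient, h.fderiv_eq]

theorem hessian_congr_of_eventuallyEq (h : φ =ᶠ[𝓝 y] ψ) : hessian φ y = hessian ψ y := by
  have h1 : gradient φ =ᶠ[𝓝 y] gradient ψ :=
    h.eventuallyEq_nhds.mono fun z hz => gradient_congr_of_eventuallyEq hz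
  rw [hessian, hessian, h1.fderiv_eq]

theorem scaledVariance_congr_of_eventuallyEq (h : φ =ᶠ[𝓝 y] ψ) :
    scaledVariance φ y = scaledVariance ψ y := by
  rw [scaledVariance, scaledVariance, hessian_congr_of_eventuallyEq h]

theorem circField_congr_of_eventuallyEq
    {b : EuclideanSpace ℝ (Fin n) → EuclideanSpace ℝ (Fin n)} {D : Matrix (Fin n) (Fin n) ℝ}
    (h : φ =ᶠ[𝓝 y] ψ) : circField b D φ y = circField b D ψ y := by
  rw [circField, circField, gradient_congr_of_eventuallyEq h]

end Congr

theorem HasWKBForm.congr {n : ℕ} {𝒟 : Set (EuclideanSpace ℝ (Fin n))}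
    {φ ω φ' ω' : EuclideanSpace ℝ (Fin n) → ℝ} {ε₀ : ℝ}
    {π : ℝ → EuclideanSpace ℝ (Fin n) → ℝ} (h : HasWKBForm 𝒟 φ ω ε₀ π)
    (hφ : ∀ y ∈ 𝒟, φ' y = φ y) (hω : ∀ y ∈ 𝒟, ω' y = ω y) : HasWKBForm 𝒟 φ' ω' ε₀ π := by
  obtain ⟨a, C, h⟩ := h
  refine ⟨a, C, fun ε hε => ⟨(h ε hε).1, fun y hy => ?_⟩⟩
  rw [hφ y hy, hω y hy]
  exact (h ε hε).2 y hy

/-! ### Conclusion -/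

theorem mainTheorem5 (n : ℕ)
    -- drift, constant positive definite diffusion matrix
    (b : EuclideanSpace ℝ (Fin n) → EuclideanSpace ℝ (Fin n)) (hb : ContDiff ℝ 1 b)
    (D : Matrix (Fin n) (Fin n) ℝ) (hD : D.PosDef)
    -- the limit cycle `range x` and the compact domain that it attracts
    (x : ℝ → EuclideanSpace ℝ (Fin n)) (T : ℝ) (hx : IsClosedOrbit b x T)
    (𝒟 : Set (EuclideanSpace ℝ (Fin n))) (h𝒟 : IsCompact 𝒟) (h𝒟_reg : 𝒟 ⊆ closure (interior 𝒟))
    (h𝒟_cycle : range x ⊆ interior 𝒟) (h𝒟_attr : AttractedWithin b 𝒟 (range x))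
    -- rate function and prefactor, smooth on a neighbourhood of the domain
    (U : Set (EuclideanSpace ℝ (Fin n))) (hU : IsOpen U) (h𝒟U : 𝒟 ⊆ U)
    (φ ω : EuclideanSpace ℝ (Fin n) → ℝ)
    (hφ : ContDiffOn ℝ 4 φ U) (hω : ContDiffOn ℝ 2 ω U) (hω_pos : ∀ y ∈ 𝒟, 0 < ω y)
    -- on the cycle, zero is at most a simple eigenvalue of the Hessian
    (hφ_ker : ∀ y ∈ range x, Module.finrank ℝ (LinearMap.ker (hessian φ y)) ≤ 1)
    -- stationary densities, of WKB form on the domain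
    (ε₀ : ℝ) (hε₀ : 0 < ε₀) (π : ℝ → EuclideanSpace ℝ (Fin n) → ℝ)
    (hπ : ∀ ε ∈ Ioo 0 ε₀, IsStationaryDensity b D ε (π ε))
    (hπ_wkb : HasWKBForm 𝒟 φ ω ε₀ π)
    (hπ_out : ∃ C : ℝ, ∀ ε ∈ Ioo 0 ε₀, ∫ y in 𝒟ᶜ, π ε y ≤ C * ε) :
    (∃ c : ℝ, ∀ y ∈ range x,
      Real.sqrt (scaledVariance φ y) * ‖ω y • circField b D φ y‖ = c) ∧
    ∃ K : ℝ, ∃ δ₀ : ℝ, 0 < δ₀ ∧ ∀ δ ∈ Ioo 0 δ₀, ∃ C ε₁ : ℝ, 0 < ε₁ ∧ ∀ ε ∈ Ioo 0 ε₁,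
      ∃ g : EuclideanSpace ℝ (Fin n) → ℝ, IsMarginalDensity (π ε) x T δ g ∧
        ∀ y ∈ range x,
          |g y - ω y * Real.sqrt (scaledVariance φ y) /
              arcIntegral x T (fun z => ω z * Real.sqrt (scaledVariance φ z))| ≤ C * ε ∧
          |g y * ‖circField b D φ y‖ - K| ≤ C * ε := by
  -- The extensions agree with φ and ω near each point of 𝒟, so gradients, Hessians and the WKB form
  -- are unchanged there.
  obtain ⟨φ', hφ', hφφ'⟩ := ContDiffOn.exists_contDiff_eventuallyEq (k := 4) hφ hU h𝒟.isClosed h𝒟U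
  obtain ⟨ω', hω', hωω'⟩ := ContDiffOn.exists_contDiff_eventuallyEq (k := 2) hω hU h𝒟.isClosed h𝒟U
  have hωe : ∀ y ∈ 𝒟, ω' y = ω y := fun y hy => (hωω' y hy).eq_of_nhds
  have hω'_pos : ∀ y ∈ 𝒟, 0 < ω' y := fun y hy => by
    rw [hωe y hy]
    exact hω_pos y hy
  have hw' : HasWKBForm 𝒟 φ' ω' ε₀ π :=
    hπ_wkb.congr (fun y hy => (hφφ' y hy).eq_of_nhds) hωe
  have hΓ : range x ⊆ 𝒟 := h𝒟_cycle.trans interior_subset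
  obtain ⟨a, C, ε₁, hC, hε₁, hε₁₀, hε₁1, habs⟩ := hw'.exists_bound hε₀ hω'_pos
  obtain ⟨Co, hCo⟩ := hπ_out
  have h : IsWKBFamily b D x T 𝒟 φ' ω' π a ε₁ (C + |Co|) :=
    { field_contDiff := hb
      posDef := hD
      orbit := hx
      isCompact := h𝒟
      cycle_subset := h𝒟_cycle
      attracted := h𝒟_attr
      rate_contDiff := hφ'
      prefactor_contDiff := hω'
      prefactor_pos := hω'_pos
      hamilton_jacobi := fderiv_circField_eq_zero hb hD h𝒟 h𝒟_reg (hφ'.of_le (by norm_num))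
        hω'.continuous hω'_pos hε₀ hπ hw'
      finrank_ker_le := fun y hy => by
        rw [hessian_congr_of_eventuallyEq (hφφ' y (hΓ hy))]
        exact hφ_ker y hy
      eps_pos := hε₁
      eps_le_one := hε₁1
      const_pos := by positivity
      stationary := fun ε hε => hπ ε ⟨hε.1, hε.2.trans_le hε₁₀⟩
      amplitude_pos := fun ε hε => (habs ε hε).1
      abs_sub_le := fun ε hε y hy => by
        refine ((habs ε hε).2 y hy).trans ?_
        have h1 := (habs ε hε).1
        have h2 := hω'_pos y hy
        have h3 := hε.1
        gcongr
        linarith [abs_nonneg Co]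
      integral_compl_le := fun ε hε => by
        refine (hCo ε ⟨hε.1, hε.2.trans_le hε₁₀⟩).trans ?_
        have h3 := hε.1
        gcongr
        linarith [le_abs_self Co] }
  -- The gradient of φ vanishes on the cycle.
  have hγ : ∀ y ∈ range x, circField b D φ y = b y := by
    intro y hy
    rw [← circField_congr_of_eventuallyEq (hφφ' y (hΓ hy))]
    obtain ⟨t, rfl⟩ := hy
    rw [circField, h.gradient_eq_zero t, diffAct_eq, map_zero, add_zero]
  have hL : ∀ y ∈ range x, ω y * Real.sqrt (scaledVariance φ y) = leadingDensity b φ' ω' y := by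
    intro y hy
    rw [← scaledVariance_congr_of_eventuallyEq (hφφ' y (hΓ hy)), ← hωe y (hΓ hy),
      hx.sqrt_scaledVariance hb (hφ'.of_le (by norm_num)) h.gradient_eq_zero h.finrank_ker_le hy,
      leadingDensity, mul_one_div]
  have hZ : arcIntegral x T (fun z => ω z * Real.sqrt (scaledVariance φ z)) =
      arcIntegral x T (leadingDensity b φ' ω') := by
    simp only [arcIntegral, hL _ (mem_range_self _)]
  obtain ⟨c, hc⟩ := h.exists_leadingDensity_mul_norm_eq
  refine ⟨⟨c, fun y hy => ?_⟩, ?_⟩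
  · rw [hγ y hy, norm_smul, Real.norm_eq_abs, abs_of_pos (hω_pos y (hΓ hy)), ← mul_assoc,
      mul_comm (Real.sqrt _), hL y hy, hc y hy]
  obtain ⟨δ₀, hδ₀, hrad⟩ := h.exists_isTubeRadius
  obtain ⟨-, B, -, -, hB, -, -, hBle, -⟩ := hx.exists_bounds hb
  -- K is the constant flux divided by the normalization; it does not depend on δ.
  refine ⟨c / arcIntegral x T (leadingDensity b φ' ω'), δ₀, hδ₀, fun δ hδ => ?_⟩
  have hδ' := hrad δ ⟨hδ.1, hδ.2.le⟩
  obtain ⟨K, ε₂, hK, hε₂, hε₂₁, hg⟩ := h.exists_abs_discIntegral_sub_div_le hδ'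
  -- One constant for both estimates: the second is the first multiplied by ‖b‖ ≤ B.
  refine ⟨K * (1 + B), ε₂, hε₂, fun ε hε => ⟨discIntegral b δ ε (π ε),
    h.isMarginalDensity_discIntegral hδ' ⟨hε.1, hε.2.trans_le hε₂₁⟩, fun y hy => ?_⟩⟩
  have hε0 := hε.1
  have h1 := hg ε hε y hy
  have hBy : ‖b y‖ ≤ B := by
    obtain ⟨t, rfl⟩ := hy
    exact hBle t
  constructor
  · rw [hL y hy, hZ]
    have : 0 ≤ K * B * ε := by positivity
    linarith
  · rw [hγ y hy, ← hc y hy, mul_div_right_comm, ← sub_mul, abs_mul, abs_norm]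
    calc _ ≤ K * ε * B := by gcongr
      _ ≤ _ := by
        have : 0 ≤ K * ε := by positivity
        linarith
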